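/- Types are $A ::= a \mid A\to A \mid \Box A$, with $a$ ranging over a countable set of atoms. Modal $\lambda$-terms are $M,N ::= x \mid \lambda x^A.M \mid MN \mid M[N_1,\dots,N_n/x_1,\dots,x_n]$ with $n\ge 0$ and distinct $x_i$, where the explicit substitution $[\vec N/\vec x]$ binds $x_1,\dots,x_n$ in $M$ and $\mathrm{FV}(M[\vec N/\vec x])=\bigcup_i \mathrm{FV}(N_i)$. Terms are taken modulo $\alpha$-equivalence and modulo simultaneous permutation of $\vec N$ and $\vec x$ in explicit substitutions. The typing rules are: $\Gamma\vdash x:A$ if $x:A\in\Gamma$; from $\Gamma,x:A\vdash M:C$ infer $\Gamma\vdash\lambda x^A.M:A\to C$; from $\Gamma\vdash M:A\to C$ and $\Gamma\vdash N:A$ infer $\Gamma\vdash MN:C$; from $\Gamma\vdash N_i:\Box A_i$ ($1\le i\le n$) and $x_1:A_1,\dots,x_n:A_n\vdash M:C$ infer $\Gamma\vdash M[\vec N/\vec x]:\Box C$. A term is typable in $\Gamma$ if $\Gamma\vdash M:A$ is derivable for some $A$. Write $M\{N/x\}$ for capture-avoiding substitution. The ground steps are: - $\beta$: $(\lambda x^A.M)N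 \rightsquigarrow M\{N/x\}$, and $M[\vec P,R[\vec N/\vec z],\vec Q/\vec x,y,\vec w]\rightsquigarrow M\{R/y\}[\vec P,\vec N,\vec Q/\vec x,\vec z,\vec w]$; - $\eta_1$: $M\rightsquigarrow\lambda x^A.Mx$ if $M$ has type $A\to B$ in the typing context at its position, $x\notin \mathrm{FV}(M)$, and $M$ is not a $\lambda$-abstraction; - $\eta_2$: $M\rightsquigarrow x[M/x]$ if $M$ has type $\Box A$ in the typing context at its position, $x\notin\mathrm{FV}(M)$, and $M$ is not an explicit substitution; - $\kappa$: $M[\vec P,N,\vec Q/\vec x,y,\vec z]\rightsquigarrow M[\vec P,\vec Q/\vec x,\vec z]$ if $y$ does not occur free in $M$, and $M[\vec P,N,N,\vec Q/\vec x,y_1,y_2,\vec z]\rightsquigarrow M\{v,v/y_1,y_2\}[\vec P,N,\vec Q/\vec x,v,\vec z]$ with $v$ fresh. The reductions $\rightsquigarrow_\beta$ and $\rightsquigarrow_\kappa$ are the closures of their ground steps under all one-hole contexts. The reduction $\rightsquigarrow_\eta$, on terms typed in $\Gamma$, is the union of the closure of $\eta_1$ under one-hole contexts whose hole is not the function part $M$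 of an application $MN$ and of the closure of $\eta_2$ under one-hole contexts whose hole is not one of the arguments $N_i$ of an explicit substitution $M[\vec N/\vec x]$; the typing context at the hole is the one determined by $\Gamma$. **Proposition.** For every context $\Gamma$, on the modal $\lambda$-terms typable in $\Gamma$: 1. $\rightsquigarrow_\beta$ is strongly normalizing and confluent; 2. $\rightsquigarrow_\eta$ is strongly normalizing and confluent; 3. $\rightsquigarrow_\kappa$ is strongly normalizing and confluent. -/

import Mathlib

namespace ModalLambda

/-- Types: propositional atoms from a countable set, implication and box. -/
inductive Ty : Type
  | atom (a : ℕ) : Ty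
  | arr (A B : Ty) : Ty
  | box (A : Ty) : Ty

/-- Modal `λ`-terms up to `α`-equivalence, in de Bruijn notation, with the type of the bound
variable written on an abstraction (`λ x^A. M`).  `sub M [N₀, …, N_{n-1}]` is the explicit
substitution `M[N₀, …, N_{n-1} / x₀, …, x_{n-1}]`: it binds the variables `0, …, n-1` of `M`,
index `i` standing for `x_i`. -/
inductive Tm : Type
  | var (i : ℕ) : Tm
  | lam (A : Ty) (M : Tm) : Tm
  | app (M N : Tm) : Tm
  | sub (M : Tm) (Ns : List Tm) : Tm

/-- Extension of a renaming under one binder. -/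
def upRen (f : ℕ → ℕ) : ℕ → ℕ
  | 0 => 0
  | i + 1 => f i + 1

mutual
/-- Renaming of free variables.  As `FV (M[N/x]) = ⋃ᵢ FV Nᵢ`, the body of an explicit
substitution is left alone. -/
def Tm.rename (f : ℕ → ℕ) : Tm → Tm
  | .var i => .var (f i)
  | .lam A M => .lam A (Tm.rename (upRen f) M)
  | .app M N => .app (Tm.rename f M) (Tm.rename f N)
  | .sub M Ns => .sub M (Tm.renameList f Ns)
/-- Renaming, on lists of terms. -/
def Tm.renameList (f : ℕ → ℕ) : List Tm → List Tm
  | [] => []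
  | N :: Ns => Tm.rename f N :: Tm.renameList f Ns
end

/-- Extension of a substitution under one binder. -/
def upSubst (s : ℕ → Tm) : ℕ → Tm
  | 0 => .var 0
  | i + 1 => (s i).rename Nat.succ

mutual
/-- Simultaneous capture-avoiding substitution. -/
def Tm.subst (s : ℕ → Tm) : Tm → Tm
  | .var i => s i
  | .lam A M => .lam A (Tm.subst (upSubst s) M)
  | .app M N => .app (Tm.subst s M) (Tm.subst s N)
  | .sub M Ns => .sub M (Tm.substList s Ns)
/-- Substitution, on lists of terms. -/
def Tm.substList (s : ℕ → Tm) : List Tm → List Tm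
  | [] => []
  | N :: Ns => Tm.subst s N :: Tm.substList s Ns
end

mutual
/-- Number of free occurrences of the variable `x` in a term. -/
def Tm.count (x : ℕ) : Tm → ℕ
  | .var i => if i = x then 1 else 0
  | .lam _ M => Tm.count (x + 1) M
  | .app M N => Tm.count x M + Tm.count x N
  | .sub _ Ns => Tm.countList x Ns
/-- Number of free occurrences of the variable `x` in a list of terms. -/
def Tm.countList (x : ℕ) : List Tm → ℕ
  | [] => 0
  | N :: Ns => Tm.count x N + Tm.countList x Ns
end

/-- Contexts: index `i` is declared with the `i`-th type of the list. -/
abbrev Ctx : Type := List Ty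

/-- Derivable type assignments `Γ ⊢ M : A` of the natural deduction system. -/
inductive HasType : Ctx → Tm → Ty → Prop
  | id {Γ : Ctx} {i : ℕ} {A : Ty} : Γ[i]? = some A → HasType Γ (.var i) A
  | abs {Γ : Ctx} {M : Tm} {A C : Ty} :
      HasType (A :: Γ) M C → HasType Γ (.lam A M) (.arr A C)
  | app {Γ : Ctx} {M N : Tm} {A C : Ty} :
      HasType Γ N A → HasType Γ M (.arr A C) → HasType Γ (.app M N) C
  | boxSubst {Γ Δ : Ctx} {M : Tm} {Ns : List Tm} {C : Ty} :
      Ns.length = Δ.length →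
      (∀ p ∈ List.zip Ns Δ, HasType Γ p.1 (.box p.2)) →
      HasType Δ M C → HasType Γ (.sub M Ns) (.box C)

/-- Action on indices of a permutation of the `n` variables bound by an explicit substitution. -/
def permIdx {n : ℕ} (σ : Equiv.Perm (Fin n)) (i : ℕ) : ℕ :=
  if h : i < n then (σ ⟨i, h⟩ : ℕ) else i

/-- The congruence generated by
`M[N₁, …, Nₙ / x₁, …, xₙ] = M[N_{σ(1)}, …, N_{σ(n)} / x_{σ(1)}, …, x_{σ(n)}]`.
After the permutation, the variable `x_j` is the one with index `σ⁻¹ j`. -/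
inductive PermEq : Tm → Tm → Prop
  | perm {n : ℕ} (σ : Equiv.Perm (Fin n)) (M : Tm) (N : Fin n → Tm) :
      PermEq (.sub M (List.ofFn N))
        (.sub (M.rename (permIdx σ⁻¹)) (List.ofFn fun i => N (σ i)))
  | lam {A : Ty} {M M' : Tm} : PermEq M M' → PermEq (.lam A M) (.lam A M')
  | app {M M' N N' : Tm} : PermEq M M' → PermEq N N' → PermEq (.app M N) (.app M' N')
  | body {M M' : Tm} {Ns : List Tm} : PermEq M M' → PermEq (.sub M Ns) (.sub M' Ns)
  | arg {M N N' : Tm} {Ps Qs : List Tm} : PermEq N N' →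
      PermEq (.sub M (Ps ++ N :: Qs)) (.sub M (Ps ++ N' :: Qs))
  | refl (M : Tm) : PermEq M M
  | symm {M N : Tm} : PermEq M N → PermEq N M
  | trans {M N P : Tm} : PermEq M N → PermEq N P → PermEq M P

instance permSetoid : Setoid Tm where
  r := PermEq
  iseqv := ⟨PermEq.refl, PermEq.symm, PermEq.trans⟩

/-- Modal `λ`-terms: modulo `α`-equivalence and permutations of explicit substitutions. -/
abbrev Term : Type := Quotient permSetoid

/-- `Γ ⊢ t : A` is derivable. -/
def Typed (Γ : Ctx) (t : Term) (A : Ty) : Prop :=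
  ∃ M : Tm, Quotient.mk permSetoid M = t ∧ HasType Γ M A

/-- Terms with a hole. -/
inductive Hole : Type
  | hole : Hole
  | lam (A : Ty) (C : Hole) : Hole
  | appR (M : Tm) (C : Hole) : Hole
  | appL (C : Hole) (M : Tm) : Hole
  | body (C : Hole) (Ms : List Tm) : Hole
  | arg (M : Tm) (Ps : List Tm) (C : Hole) (Qs : List Tm) : Hole

/-- `C⟨M⟩`: the hole is replaced by `M`; the variables of `M` may be captured. -/
def Hole.fill : Hole → Tm → Tm
  | .hole, M => M
  | .lam A C, M => .lam A (C.fill M)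
  | .appR P C, M => .app P (C.fill M)
  | .appL C P, M => .app (C.fill M) P
  | .body C Ms, M => .sub (C.fill M) Ms
  | .arg P Ps C Qs, M => .sub P (Ps ++ C.fill M :: Qs)

/-- The terms with a hole allowed for `η₁`: the hole is not the function part of an
application. -/
def Hole.IsEta1 : Hole → Prop
  | .hole => True
  | .lam _ C => C.IsEta1
  | .appR _ C => C.IsEta1
  | .appL C _ => C ≠ .hole ∧ C.IsEta1
  | .body C _ => C.IsEta1
  | .arg _ _ C _ => C.IsEta1

/-- The terms with a hole allowed for `η₂`: the hole is not an argument of an explicit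
substitution. -/
def Hole.IsEta2 : Hole → Prop
  | .hole => True
  | .lam _ C => C.IsEta2
  | .appR _ C => C.IsEta2
  | .appL C _ => C.IsEta2
  | .body C _ => C.IsEta2
  | .arg _ _ C _ => C ≠ .hole ∧ C.IsEta2

/-- `HoleCtx Γ C Δ`: if the free variables of `C` are typed by `Γ`, then `Δ` types the variables
available at its hole. -/
inductive HoleCtx : Ctx → Hole → Ctx → Prop
  | hole {Γ : Ctx} : HoleCtx Γ .hole Γ
  | lam {Γ Δ : Ctx} {A : Ty} {C : Hole} : HoleCtx (A :: Γ) C Δ → HoleCtx Γ (.lam A C) Δ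
  | appR {Γ Δ : Ctx} {M : Tm} {C : Hole} : HoleCtx Γ C Δ → HoleCtx Γ (.appR M C) Δ
  | appL {Γ Δ : Ctx} {M : Tm} {C : Hole} : HoleCtx Γ C Δ → HoleCtx Γ (.appL C M) Δ
  | body {Γ Δ Θ : Ctx} {C : Hole} {Ms : List Tm} :
      Ms.length = Θ.length →
      (∀ p ∈ List.zip Ms Θ, HasType Γ p.1 (.box p.2)) →
      HoleCtx Θ C Δ → HoleCtx Γ (.body C Ms) Δ
  | arg {Γ Δ : Ctx} {M : Tm} {Ps Qs : List Tm} {C : Hole} :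
      HoleCtx Γ C Δ → HoleCtx Γ (.arg M Ps C Qs) Δ

/-- The substitution `{N/x}` for the variable `x` of index `0`, which disappears. -/
def inst (N : Tm) : ℕ → Tm
  | 0 => N
  | i + 1 => .var i

/-- The substitution `{R/y}`, where `y` is the variable of index `p` of the body of an explicit
substitution, and is replaced by `k` new variables `p, …, p + k - 1`, namely those of `R`. -/
def spliceSubst (p k : ℕ) (R : Tm) (i : ℕ) : Tm :=
  if i < p then .var i
  else if i = p then R.rename (fun j => p + j)
  else .var (i - 1 + k)

/-- The renaming that lowers by one the indices above `p`: it identifies `p + 1` with `p`, and,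
where `p` does not occur, closes the gap at `p`. -/
def lower (p i : ℕ) : ℕ := if i ≤ p then i else i - 1

/-- Ground `β₁` and `β₂` steps. -/
inductive BetaGround : Tm → Tm → Prop
  | beta1 (A : Ty) (M N : Tm) : BetaGround (.app (.lam A M) N) (M.subst (inst N))
  | beta2 (M R : Tm) (Ps Ns Qs : List Tm) :
      BetaGround (.sub M (Ps ++ .sub R Ns :: Qs))
        (.sub (M.subst (spliceSubst Ps.length Ns.length R)) (Ps ++ Ns ++ Qs))

/-- Ground `κ₁` and `κ₂` steps. -/
inductive KappaGround : Tm → Tm → Prop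
  | kappa1 (M N : Tm) (Ps Qs : List Tm) : M.count Ps.length = 0 →
      KappaGround (.sub M (Ps ++ N :: Qs)) (.sub (M.rename (lower Ps.length)) (Ps ++ Qs))
  | kappa2 (M N : Tm) (Ps Qs : List Tm) :
      KappaGround (.sub M (Ps ++ N :: N :: Qs))
        (.sub (M.rename (lower Ps.length)) (Ps ++ N :: Qs))

/-- Ground `η₁` steps `M ⇝ λ x^A. M x` at `Γ ⊢ M : A → B`, for `M` not an abstraction. -/
inductive Eta1Ground (Γ : Ctx) : Tm → Tm → Prop
  | eta1 {M : Tm} {A B : Ty} : HasType Γ M (.arr A B) → (∀ A' P, M ≠ .lam A' P) →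
      Eta1Ground Γ M (.lam A (.app (M.rename Nat.succ) (.var 0)))

/-- Ground `η₂` steps `M ⇝ x[M/x]` at `Γ ⊢ M : □A`, for `M` not an explicit substitution. -/
inductive Eta2Ground (Γ : Ctx) : Tm → Tm → Prop
  | eta2 {M : Tm} {A : Ty} : HasType Γ M (.box A) → (∀ P Ns, M ≠ .sub P Ns) →
      Eta2Ground Γ M (.sub (.var 0) [M])

/-- One `β` step, on representatives. -/
inductive BetaStep : Tm → Tm → Prop
  | mk (C : Hole) {M N : Tm} : BetaGround M N → BetaStep (C.fill M) (C.fill N)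

/-- One `κ` step, on representatives. -/
inductive KappaStep : Tm → Tm → Prop
  | mk (C : Hole) {M N : Tm} : KappaGround M N → KappaStep (C.fill M) (C.fill N)

/-- One restricted `η`-expansion step, on representatives, for terms typed in `Γ`. -/
inductive EtaStep (Γ : Ctx) : Tm → Tm → Prop
  | eta1 {E : Hole} {Δ : Ctx} {M N : Tm} : E.IsEta1 → HoleCtx Γ E Δ →
      Eta1Ground Δ M N → EtaStep Γ (E.fill M) (E.fill N)
  | eta2 {D : Hole} {Δ : Ctx} {M N : Tm} : D.IsEta2 → HoleCtx Γ D Δ →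
      Eta2Ground Δ M N → EtaStep Γ (D.fill M) (D.fill N)

/-- The reduction `β` on terms. -/
def Beta : Term → Term → Prop :=
  Relation.Map BetaStep (Quotient.mk permSetoid) (Quotient.mk permSetoid)

/-- The reduction `κ` on terms. -/
def Kappa : Term → Term → Prop :=
  Relation.Map KappaStep (Quotient.mk permSetoid) (Quotient.mk permSetoid)

/-- The reduction `η` (restricted expansion) on terms typed in `Γ`. -/
def Eta (Γ : Ctx) : Term → Term → Prop :=
  Relation.Map (EtaStep Γ) (Quotient.mk permSetoid) (Quotient.mk permSetoid)

/-- `t` is strongly normalizing: the relation is well-founded below `t`. -/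
def StronglyNormalizing (r : Term → Term → Prop) (t : Term) : Prop :=
  Acc (fun a b => r b a) t

/-- Any two reduction sequences from `t` can be joined. -/
def Confluent (r : Term → Term → Prop) (t : Term) : Prop :=
  ∀ u v : Term, Relation.ReflTransGen r t u → Relation.ReflTransGen r t v →
    ∃ w : Term, Relation.ReflTransGen r u w ∧ Relation.ReflTransGen r v w

end ModalLambda

/-!
Terms modulo permutation are a quotient of the de Bruijn terms `Tm`, and most arguments take place
on representatives.  The link is the relation `PE`, a syntax-directed form of the generating
equivalence: two explicit substitutions are related if, for one permutation `σ` of their arguments,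
the bodies are related after renaming along `σ` and each argument is related to its counterpart
(`mk_eq_mk`).  The steps of `β` and `κ` are the congruence closures
`Cl` of their ground steps.

**Normalization of `β`.** The proof is by reducibility (`RED`). At a type `□A` the elimination is
the merging step `β₂`, which puts the body of an argument into the surrounding body and the
arguments of that argument into the surrounding list. Repeated merging can substitute for a variable
any term `S` with `Flat N S`, where `N` is the argument bound to that variable; a term `N` of type
`□A` is therefore called reducible if it is strongly normalizing and every such `S` is reducible at
`A`. An explicit substitution whose body is reducible under all these instances (`Good`) keeps this
property along every step (`Good.body`, `Good.arg`, `Good.beta`). It is strongly normalizing if its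
arguments are (`Good.sn`): a step within an argument, and a step `β₂`, replaces one element of the
multiset of arguments by smaller ones, in the well-founded order in which a strongly normalizing
term is above its reducts and its arguments, and a step in the body leaves the multiset as it is and
reduces a strongly normalizing term.

**Confluence of `β`.**  Typed representatives are locally confluent (`HasType.betaJoin`), hence
confluent by Newman's lemma.  The interesting pairs are two steps `β₂` on the same explicit
substitution, at different arguments or one inside the other; the former commute because the body
of a typed explicit substitution has no free variables besides those it binds.  Since `PE` is a
bisimulation for `β` on typed terms (`PE.beta`), both properties pass to the quotient.

**`κ`.**  Each step decreases the size, so it suffices to show that a typed term has at most one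
normal form.  The unshared form of a term (`Tm.unshare`), in which each variable bound by an
explicit substitution is replaced with its argument, is invariant under `κ` and under permutations.
In a normal form all the variables bound by an explicit substitution occur and its arguments are
pairwise different, and a term of this kind can be recovered from its unshared form up to a
permutation (`KappaNF.pe_of_unshare_eq`): the occurrences of `unbox` tell which arguments there are,
and equal ones must have been the same.

**`η`.**  The restrictions on the contexts are recorded by a flag (`EtaRed`), which tells whether
the root of a term may be expanded.  A subterm that may be expanded, and is not yet an abstraction
or an explicit substitution, is given a weight that depends on its type, and a step decreases the
total weight (`EtaRed.etaMeasure_lt`).  For confluence, a long normal form of a typed term is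
defined by recursion, by expanding all the subterms that may be expanded (`Tm.core`, `expand`).
It is invariant under the steps (`EtaRed.expand_core`), and every term reduces to it
(`HasType.etaStar_core`, `HasType.etaStar_expand`), so any two reducts of a term have it as a common
reduct.
-/

namespace ModalLambda

open Relation

/-! ### Terms, renaming and substitution -/

/-- Structural induction on terms, with an induction hypothesis for every argument of an explicit
substitution. -/
@[elab_as_elim, induction_eliminator]
theorem Tm.ind {P : Tm → Prop} (var : ∀ i, P (.var i)) (lam : ∀ A M, P M → P (.lam A M))
    (app : ∀ M N, P M → P N → P (.app M N))
    (sub : ∀ M Ns, P M → (∀ N ∈ Ns, P N) → P (.sub M Ns)) (M : Tm) : P M :=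
  Tm.rec (motive_1 := P) (motive_2 := fun Ns => ∀ N ∈ Ns, P N) var lam app sub
    (by simp) (fun N Ns h1 h2 => by simpa using ⟨h1, h2⟩) M

theorem Tm.renameList_eq_map (f : ℕ → ℕ) (Ns : List Tm) :
    Tm.renameList f Ns = Ns.map (Tm.rename f) := by
  induction Ns with
  | nil => rfl
  | cons N Ns ih => simp [Tm.renameList, ih]

theorem Tm.substList_eq_map (s : ℕ → Tm) (Ns : List Tm) :
    Tm.substList s Ns = Ns.map (Tm.subst s) := by
  induction Ns with
  | nil => rfl
  | cons N Ns ih => simp [Tm.substList, ih]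

@[simp] theorem Tm.rename_var (f : ℕ → ℕ) (i : ℕ) : (Tm.var i).rename f = .var (f i) := rfl
@[simp] theorem Tm.rename_lam (f : ℕ → ℕ) (A : Ty) (M : Tm) :
    (Tm.lam A M).rename f = .lam A (M.rename (upRen f)) := rfl
@[simp] theorem Tm.rename_app (f : ℕ → ℕ) (M N : Tm) :
    (Tm.app M N).rename f = .app (M.rename f) (N.rename f) := rfl
@[simp] theorem Tm.rename_sub (f : ℕ → ℕ) (M : Tm) (Ns : List Tm) :
    (Tm.sub M Ns).rename f = .sub M (Ns.map (Tm.rename f)) := by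
  simp [Tm.rename, Tm.renameList_eq_map]
@[simp] theorem Tm.subst_var (s : ℕ → Tm) (i : ℕ) : (Tm.var i).subst s = s i := rfl
@[simp] theorem Tm.subst_lam (s : ℕ → Tm) (A : Ty) (M : Tm) :
    (Tm.lam A M).subst s = .lam A (M.subst (upSubst s)) := rfl
@[simp] theorem Tm.subst_app (s : ℕ → Tm) (M N : Tm) :
    (Tm.app M N).subst s = .app (M.subst s) (N.subst s) := rfl
@[simp] theorem Tm.subst_sub (s : ℕ → Tm) (M : Tm) (Ns : List Tm) :
    (Tm.sub M Ns).subst s = .sub M (Ns.map (Tm.subst s)) := by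
  simp [Tm.subst, Tm.substList_eq_map]

theorem upRen_comp (f g : ℕ → ℕ) : upRen g ∘ upRen f = upRen (g ∘ f) := by
  funext i; cases i <;> rfl

theorem Tm.rename_rename (M : Tm) (f g : ℕ → ℕ) :
    (M.rename f).rename g = M.rename (g ∘ f) := by
  induction M generalizing f g with
  | var i => rfl
  | lam A M ih => simp [ih, upRen_comp]
  | app M N ihM ihN => simp [ihM, ihN]
  | sub M Ns _ ih => simpa using fun N hN => ih N hN f g

theorem upRen_id : upRen id = id := by
  funext i; cases i <;> rfl

theorem Tm.rename_id (M : Tm) : M.rename id = M := by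
  induction M with
  | var i => rfl
  | lam A M ih => simp [upRen_id, ih]
  | app M N ihM ihN => simp [ihM, ihN]
  | sub M Ns _ ih =>
    simp only [Tm.rename_sub, Tm.sub.injEq, true_and]
    exact (List.map_congr_left ih).trans (List.map_id _)

theorem upSubst_comp_upRen (s : ℕ → Tm) (f : ℕ → ℕ) :
    upSubst s ∘ upRen f = upSubst (s ∘ f) := by
  funext i; cases i <;> rfl

theorem Tm.subst_rename (M : Tm) (f : ℕ → ℕ) (s : ℕ → Tm) :
    (M.rename f).subst s = M.subst (s ∘ f) := by
  induction M generalizing f s with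
  | var i => rfl
  | lam A M ih => simp [ih, upSubst_comp_upRen]
  | app M N ihM ihN => simp [ihM, ihN]
  | sub M Ns _ ih => simpa using fun N hN => ih N hN f s

theorem rename_comp_upSubst (s : ℕ → Tm) (f : ℕ → ℕ) :
    Tm.rename (upRen f) ∘ upSubst s = upSubst (Tm.rename f ∘ s) := by
  funext i
  cases i with
  | zero => rfl
  | succ i => simp only [Function.comp, upSubst, Tm.rename_rename]; rfl

theorem Tm.rename_subst (M : Tm) (s : ℕ → Tm) (f : ℕ → ℕ) :
    (M.subst s).rename f = M.subst (Tm.rename f ∘ s) := by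
  induction M generalizing f s with
  | var i => rfl
  | lam A M ih => simp [ih, rename_comp_upSubst]
  | app M N ihM ihN => simp [ihM, ihN]
  | sub M Ns _ ih => simpa using fun N hN => ih N hN s f

theorem subst_comp_upSubst (s t : ℕ → Tm) :
    Tm.subst (upSubst t) ∘ upSubst s = upSubst (Tm.subst t ∘ s) := by
  funext i
  cases i with
  | zero => rfl
  | succ i => simp only [Function.comp, upSubst, Tm.rename_subst, Tm.subst_rename]; rfl

theorem Tm.subst_subst (M : Tm) (s t : ℕ → Tm) :
    (M.subst s).subst t = M.subst (Tm.subst t ∘ s) := by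
  induction M generalizing s t with
  | var i => rfl
  | lam A M ih => simp [ih, subst_comp_upSubst]
  | app M N ihM ihN => simp [ihM, ihN]
  | sub M Ns _ ih => simpa using fun N hN => ih N hN s t

theorem upSubst_var_comp (f : ℕ → ℕ) : upSubst (Tm.var ∘ f) = Tm.var ∘ upRen f := by
  funext i; cases i <;> rfl

theorem Tm.subst_var_comp (M : Tm) (f : ℕ → ℕ) : M.subst (Tm.var ∘ f) = M.rename f := by
  induction M generalizing f with
  | var i => rfl
  | lam A M ih => simp [upSubst_var_comp, ih]
  | app M N ihM ihN => simp [ihM, ihN]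
  | sub M Ns _ ih => simpa using fun N hN => ih N hN f

theorem Tm.subst_inst_upSubst (M N : Tm) (s : ℕ → Tm) :
    (M.subst (upSubst s)).subst (inst N) =
      M.subst (fun | 0 => N | i + 1 => s i) := by
  rw [Tm.subst_subst]
  congr 1
  funext i
  cases i with
  | zero => rfl
  | succ i =>
    simp only [Function.comp, upSubst, Tm.subst_rename]
    exact (Tm.subst_var_comp (s i) id).trans (Tm.rename_id _)

theorem Tm.subst_inst_subst (M N : Tm) (s : ℕ → Tm) :
    (M.subst (inst N)).subst s = (M.subst (upSubst s)).subst (inst (N.subst s)) := by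
  rw [Tm.subst_inst_upSubst, Tm.subst_subst]
  congr 1
  funext i; cases i <;> rfl

/-! ### Lists of arguments -/

/-- The argument of index `i` of an explicit substitution, with the value `var 0` beyond the end
of the list. -/
def nth (Ns : List Tm) (i : ℕ) : Tm := Ns.getD i (.var 0)

theorem nth_of_lt {Ns : List Tm} {i : ℕ} (h : i < Ns.length) : nth Ns i = Ns[i] := by
  simp [nth, h]

theorem nth_of_le {Ns : List Tm} {i : ℕ} (h : Ns.length ≤ i) : nth Ns i = .var 0 := by
  simp [nth, h]

theorem nth_mem {Ns : List Tm} {i : ℕ} (h : i < Ns.length) : nth Ns i ∈ Ns := by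
  rw [nth_of_lt h]; exact List.getElem_mem h

theorem exists_nth_of_mem {Ns : List Tm} {N : Tm} (h : N ∈ Ns) :
    ∃ i < Ns.length, nth Ns i = N := by
  obtain ⟨i, hi, rfl⟩ := List.getElem_of_mem h
  exact ⟨i, hi, nth_of_lt hi⟩

theorem nth_map {Ns : List Tm} {i : ℕ} (g : Tm → Tm) (h : i < Ns.length) :
    nth (Ns.map g) i = g (nth Ns i) := by
  rw [nth_of_lt h, nth_of_lt (by simpa using h)]; simp

theorem nth_append_left {Ps Qs : List Tm} {i : ℕ} (h : i < Ps.length) :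
    nth (Ps ++ Qs) i = nth Ps i := by
  simp [nth, List.getD_eq_getElem?_getD, List.getElem?_append_left h]

theorem nth_append_right {Ps Qs : List Tm} {i : ℕ} (h : Ps.length ≤ i) :
    nth (Ps ++ Qs) i = nth Qs (i - Ps.length) := by
  simp [nth, List.getD_eq_getElem?_getD, List.getElem?_append_right h]

@[simp] theorem nth_cons_zero (N : Tm) (Ns : List Tm) : nth (N :: Ns) 0 = N := rfl
@[simp] theorem nth_cons_succ (N : Tm) (Ns : List Tm) (i : ℕ) :
    nth (N :: Ns) (i + 1) = nth Ns i := rfl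

theorem nth_middle (Ps Qs : List Tm) (N : Tm) : nth (Ps ++ N :: Qs) Ps.length = N := by
  rw [nth_append_right le_rfl]; simp

theorem nth_middle_ne {Ps Qs : List Tm} (N N' : Tm) {i : ℕ} (h : i ≠ Ps.length) :
    nth (Ps ++ N :: Qs) i = nth (Ps ++ N' :: Qs) i := by
  rcases lt_or_gt_of_ne h with h | h
  · rw [nth_append_left h, nth_append_left h]
  · rw [nth_append_right h.le, nth_append_right h.le]
    obtain ⟨j, hj⟩ : ∃ j, i - Ps.length = j + 1 := ⟨i - Ps.length - 1, by omega⟩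
    simp [hj]

theorem ext_nth {Ns Ns' : List Tm} (hl : Ns.length = Ns'.length)
    (h : ∀ i < Ns.length, nth Ns i = nth Ns' i) : Ns = Ns' := by
  refine List.ext_getElem hl fun i h1 h2 => ?_
  rw [← nth_of_lt h1, ← nth_of_lt h2, h i h1]

theorem split_at {Ns : List Tm} {i : ℕ} (h : i < Ns.length) :
    ∃ Ps Qs, Ns = Ps ++ nth Ns i :: Qs ∧ Ps.length = i := by
  refine ⟨Ns.take i, Ns.drop (i + 1), ?_, by simp; omega⟩
  rw [nth_of_lt h]
  simp

/-- Two ways of singling out an element of a list: the same position, or one before the other. -/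
theorem split_split {α : Type*} {Ps Qs Ps' Qs' : List α} {a b : α}
    (h : Ps ++ a :: Qs = Ps' ++ b :: Qs') :
    (Ps = Ps' ∧ a = b ∧ Qs = Qs') ∨ (∃ L, Ps' = Ps ++ a :: L ∧ Qs = L ++ b :: Qs') ∨
      (∃ L, Ps = Ps' ++ b :: L ∧ Qs' = L ++ a :: Qs) := by
  rw [List.append_eq_append_iff] at h
  rcases h with ⟨L, h1, h2⟩ | ⟨L, h1, h2⟩
  · cases L with
    | nil => simp at h1 h2; simp [h1, h2]
    | cons c L => simp at h2; right; left; exact ⟨L, by simp [h1, h2.1], h2.2⟩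
  · cases L with
    | nil => simp at h1 h2; simp [h1, h2]
    | cons c L => simp at h2; right; right; exact ⟨L, by simp [h1, h2.1], h2.2⟩

/-! ### Free variables -/

theorem Tm.countList_ne_zero {x : ℕ} {Ns : List Tm} :
    Tm.countList x Ns ≠ 0 ↔ ∃ N ∈ Ns, N.count x ≠ 0 := by
  induction Ns with
  | nil => simp [Tm.countList]
  | cons N Ns ih =>
    simp only [List.mem_cons, exists_eq_or_imp, ← ih, Tm.countList]
    omega

/-- The variable `x` occurs free in `M`. -/
def Tm.Free (x : ℕ) (M : Tm) : Prop := M.count x ≠ 0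

@[simp] theorem Tm.free_var {x i : ℕ} : (Tm.var i).Free x ↔ i = x := by
  simp [Tm.Free, Tm.count]
@[simp] theorem Tm.free_lam {x : ℕ} {A : Ty} {M : Tm} : (Tm.lam A M).Free x ↔ M.Free (x + 1) :=
  Iff.rfl
@[simp] theorem Tm.free_app {x : ℕ} {M N : Tm} :
    (Tm.app M N).Free x ↔ M.Free x ∨ N.Free x := by
  simp only [Tm.Free, Tm.count]; omega
@[simp] theorem Tm.free_sub {x : ℕ} {M : Tm} {Ns : List Tm} :
    (Tm.sub M Ns).Free x ↔ ∃ N ∈ Ns, N.Free x := by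
  simp only [Tm.Free, Tm.count]; exact Tm.countList_ne_zero

theorem Tm.subst_congr (M : Tm) {s t : ℕ → Tm} (h : ∀ i, M.Free i → s i = t i) :
    M.subst s = M.subst t := by
  induction M generalizing s t with
  | var i => exact h i (by simp)
  | lam A M ih =>
    simp only [Tm.subst_lam, Tm.lam.injEq, true_and]
    refine ih fun i hi => ?_
    cases i with
    | zero => rfl
    | succ i => simp only [upSubst]; rw [h i (by simpa using hi)]
  | app M N ihM ihN =>
    simp only [Tm.subst_app]
    rw [ihM fun i hi => h i (by simp [hi]), ihN fun i hi => h i (by simp [hi])]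
  | sub M Ns _ ih =>
    simp only [Tm.subst_sub, Tm.sub.injEq, true_and]
    exact List.map_congr_left fun N hN => ih N hN fun i hi => h i (by simpa using ⟨N, hN, hi⟩)

theorem Tm.rename_congr (M : Tm) {f g : ℕ → ℕ} (h : ∀ i, M.Free i → f i = g i) :
    M.rename f = M.rename g := by
  rw [← Tm.subst_var_comp, ← Tm.subst_var_comp]
  exact M.subst_congr fun i hi => by simp [h i hi]

/-! ### Typing -/

theorem HasType.sub {Γ Δ : Ctx} {M : Tm} {Ns : List Tm} {C : Ty} (hl : Ns.length = Δ.length)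
    (hN : ∀ i B, Δ[i]? = some B → HasType Γ (nth Ns i) (.box B)) (hM : HasType Δ M C) :
    HasType Γ (.sub M Ns) (.box C) := by
  refine .boxSubst hl (fun p hp => ?_) hM
  obtain ⟨i, hi, rfl⟩ := List.getElem_of_mem hp
  simp only [List.length_zip, lt_inf_iff] at hi
  simp only [List.getElem_zip]
  rw [← nth_of_lt hi.1]
  exact hN i _ (by simp [hi.2])

theorem nth_hasType {Γ Δ : Ctx} {Ns : List Tm} (hl : Ns.length = Δ.length)
    (h : ∀ p ∈ List.zip Ns Δ, HasType Γ p.1 (.box p.2)) (i : ℕ) (B : Ty) (hB : Δ[i]? = some B) :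
    HasType Γ (nth Ns i) (.box B) := by
  obtain ⟨hi, rfl⟩ := List.getElem?_eq_some_iff.1 hB
  have hi' : i < Ns.length := hl ▸ hi
  rw [nth_of_lt hi']
  refine h (Ns[i], Δ[i]) ?_
  rw [List.mem_iff_getElem]
  exact ⟨i, by simp [hi, hi'], by simp⟩

theorem HasType.var_inv {Γ : Ctx} {i : ℕ} {A : Ty} (h : HasType Γ (.var i) A) :
    Γ[i]? = some A := by
  cases h with | id h => exact h

theorem HasType.lam_inv {Γ : Ctx} {A T : Ty} {M : Tm} (h : HasType Γ (.lam A M) T) :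
    ∃ C, T = .arr A C ∧ HasType (A :: Γ) M C := by
  cases h with | abs h => exact ⟨_, rfl, h⟩

theorem HasType.app_inv {Γ : Ctx} {C : Ty} {M N : Tm} (h : HasType Γ (.app M N) C) :
    ∃ A, HasType Γ M (.arr A C) ∧ HasType Γ N A := by
  cases h with | app h1 h2 => exact ⟨_, h2, h1⟩

theorem HasType.sub_inv {Γ : Ctx} {T : Ty} {M : Tm} {Ns : List Tm} (h : HasType Γ (.sub M Ns) T) :
    ∃ Δ C, T = .box C ∧ Ns.length = Δ.length ∧
      (∀ i B, Δ[i]? = some B → HasType Γ (nth Ns i) (.box B)) ∧ HasType Δ M C := by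
  cases h with | boxSubst hl hN hM => exact ⟨_, _, rfl, hl, nth_hasType hl hN, hM⟩

/-- An argument of a typed explicit substitution is typed. -/
theorem HasType.sub_inv_arg {Γ Δ : Ctx} {Ns : List Tm} (hl : Ns.length = Δ.length)
    (hN : ∀ i B, Δ[i]? = some B → HasType Γ (nth Ns i) (.box B)) {N : Tm} (h : N ∈ Ns) :
    ∃ B, HasType Γ N (.box B) := by
  obtain ⟨i, hi, rfl⟩ := exists_nth_of_mem h
  exact ⟨_, hN i _ (List.getElem?_eq_getElem (hl ▸ hi))⟩

theorem HasType.lt_of_free {Γ : Ctx} {M : Tm} {A : Ty} (h : HasType Γ M A) {i : ℕ}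
    (hi : M.Free i) : i < Γ.length := by
  induction M generalizing Γ A i with
  | var j =>
    obtain rfl : j = i := by simpa using hi
    exact (List.getElem?_eq_some_iff.1 h.var_inv).1
  | lam B M ih =>
    obtain ⟨C, rfl, hM⟩ := h.lam_inv
    simpa using ih hM (Tm.free_lam.1 hi)
  | app M N ihM ihN =>
    obtain ⟨B, hM, hN⟩ := h.app_inv
    exact (Tm.free_app.1 hi).elim (ihM hM) (ihN hN)
  | sub M Ns _ ih =>
    obtain ⟨Δ, C, rfl, hl, hN, hM⟩ := h.sub_inv
    obtain ⟨N, hmem, hi⟩ := Tm.free_sub.1 hi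
    obtain ⟨B, hB⟩ := HasType.sub_inv_arg hl hN hmem
    exact ih N hmem hB hi

/-- Typing is preserved by a renaming that respects the types of the variables that occur. -/
theorem HasType.rename {Γ Δ : Ctx} {M : Tm} {A : Ty} {f : ℕ → ℕ} (h : HasType Γ M A)
    (hf : ∀ i B, M.Free i → Γ[i]? = some B → Δ[f i]? = some B) : HasType Δ (M.rename f) A := by
  induction M generalizing Γ Δ A f with
  | var j => exact .id (hf j A (by simp) h.var_inv)
  | lam B M ih =>
    obtain ⟨C, rfl, hM⟩ := h.lam_inv
    refine .abs (ih hM fun i B hi hB => ?_)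
    cases i with
    | zero => simpa [upRen] using hB
    | succ i => simpa [upRen] using hf i B hi (by simpa using hB)
  | app M N ihM ihN =>
    obtain ⟨B, hM, hN⟩ := h.app_inv
    exact .app (ihN hN fun i B hi => hf i B (by simp [hi]))
      (ihM hM fun i B hi => hf i B (by simp [hi]))
  | sub M Ns _ ih =>
    obtain ⟨Θ, C, rfl, hl, hN, hM⟩ := h.sub_inv
    rw [Tm.rename_sub]
    refine .sub (by simpa using hl) (fun i B hB => ?_) hM
    have hi : i < Ns.length := hl ▸ (List.getElem?_eq_some_iff.1 hB).1
    rw [nth_map _ hi]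
    exact ih _ (nth_mem hi) (hN i B hB) fun j B hj => hf j B (Tm.free_sub.2 ⟨_, nth_mem hi, hj⟩)

theorem HasType.weaken {Γ : Ctx} {M : Tm} {A : Ty} (B : Ty) (h : HasType Γ M A) :
    HasType (B :: Γ) (M.rename Nat.succ) A :=
  h.rename fun i C _ hC => by simpa using hC

theorem HasType.subst {Γ Δ : Ctx} {M : Tm} {A : Ty} {s : ℕ → Tm} (h : HasType Γ M A)
    (hs : ∀ i B, Γ[i]? = some B → HasType Δ (s i) B) : HasType Δ (M.subst s) A := by
  induction M generalizing Γ Δ A s with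
  | var j => exact hs j A h.var_inv
  | lam B M ih =>
    obtain ⟨C, rfl, hM⟩ := h.lam_inv
    refine .abs (ih hM fun i D hD => ?_)
    cases i with
    | zero => exact .id (by simpa using hD)
    | succ i => exact (hs i D (by simpa using hD)).weaken B
  | app M N ihM ihN =>
    obtain ⟨B, hM, hN⟩ := h.app_inv
    exact .app (ihN hN hs) (ihM hM hs)
  | sub M Ns _ ih =>
    obtain ⟨Θ, C, rfl, hl, hN, hM⟩ := h.sub_inv
    rw [Tm.subst_sub]
    refine .sub (by simpa using hl) (fun i B hB => ?_) hM
    have hi : i < Ns.length := hl ▸ (List.getElem?_eq_some_iff.1 hB).1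
    rw [nth_map _ hi]
    exact ih _ (nth_mem hi) (hN i B hB) hs

/-! ### Congruence closure of ground steps -/

/-- The closure of the ground steps `G` under the term formers; it coincides with the closure
under one-hole contexts. -/
inductive Cl (G : Tm → Tm → Prop) : Tm → Tm → Prop
  | ground {M N : Tm} : G M N → Cl G M N
  | lam {A : Ty} {M N : Tm} : Cl G M N → Cl G (.lam A M) (.lam A N)
  | appL {M N P : Tm} : Cl G M N → Cl G (.app M P) (.app N P)
  | appR {M N P : Tm} : Cl G M N → Cl G (.app P M) (.app P N)
  | body {M N : Tm} {Ps : List Tm} : Cl G M N → Cl G (.sub M Ps) (.sub N Ps)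
  | arg {P M N : Tm} {Ps Qs : List Tm} : Cl G M N →
      Cl G (.sub P (Ps ++ M :: Qs)) (.sub P (Ps ++ N :: Qs))

theorem Cl.fill {G : Tm → Tm → Prop} {M N : Tm} (h : G M N) (C : Hole) :
    Cl G (C.fill M) (C.fill N) := by
  induction C with
  | hole => exact .ground h
  | lam A C ih => exact .lam ih
  | appR P C ih => exact .appR ih
  | appL C P ih => exact .appL ih
  | body C Ms ih => exact .body ih
  | arg P Ps C Qs ih => exact .arg ih

theorem Cl.exists_hole {G : Tm → Tm → Prop} {M N : Tm} (h : Cl G M N) :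
    ∃ (C : Hole) (P Q : Tm), G P Q ∧ M = C.fill P ∧ N = C.fill Q := by
  induction h with
  | ground h => exact ⟨.hole, _, _, h, rfl, rfl⟩
  | @lam A _ _ _ ih =>
    obtain ⟨C, P, Q, h, rfl, rfl⟩ := ih
    exact ⟨.lam A C, P, Q, h, rfl, rfl⟩
  | @appL _ _ R _ ih =>
    obtain ⟨C, P, Q, h, rfl, rfl⟩ := ih
    exact ⟨.appL C R, P, Q, h, rfl, rfl⟩
  | @appR _ _ R _ ih =>
    obtain ⟨C, P, Q, h, rfl, rfl⟩ := ih
    exact ⟨.appR R C, P, Q, h, rfl, rfl⟩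
  | @body _ _ Rs _ ih =>
    obtain ⟨C, P, Q, h, rfl, rfl⟩ := ih
    exact ⟨.body C Rs, P, Q, h, rfl, rfl⟩
  | @arg R _ _ Ps Qs _ ih =>
    obtain ⟨C, P, Q, h, rfl, rfl⟩ := ih
    exact ⟨.arg R Ps C Qs, P, Q, h, rfl, rfl⟩

theorem betaStep_iff {M N : Tm} : BetaStep M N ↔ Cl BetaGround M N := by
  constructor
  · rintro ⟨C, h⟩; exact Cl.fill h C
  · intro h
    obtain ⟨C, P, Q, hG, rfl, rfl⟩ := h.exists_hole
    exact ⟨C, hG⟩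

theorem kappaStep_iff {M N : Tm} : KappaStep M N ↔ Cl KappaGround M N := by
  constructor
  · rintro ⟨C, h⟩; exact Cl.fill h C
  · intro h
    obtain ⟨C, P, Q, hG, rfl, rfl⟩ := h.exists_hole
    exact ⟨C, hG⟩

/-! ### Permutation equivalence, syntax-directed -/

theorem forall_nth {P : Tm → Prop} {Ns : List Tm} (h : ∀ N ∈ Ns, P N) (h0 : P (.var 0)) (i : ℕ) :
    P (nth Ns i) := by
  rcases lt_or_ge i Ns.length with hi | hi
  · exact h _ (nth_mem hi)
  · rwa [nth_of_le hi]

/-- A permutation of `ℕ` that fixes all `i ≥ n` preserves `{0, …, n-1}`. -/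
theorem perm_lt_iff {σ : Equiv.Perm ℕ} {n : ℕ} (h : ∀ i, n ≤ i → σ i = i) (i : ℕ) :
    σ i < n ↔ i < n := by
  constructor
  · intro hi
    by_contra hn
    rw [h i (by omega)] at hi
    exact hn hi
  · intro hi
    by_contra hn
    have := σ.injective (h (σ i) (by omega))
    omega

theorem perm_symm_fix {σ : Equiv.Perm ℕ} {n : ℕ} (h : ∀ i, n ≤ i → σ i = i) (i : ℕ) (hi : n ≤ i) :
    σ.symm i = i := by
  rw [Equiv.symm_apply_eq, h i hi]

theorem exists_perm_of_injective {f : ℕ → ℕ} {n : ℕ} (hf : Function.Injective f)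
    (h : ∀ i, n ≤ i → f i = i) : ∃ σ : Equiv.Perm ℕ, ∀ i, σ i = f i := by
  have hlt : ∀ i < n, f i < n := fun i hi => by
    by_contra hn
    have := hf (h (f i) (by omega))
    omega
  refine ⟨Equiv.ofBijective f ⟨hf, fun j => ?_⟩, fun i => rfl⟩
  rcases lt_or_ge j n with hj | hj
  · obtain ⟨i, hi⟩ := Finite.surjective_of_injective
      (f := fun i : Fin n => (⟨f i, hlt i i.2⟩ : Fin n))
      (fun a b hab => Fin.ext (hf (by simpa using hab))) ⟨j, hj⟩
    exact ⟨i, by simpa using hi⟩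
  · exact ⟨j, h j hj⟩

/-- Permutation equivalence with one rule per term former: the permutation `σ` relating two
explicit substitutions is a permutation of `ℕ` fixing the indices that are not bound, and sends
the position of an argument to that of its counterpart. -/
inductive PE : Tm → Tm → Prop
  | var (i : ℕ) : PE (.var i) (.var i)
  | lam {A : Ty} {M M' : Tm} : PE M M' → PE (.lam A M) (.lam A M')
  | app {M M' N N' : Tm} : PE M M' → PE N N' → PE (.app M N) (.app M' N')
  | sub {M M' : Tm} {Ns Ns' : List Tm} (σ : Equiv.Perm ℕ) : Ns.length = Ns'.length →
      (∀ i, Ns.length ≤ i → σ i = i) → PE (M.rename σ) M' →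
      (∀ i, PE (nth Ns i) (nth Ns' (σ i))) → PE (.sub M Ns) (.sub M' Ns')

theorem PE.refl (M : Tm) : PE M M := by
  induction M with
  | var i => exact .var i
  | lam A M ih => exact .lam ih
  | app M N ihM ihN => exact .app ihM ihN
  | sub M Ns ihM ih =>
    exact .sub 1 rfl (fun _ _ => rfl) ((Tm.rename_id M).symm ▸ ihM) (forall_nth ih (.var 0))

theorem nth_map_pe {g g' : Tm → Tm} {Ns Ns' : List Tm} {σ : Equiv.Perm ℕ}
    (hl : Ns.length = Ns'.length) (hσ : ∀ i, Ns.length ≤ i → σ i = i)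
    (h : ∀ i < Ns.length, PE (g (nth Ns i)) (g' (nth Ns' (σ i)))) (i : ℕ) :
    PE (nth (Ns.map g) i) (nth (Ns'.map g') (σ i)) := by
  rcases lt_or_ge i Ns.length with hi | hi
  · rw [nth_map _ hi, nth_map _ (hl ▸ (perm_lt_iff hσ i).2 hi)]
    exact h i hi
  · rw [hσ i hi, nth_of_le (by simpa using hi), nth_of_le (by simpa using hl ▸ hi)]
    exact .var 0

theorem PE.rename {M M' : Tm} (h : PE M M') (f : ℕ → ℕ) : PE (M.rename f) (M'.rename f) := by
  induction h generalizing f with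
  | var i => exact .var _
  | lam _ ih => exact .lam (ih _)
  | app _ _ ih1 ih2 => exact .app (ih1 f) (ih2 f)
  | sub σ hl hσ hM _ _ ih =>
    rw [Tm.rename_sub, Tm.rename_sub]
    exact .sub σ (by simpa using hl) (by simpa using hσ) hM (nth_map_pe hl hσ fun i _ => ih i f)

theorem PE.subst {M M' : Tm} (h : PE M M') {s s' : ℕ → Tm} (hs : ∀ i, PE (s i) (s' i)) :
    PE (M.subst s) (M'.subst s') := by
  induction h generalizing s s' with
  | var i => exact hs i
  | lam _ ih =>
    refine .lam (ih fun i => ?_)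
    cases i with
    | zero => exact .var 0
    | succ i => exact (hs i).rename _
  | app _ _ ih1 ih2 => exact .app (ih1 hs) (ih2 hs)
  | sub σ hl hσ hM _ _ ih =>
    rw [Tm.subst_sub, Tm.subst_sub]
    exact .sub σ (by simpa using hl) (by simpa using hσ) hM (nth_map_pe hl hσ fun i _ => ih i hs)

theorem Tm.rename_perm_symm (M : Tm) (σ : Equiv.Perm ℕ) :
    (M.rename σ).rename σ.symm = M := by
  rw [Tm.rename_rename, Equiv.symm_comp_self, Tm.rename_id]

theorem Tm.rename_symm_perm (M : Tm) (σ : Equiv.Perm ℕ) :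
    (M.rename σ.symm).rename σ = M := by
  rw [Tm.rename_rename, Equiv.self_comp_symm, Tm.rename_id]

theorem PE.symm {M M' : Tm} (h : PE M M') : PE M' M := by
  induction h with
  | var i => exact .var i
  | lam _ ih => exact .lam ih
  | app _ _ ih1 ih2 => exact .app ih1 ih2
  | @sub M M' Ns Ns' σ hl hσ _ _ ihM ih =>
    refine .sub σ.symm hl.symm (fun i hi => perm_symm_fix hσ i (hl ▸ hi)) ?_ fun i => ?_
    · have := ihM.rename σ.symm
      rwa [Tm.rename_perm_symm] at this
    · have := ih (σ.symm i)
      rwa [Equiv.apply_symm_apply] at this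

theorem PE.trans {M M' M'' : Tm} (h : PE M M') (h' : PE M' M'') : PE M M'' := by
  induction h generalizing M'' with
  | var i => exact h'
  | lam _ ih => cases h' with | lam h => exact .lam (ih h)
  | app _ _ ih1 ih2 => cases h' with | app h1 h2 => exact .app (ih1 h1) (ih2 h2)
  | sub σ hl hσ _ _ ihM ih =>
    cases h' with
    | sub τ hl' hτ hM' hN' =>
      refine .sub (σ.trans τ) (hl.trans hl') (fun i hi => ?_) ?_ fun i => ih i (hN' (σ i))
      · rw [Equiv.trans_apply, hσ i hi, hτ i (hl ▸ hi)]
      · have h1 := hM'.rename τ.symm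
        rw [Tm.rename_perm_symm] at h1
        have h2 := (ihM h1).rename τ
        rwa [Tm.rename_symm_perm, Tm.rename_rename] at h2

theorem permIdx_lt {n : ℕ} (σ : Equiv.Perm (Fin n)) {i : ℕ} (h : i < n) :
    permIdx σ i = σ ⟨i, h⟩ := by simp [permIdx, h]

theorem permIdx_inv_cancel {n : ℕ} (σ : Equiv.Perm (Fin n)) (i : ℕ) :
    permIdx σ (permIdx σ⁻¹ i) = i := by
  rcases lt_or_ge i n with h | h
  · rw [permIdx_lt _ h, permIdx_lt _ (Fin.isLt _)]; simp
  · have h' : ¬ i < n := by omega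
    simp [permIdx, h']

/-- The permutation of `ℕ` underlying `permIdx`. -/
def permNat {n : ℕ} (σ : Equiv.Perm (Fin n)) : Equiv.Perm ℕ where
  toFun := permIdx σ
  invFun := permIdx σ⁻¹
  left_inv i := by simpa using permIdx_inv_cancel σ⁻¹ i
  right_inv i := permIdx_inv_cancel σ i

theorem nth_ofFn {n : ℕ} (N : Fin n → Tm) {i : ℕ} (h : i < n) :
    nth (List.ofFn N) i = N ⟨i, h⟩ := by
  rw [nth_of_lt (by simpa using h)]; simp

theorem pe_of_permEq {M M' : Tm} (h : PermEq M M') : PE M M' := by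
  induction h with
  | @perm n σ M N =>
    refine .sub (permNat σ⁻¹) (by simp) (fun i hi => ?_) (.refl _) fun i => ?_
    · have h' : ¬ i < n := by simpa using hi
      simp [permNat, permIdx, h']
    · rcases lt_or_ge i n with h | h
      · have h' : permNat σ⁻¹ i = (σ⁻¹ ⟨i, h⟩ : Fin n) := permIdx_lt _ h
        rw [h', nth_ofFn _ h, nth_ofFn _ (Fin.isLt _)]
        simpa using PE.refl _
      · have h' : permNat σ⁻¹ i = i := by
          have : ¬ i < n := by omega
          simp [permNat, permIdx, this]
        rw [h', nth_of_le (by simpa using h), nth_of_le (by simpa using h)]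
        exact .var 0
  | lam _ ih => exact .lam ih
  | app _ _ ih1 ih2 => exact .app ih1 ih2
  | body _ ih =>
    exact .sub 1 rfl (fun _ _ => rfl) ((Tm.rename_id _).symm ▸ ih) fun i => .refl _
  | @arg M N N' Ps Qs _ ih =>
    refine .sub 1 (by simp) (fun _ _ => rfl) ((Tm.rename_id _).symm ▸ .refl _) fun i => ?_
    rw [Equiv.Perm.one_apply]
    by_cases hi : i = Ps.length
    · rw [hi, nth_middle, nth_middle]; exact ih
    · rw [nth_middle_ne N N' hi]; exact .refl _
  | refl M => exact .refl M
  | symm _ ih => exact ih.symm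
  | trans _ _ ih1 ih2 => exact ih1.trans ih2

theorem PermEq.args {M : Tm} {Ns Ns' : List Tm} (h : List.Forall₂ PermEq Ns Ns') (Ps : List Tm) :
    PermEq (.sub M (Ps ++ Ns)) (.sub M (Ps ++ Ns')) := by
  induction h generalizing Ps with
  | nil => exact .refl _
  | @cons N N' Ns Ns' h _ ih =>
    refine (PermEq.arg h).trans ?_
    simpa using ih (Ps ++ [N'])

theorem permEq_of_pe {M M' : Tm} (h : PE M M') : PermEq M M' := by
  induction h with
  | var i => exact .refl _
  | lam _ ih => exact .lam ih
  | app _ _ ih1 ih2 => exact .app ih1 ih2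
  | @sub M M' Ns Ns' σ hl hσ _ _ ihM ih =>
    have hlt := perm_lt_iff hσ
    have hlt' := perm_lt_iff (perm_symm_fix hσ)
    let τ : Equiv.Perm (Fin Ns.length) :=
      { toFun := fun i => ⟨σ.symm i, (hlt' i).2 i.2⟩
        invFun := fun i => ⟨σ i, (hlt i).2 i.2⟩
        left_inv := fun i => by simp
        right_inv := fun i => by simp }
    have h1 := PermEq.perm τ M (fun i => nth Ns i)
    have h2 : List.ofFn (fun i : Fin Ns.length => nth Ns i) = Ns :=
      ext_nth (by simp) fun i hi => by
        rw [nth_ofFn _ (by simpa using hi)]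
    have h3 : M.rename (permIdx τ⁻¹) = M.rename σ := by
      congr 1
      funext i
      rcases lt_or_ge i Ns.length with hi | hi
      · rw [permIdx_lt _ hi]; rfl
      · have h' : ¬ i < Ns.length := by omega
        simp [permIdx, h', hσ i hi]
    rw [h2, h3] at h1
    have h4 : List.Forall₂ PermEq (List.ofFn fun i : Fin Ns.length => nth Ns (τ i)) Ns' := by
      refine List.forall₂_iff_get.2 ⟨List.length_ofFn.trans hl, fun i hi hi' => ?_⟩
      have h5 := ih (σ.symm i)
      rw [Equiv.apply_symm_apply, nth_of_lt (Ns := Ns') hi'] at h5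
      simpa [τ] using h5
    exact h1.trans ((PermEq.body ihM).trans (PermEq.args h4 []))

/-- The relation `PE` is equality of classes modulo permutations. -/
theorem mk_eq_mk {M M' : Tm} :
    (Quotient.mk permSetoid M = Quotient.mk permSetoid M') ↔ PE M M' :=
  ⟨fun h => pe_of_permEq (Quotient.exact h), fun h => Quotient.sound (permEq_of_pe h)⟩

/-- The context `Γ` permuted by `σ`. -/
theorem exists_perm_ctx (Γ : Ctx) {σ : Equiv.Perm ℕ} (hσ : ∀ i, Γ.length ≤ i → σ i = i) :
    ∃ Δ : Ctx, Δ.length = Γ.length ∧ ∀ i, Δ[σ i]? = Γ[i]? := by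
  refine ⟨List.ofFn fun i : Fin Γ.length =>
    Γ[σ.symm i]'((perm_lt_iff (perm_symm_fix hσ) i).2 i.2), by simp, fun i => ?_⟩
  rcases lt_or_ge i Γ.length with hi | hi
  · have := (perm_lt_iff hσ i).2 hi
    simp [this, hi]
  · simp [hσ i hi, hi]

theorem PE.hasType {M M' : Tm} (h : PE M M') {Γ : Ctx} {A : Ty} (hM : HasType Γ M A) :
    HasType Γ M' A := by
  induction h generalizing Γ A with
  | var i => exact hM
  | lam _ ih =>
    obtain ⟨C, rfl, h⟩ := hM.lam_inv
    exact .abs (ih h)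
  | app _ _ ih1 ih2 =>
    obtain ⟨B, h1, h2⟩ := hM.app_inv
    exact .app (ih2 h2) (ih1 h1)
  | sub σ hl hσ _ _ ihM ih =>
    obtain ⟨Δ, C, rfl, hl', hN, hM⟩ := hM.sub_inv
    obtain ⟨Δ', hlen, hΔ⟩ := exists_perm_ctx Δ (σ := σ) fun i hi => hσ i (hl' ▸ hi)
    refine .sub (Δ := Δ') (by omega) (fun i B hB => ?_)
      (ihM (hM.rename fun i B _ hB => by rw [hΔ, hB]))
    obtain ⟨j, rfl⟩ := σ.surjective i
    exact ih j (hN j B (by rw [← hΔ, hB]))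

theorem typed_mk {Γ : Ctx} {M : Tm} {A : Ty} :
    Typed Γ (Quotient.mk permSetoid M) A ↔ HasType Γ M A :=
  ⟨fun ⟨_, h, hN⟩ => (mk_eq_mk.1 h).hasType hN, fun h => ⟨M, rfl, h⟩⟩

/-! ### Strong normalization of `β` on representatives -/

/-- Strong normalization of `β` on representatives. -/
def SN (M : Tm) : Prop := Acc (fun a b => Cl BetaGround b a) M

theorem SN.step {M N : Tm} (h : SN M) (hs : Cl BetaGround M N) : SN N := h.inv hs

theorem BetaGround.subst {M N : Tm} (h : BetaGround M N) (s : ℕ → Tm) :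
    BetaGround (M.subst s) (N.subst s) := by
  cases h with
  | beta1 A M N =>
    rw [Tm.subst_inst_subst]
    exact .beta1 _ _ _
  | beta2 M R Ps Ns Qs =>
    have := BetaGround.beta2 M R (Ps.map (Tm.subst s)) (Ns.map (Tm.subst s)) (Qs.map (Tm.subst s))
    simpa using this

theorem Cl.subst {G : Tm → Tm → Prop}
    (hG : ∀ M N, G M N → ∀ s : ℕ → Tm, G (M.subst s) (N.subst s)) {M N : Tm}
    (h : Cl G M N) (s : ℕ → Tm) : Cl G (M.subst s) (N.subst s) := by
  induction h generalizing s with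
  | ground h => exact .ground (hG _ _ h s)
  | lam _ ih => exact .lam (ih _)
  | appL _ ih => exact .appL (ih s)
  | appR _ ih => exact .appR (ih s)
  | body h _ => simpa using .body h
  | arg _ ih => simpa using .arg (ih s)

theorem beta_subst {M N : Tm} (h : Cl BetaGround M N) (s : ℕ → Tm) :
    Cl BetaGround (M.subst s) (N.subst s) :=
  h.subst (fun _ _ h s => h.subst s) s

theorem beta_rename {M N : Tm} (h : Cl BetaGround M N) (f : ℕ → ℕ) :
    Cl BetaGround (M.rename f) (N.rename f) := by
  rw [← Tm.subst_var_comp, ← Tm.subst_var_comp]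
  exact beta_subst h _

/-- Strong normalization is reflected by any map on terms that preserves steps. -/
theorem SN.of_map {g : Tm → Tm} (hg : ∀ M N, Cl BetaGround M N → Cl BetaGround (g M) (g N))
    {M : Tm} (h : SN (g M)) : SN M := by
  generalize hP : g M = P at h
  induction h generalizing M with
  | intro P _ ih => exact ⟨_, fun N hN => ih (g N) (hP ▸ hg M N hN) rfl⟩

/-- `Flat N S`: the term `S` is a body obtained from the term `N` of box type by performing `β`
steps and, at an explicit substitution, by merging the bodies obtained from its arguments into its
own body; an argument need not be unfolded, and then stands for an arbitrary variable.  These are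
the terms that the steps `β₂` may substitute for a variable to which `N` is bound. -/
inductive Flat : Tm → Tm → Prop
  | var (N : Tm) (j : ℕ) : Flat N (.var j)
  | step {N N' S : Tm} : Cl BetaGround N N' → Flat N' S → Flat N S
  | sub {R : Tm} {Ns : List Tm} {s : ℕ → Tm} : (∀ i < Ns.length, Flat (nth Ns i) (s i)) →
      Flat (.sub R Ns) (R.subst s)

/-- Reducible terms of each type.  At `□A` the terms tested are the unfoldings in the sense of
`Flat`, which are what a term of this type contributes to a surrounding explicit substitution. -/
def RED : Ty → Tm → Prop
  | .atom _, M => SN M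
  | .arr A B, M => ∀ N, RED A N → RED B (.app M N)
  | .box A, M => SN M ∧ ∀ S, Flat M S → RED A S

/-- The terms which are neither abstractions nor explicit substitutions; as the function
part of an application or as an argument of an explicit substitution, such a term makes no redex. -/
def Neutral : Tm → Prop
  | .lam _ _ => False
  | .sub _ _ => False
  | _ => True

theorem not_beta_var {i : ℕ} {N : Tm} : ¬ Cl BetaGround (.var i) N := by
  intro h
  cases h with | ground h => cases h

/-- The three properties of reducibility candidates, proved together by induction on the type:
reducible terms are strongly normalizing, reducibility is closed under steps, and a neutral term
is reducible as soon as all its reducts are. -/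
theorem RED.candidate (A : Ty) :
    (∀ M, RED A M → SN M) ∧
    (∀ M N, RED A M → Cl BetaGround M N → RED A N) ∧
    (∀ M, Neutral M → (∀ N, Cl BetaGround M N → RED A N) → RED A M) := by
  induction A with
  | atom a => exact ⟨fun _ h => h, fun _ _ h hs => h.step hs, fun M _ h => ⟨_, h⟩⟩
  | arr A B ihA ihB =>
    have hvar : RED A (.var 0) := ihA.2.2 _ trivial fun N hN => (not_beta_var hN).elim
    refine ⟨fun M h => ?_, fun M N h hs P hP => ihB.2.1 _ _ (h P hP) (.appL hs), ?_⟩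
    · exact SN.of_map (g := fun M => .app M (.var 0)) (fun _ _ h => .appL h)
        (ihB.1 _ (h _ hvar))
    · intro M hM h P hP
      have hsn := ihA.1 P hP
      induction hsn with
      | intro P _ ih =>
        refine ihB.2.2 _ trivial fun N hN => ?_
        cases hN with
        | ground h => cases h; exact hM.elim
        | appL h' => exact h _ h' P hP
        | appR h' => exact ih _ h' (ihA.2.1 _ _ hP h')
  | box A ihA =>
    refine ⟨fun M h => h.1, fun M N h hs => ⟨h.1.step hs, fun S hS => h.2 S (.step hs hS)⟩, ?_⟩
    intro M hM h
    refine ⟨⟨_, fun N hN => (h N hN).1⟩, fun S hS => ?_⟩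
    cases hS with
    | var N j => exact ihA.2.2 _ trivial fun N hN => (not_beta_var hN).elim
    | step hs hS => exact (h _ hs).2 S hS
    | sub hs => exact hM.elim

theorem RED.sn {A : Ty} {M : Tm} (h : RED A M) : SN M := (RED.candidate A).1 M h

theorem RED.step {A : Ty} {M N : Tm} (h : RED A M) (hs : Cl BetaGround M N) : RED A N :=
  (RED.candidate A).2.1 M N h hs

theorem RED.neutral {A : Ty} {M : Tm} (hM : Neutral M)
    (h : ∀ N, Cl BetaGround M N → RED A N) : RED A M := (RED.candidate A).2.2 M hM h

theorem RED.var {A : Ty} (i : ℕ) : RED A (.var i) :=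
  RED.neutral trivial fun _ hN => (not_beta_var hN).elim

theorem RED.lam {A B : Ty} {M : Tm} (h : ∀ N, RED A N → RED B (M.subst (inst N))) :
    RED (.arr A B) (.lam A M) := by
  intro N hN
  have hM : SN M := SN.of_map (g := fun M => M.subst (inst (.var 0)))
    (fun _ _ h => beta_subst h _) (h _ (RED.var 0)).sn
  induction hM generalizing N with
  | intro M _ ihM =>
    have hN' := hN.sn
    induction hN' with
    | intro N _ ihN =>
      refine RED.neutral trivial fun P hP => ?_
      cases hP with
      | ground hg => cases hg; exact h N hN
      | appL hs =>
        cases hs with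
        | ground hg => cases hg
        | lam hs => exact ihM _ hs (fun N hN => (h N hN).step (beta_subst hs _)) N hN
      | appR hs => exact ihN _ hs (hN.step hs)

/-- Whatever the arguments `Ns` unfold to, the body `M` so instantiated is in `X`. -/
def Good (X : Tm → Prop) (M : Tm) (Ns : List Tm) : Prop :=
  ∀ s : ℕ → Tm, (∀ i < Ns.length, Flat (nth Ns i) (s i)) → X (M.subst s)

theorem Good.body {X : Tm → Prop} (hX : ∀ M N, X M → Cl BetaGround M N → X N) {M M' : Tm}
    {Ns : List Tm} (h : Good X M Ns) (hs : Cl BetaGround M M') : Good X M' Ns :=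
  fun s hF => hX _ _ (h s hF) (beta_subst hs s)

theorem Good.arg {X : Tm → Prop} {M N N' : Tm} {Ps Qs : List Tm}
    (h : Good X M (Ps ++ N :: Qs)) (hs : Cl BetaGround N N') : Good X M (Ps ++ N' :: Qs) := by
  refine fun s hF => h s fun i hi => ?_
  have hF := hF i (by simpa using hi)
  by_cases hp : i = Ps.length
  · subst hp
    rw [nth_middle] at hF ⊢
    exact .step hs hF
  · rwa [nth_middle_ne N N' hp]

theorem nth_splice_lt {Ps Ks Qs : List Tm} (N : Tm) {i : ℕ} (h : i < Ps.length) :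
    nth (Ps ++ Ks ++ Qs) i = nth (Ps ++ N :: Qs) i := by
  rw [List.append_assoc, nth_append_left h, nth_append_left h]

theorem nth_splice_mid {Ps Ks Qs : List Tm} {j : ℕ} (h : j < Ks.length) :
    nth (Ps ++ Ks ++ Qs) (Ps.length + j) = nth Ks j := by
  rw [List.append_assoc, nth_append_right (by omega), Nat.add_sub_cancel_left, nth_append_left h]

theorem nth_splice_gt {Ps Ks Qs : List Tm} (N : Tm) {i : ℕ} (h : Ps.length < i) :
    nth (Ps ++ Ks ++ Qs) (i - 1 + Ks.length) = nth (Ps ++ N :: Qs) i := by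
  obtain ⟨j, rfl⟩ : ∃ j, i = Ps.length + (j + 1) := ⟨i - Ps.length - 1, by omega⟩
  rw [nth_append_right (by simp), nth_append_right (by omega), Nat.add_sub_cancel_left,
    nth_cons_succ]
  congr 1
  simp
  omega

/-- Unfolding after a step `β₂` is a case of unfolding before it. -/
theorem Good.beta {X : Tm → Prop} {M R : Tm} {Ps Ks Qs : List Tm}
    (h : Good X M (Ps ++ .sub R Ks :: Qs)) :
    Good X (M.subst (spliceSubst Ps.length Ks.length R)) (Ps ++ Ks ++ Qs) := by
  intro s hF
  rw [Tm.subst_subst]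
  refine h _ fun i hi => ?_
  simp only [List.length_append, List.length_cons] at hi hF
  simp only [Function.comp, spliceSubst]
  rcases lt_trichotomy i Ps.length with hp | rfl | hp
  · rw [if_pos hp, ← nth_splice_lt _ hp]
    exact hF i (by omega)
  · rw [if_neg (lt_irrefl _), if_pos rfl, nth_middle, Tm.subst_rename]
    refine .sub fun j hj => ?_
    rw [← nth_splice_mid (Ps := Ps) (Qs := Qs) hj]
    exact hF _ (by omega)
  · rw [if_neg (by omega), if_neg (by omega), ← nth_splice_gt (Ks := Ks) _ hp]
    exact hF _ (by omega)

/-- `Good` is exactly what is needed for all unfoldings of an explicit substitution to be in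
`X`. -/
theorem Good.flat {X : Tm → Prop} (hX : ∀ M N, X M → Cl BetaGround M N → X N)
    (hvar : ∀ j, X (.var j)) {M : Tm} {Ns : List Tm} (h : Good X M Ns) {S : Tm}
    (hS : Flat (.sub M Ns) S) : X S := by
  generalize hT : Tm.sub M Ns = T at hS
  induction hS generalizing M Ns with
  | var N j => exact hvar j
  | step hs _ ih =>
    subst hT
    cases hs with
    | ground hg => cases hg; exact ih h.beta rfl
    | body hs => exact ih (h.body hX hs) rfl
    | arg hs => exact ih (h.arg hs) rfl
  | sub hs _ => cases hT; exact h _ hs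

/-- `N` is an argument of the explicit substitution `M`. -/
def IsArg (N M : Tm) : Prop := ∃ P Ns, M = .sub P Ns ∧ N ∈ Ns

theorem IsArg.lift {N M N' : Tm} (h : IsArg N M) (hs : Cl BetaGround N N') :
    ∃ M', Cl BetaGround M M' ∧ IsArg N' M' := by
  obtain ⟨P, Ns, rfl, hN⟩ := h
  obtain ⟨Ps, Qs, rfl⟩ := List.append_of_mem hN
  exact ⟨_, .arg hs, _, _, rfl, by simp⟩

theorem IsArg.lift_star {N M N' : Tm} (h : Relation.ReflTransGen IsArg N M)
    (hs : Cl BetaGround N N') : ∃ M', Cl BetaGround M M' ∧ Relation.ReflTransGen IsArg N' M' := by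
  induction h with
  | refl => exact ⟨_, hs, .refl⟩
  | tail _ h ih =>
    obtain ⟨M', h1, h2⟩ := ih
    obtain ⟨M'', h3, h4⟩ := h.lift h1
    exact ⟨M'', h3, h2.tail h4⟩

/-- From a strongly normalizing term, pass to a reduct or to an argument. -/
def ArgStep (N M : Tm) : Prop := SN M ∧ (Cl BetaGround M N ∨ IsArg N M)

theorem ArgStep.wf : WellFounded ArgStep := by
  refine ⟨fun M => ⟨_, fun N hN => ?_⟩⟩
  have key : ∀ M, SN M → ∀ N, Relation.ReflTransGen IsArg N M → Acc ArgStep N := by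
    intro M hM
    induction hM with
    | intro M _ ih =>
      intro N
      induction N with
      | var i =>
        rintro -
        refine ⟨_, fun N' hN' => ?_⟩
        rcases hN'.2 with h | ⟨_, _, h, _⟩
        · exact (not_beta_var h).elim
        · cases h
      | lam A P _ =>
        intro hN
        refine ⟨_, fun N' hN' => ?_⟩
        rcases hN'.2 with h | ⟨_, _, h, _⟩
        · obtain ⟨M', h1, h2⟩ := IsArg.lift_star hN h
          exact ih M' h1 N' h2
        · cases h
      | app P Q _ _ =>
        intro hN
        refine ⟨_, fun N' hN' => ?_⟩
        rcases hN'.2 with h | ⟨_, _, h, _⟩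
        · obtain ⟨M', h1, h2⟩ := IsArg.lift_star hN h
          exact ih M' h1 N' h2
        · cases h
      | sub P Ns _ ihN =>
        intro hN
        refine ⟨_, fun N' hN' => ?_⟩
        rcases hN'.2 with h | ⟨_, _, h, hmem⟩
        · obtain ⟨M', h1, h2⟩ := IsArg.lift_star hN h
          exact ih M' h1 N' h2
        · cases h
          exact ihN N' hmem (.head ⟨_, _, rfl, hmem⟩ hN)
  obtain ⟨hsn, h | h⟩ := hN
  · exact key N (hsn.step h) N .refl
  · exact key M hsn N (.single h)

/-- An explicit substitution with strongly normalizing arguments is strongly normalizing if its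
body is, whatever the arguments unfold to.  A step `β₂` changes the body arbitrarily, but replaces
an argument by finitely many arguments of it; so the multiset of arguments decreases, or it stays
and the body is reduced. -/
theorem Good.sn {X : Tm → Prop} (hX : ∀ M N, X M → Cl BetaGround M N → X N)
    (hsn : ∀ M, X M → SN M) {M : Tm} {Ns : List Tm} (h : Good X M Ns) (hN : ∀ N ∈ Ns, SN N) :
    SN (.sub M Ns) := by
  have : Std.Irrefl ArgStep := ArgStep.wf.irrefl
  have hacc : Acc (Relation.CutExpand ArgStep) (Ns : Multiset Tm) := ArgStep.wf.cutExpand.apply _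
  generalize hm : (Ns : Multiset Tm) = m at hacc
  induction hacc generalizing M Ns with
  | intro m _ ihm =>
    have hM : SN M := by
      refine SN.of_map (g := fun M => M.subst .var) (fun _ _ h => beta_subst h _)
        (hsn _ (h _ fun i _ => .var _ i))
    induction hM with
    | intro M _ ihM =>
      refine ⟨_, fun T hT => ?_⟩
      cases hT with
      | body hs => exact ihM _ hs (h.body hX hs)
      | @arg _ N N' Ps Qs hs =>
        have hNs : SN N := hN N (by simp)
        refine ihm _ ⟨{N'}, N, ?_, ?_⟩ (h.arg hs) ?_ rfl
        · simpa using ⟨hNs, Or.inl hs⟩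
        · subst hm
          simp only [← Multiset.coe_add, ← Multiset.cons_coe, ← Multiset.singleton_add]
          abel
        · intro P hP
          simp only [List.mem_append, List.mem_cons] at hP hN
          rcases hP with hP | rfl | hP
          · exact hN P (.inl hP)
          · exact hNs.step hs
          · exact hN P (.inr (.inr hP))
      | ground hg =>
        cases hg with
        | beta2 _ R Ps Ks Qs =>
          have hR : SN (.sub R Ks) := hN _ (by simp)
          refine ihm _ ⟨(Ks : Multiset Tm), .sub R Ks, ?_, ?_⟩ h.beta ?_ rfl
          · intro K hK
            exact ⟨hR, .inr ⟨R, Ks, rfl, by simpa using hK⟩⟩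
          · subst hm
            simp only [← Multiset.coe_add, ← Multiset.cons_coe, ← Multiset.singleton_add]
            abel
          · intro P hP
            simp only [List.mem_append, List.mem_cons] at hP hN
            rcases hP with (hP | hP) | hP
            · exact hN P (.inl hP)
            · obtain ⟨As, Bs, rfl⟩ := List.append_of_mem hP
              exact SN.of_map (g := fun K => .sub R (As ++ K :: Bs)) (fun _ _ h => .arg h) hR
            · exact hN P (.inr (.inr hP))

/-- Instances of typed terms by reducible terms are reducible. -/
theorem HasType.red {Γ : Ctx} {M : Tm} {A : Ty} (h : HasType Γ M A) {s : ℕ → Tm}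
    (hs : ∀ i B, Γ[i]? = some B → RED B (s i)) : RED A (M.subst s) := by
  induction M generalizing Γ A s with
  | var i => exact hs i A h.var_inv
  | lam B M ih =>
    obtain ⟨C, rfl, hM⟩ := h.lam_inv
    refine RED.lam fun N hN => ?_
    rw [Tm.subst_inst_upSubst]
    refine ih hM fun i D hD => ?_
    cases i with
    | zero => obtain rfl : B = D := by simpa using hD
              exact hN
    | succ i => exact hs i D (by simpa using hD)
  | app M N ihM ihN =>
    obtain ⟨B, hM, hN⟩ := h.app_inv
    exact ihM hM hs _ (ihN hN hs)
  | sub M Ns ihM ih =>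
    obtain ⟨Δ, C, rfl, hl, hN, hM⟩ := h.sub_inv
    rw [Tm.subst_sub]
    have hN' : ∀ i B, Δ[i]? = some B → RED (.box B) (nth (Ns.map (Tm.subst s)) i) := by
      intro i B hB
      have hi : i < Ns.length := hl ▸ (List.getElem?_eq_some_iff.1 hB).1
      rw [nth_map _ hi]
      exact ih _ (nth_mem hi) (hN i B hB) hs
    have hgood : Good (RED C) M (Ns.map (Tm.subst s)) := by
      refine fun t ht => ihM hM fun i B hB => ?_
      have hi : i < Ns.length := hl ▸ (List.getElem?_eq_some_iff.1 hB).1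
      exact (hN' i B hB).2 _ (ht i (by simpa using hi))
    refine ⟨hgood.sn (fun _ _ h hs => h.step hs) (fun _ h => h.sn) fun P hP => ?_,
      fun S hS => hgood.flat (fun _ _ h hs => h.step hs) RED.var hS⟩
    obtain ⟨i, hi, rfl⟩ := exists_nth_of_mem hP
    have hi' : i < Δ.length := by simpa [hl] using hi
    exact (hN' i _ (List.getElem?_eq_getElem hi')).sn

/-- Typed terms are strongly normalizing for `β` on representatives. -/
theorem HasType.sn {Γ : Ctx} {M : Tm} {A : Ty} (h : HasType Γ M A) : SN M :=
  SN.of_map (g := fun M => M.subst .var) (fun _ _ h => beta_subst h _)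
    (h.red fun i _ _ => RED.var i).sn

/-! ### Subject reduction for `β` -/

theorem typedArgs_iff {Γ Δ : Ctx} {Ns : List Tm} :
    (Ns.length = Δ.length ∧ ∀ i B, Δ[i]? = some B → HasType Γ (nth Ns i) (.box B)) ↔
      List.Forall₂ (fun N B => HasType Γ N (.box B)) Ns Δ := by
  rw [List.forall₂_iff_get]
  refine and_congr_right fun hl => ⟨fun h i h1 h2 => ?_, fun h i B hB => ?_⟩
  · have := h i _ (List.getElem?_eq_getElem h2)
    rwa [nth_of_lt h1] at this
  · obtain ⟨h2, rfl⟩ := List.getElem?_eq_some_iff.1 hB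
    rw [nth_of_lt (hl ▸ h2)]
    exact h i (hl ▸ h2) h2

theorem HasType.sub_iff {Γ : Ctx} {T : Ty} {M : Tm} {Ns : List Tm} :
    HasType Γ (.sub M Ns) T ↔ ∃ Δ C, T = .box C ∧
      List.Forall₂ (fun N B => HasType Γ N (.box B)) Ns Δ ∧ HasType Δ M C := by
  constructor
  · intro h
    obtain ⟨Δ, C, h1, h2, h3, h4⟩ := h.sub_inv
    exact ⟨Δ, C, h1, typedArgs_iff.1 ⟨h2, h3⟩, h4⟩
  · rintro ⟨Δ, C, rfl, h1, h2⟩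
    obtain ⟨h3, h4⟩ := typedArgs_iff.2 h1
    exact .sub h3 h4 h2

theorem forall₂_append_cons_iff {α β : Type*} {R : α → β → Prop} {Ps Qs : List α} {N : α}
    {Δ : List β} : List.Forall₂ R (Ps ++ N :: Qs) Δ ↔ ∃ Δ₁ B Δ₂, Δ = Δ₁ ++ B :: Δ₂ ∧
      List.Forall₂ R Ps Δ₁ ∧ R N B ∧ List.Forall₂ R Qs Δ₂ := by
  induction Ps generalizing Δ with
  | nil =>
    constructor
    · rintro ⟨⟩
      exact ⟨[], _, _, rfl, .nil, ‹_›, ‹_›⟩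
    · rintro ⟨_, B, Δ₂, rfl, ⟨⟩, h1, h2⟩
      exact .cons h1 h2
  | cons P Ps ih =>
    constructor
    · rintro (_ | ⟨h, h'⟩)
      obtain ⟨Δ₁, B, Δ₂, rfl, h1, h2, h3⟩ := ih.1 h'
      exact ⟨_ :: Δ₁, B, Δ₂, rfl, .cons h h1, h2, h3⟩
    · rintro ⟨_, B, Δ₂, rfl, ⟨⟩, h1, h2⟩
      exact .cons ‹_› (ih.2 ⟨_, _, _, rfl, ‹_›, h1, h2⟩)

theorem forall₂_append {α β : Type*} {R : α → β → Prop} {Ps Qs : List α} {Γ Δ : List β}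
    (h1 : List.Forall₂ R Ps Γ) (h2 : List.Forall₂ R Qs Δ) : List.Forall₂ R (Ps ++ Qs) (Γ ++ Δ) := by
  induction h1 with
  | nil => exact h2
  | cons h _ ih => exact .cons h ih

theorem spliceSubst_lt {p k i : ℕ} (R : Tm) (h : i < p) : spliceSubst p k R i = .var i := by
  simp [spliceSubst, h]

theorem spliceSubst_self (p k : ℕ) (R : Tm) :
    spliceSubst p k R p = R.rename (fun j => p + j) := by simp [spliceSubst]

theorem spliceSubst_gt {p k i : ℕ} (R : Tm) (h : p < i) :
    spliceSubst p k R i = .var (i - 1 + k) := by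
  simp [spliceSubst, h.not_gt, h.ne']

theorem HasType.splice {Δ₁ Δ₂ Θ : Ctx} {R : Tm} {B : Ty} (hR : HasType Θ R B) (i : ℕ) (D : Ty)
    (hD : (Δ₁ ++ B :: Δ₂)[i]? = some D) :
    HasType (Δ₁ ++ Θ ++ Δ₂) (spliceSubst Δ₁.length Θ.length R i) D := by
  rcases lt_trichotomy i Δ₁.length with h | rfl | h
  · rw [spliceSubst_lt _ h]
    rw [List.getElem?_append_left h] at hD
    exact .id (by rw [List.append_assoc, List.getElem?_append_left h, hD])
  · rw [spliceSubst_self]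
    obtain rfl : B = D := by simpa using hD
    refine hR.rename fun j C _ hC => ?_
    have hj := (List.getElem?_eq_some_iff.1 hC).1
    rw [List.append_assoc, List.getElem?_append_right (by omega), Nat.add_sub_cancel_left,
      List.getElem?_append_left hj, hC]
  · rw [spliceSubst_gt _ h]
    obtain ⟨j, rfl⟩ : ∃ j, i = Δ₁.length + (j + 1) := ⟨i - Δ₁.length - 1, by omega⟩
    rw [List.getElem?_append_right (by omega), Nat.add_sub_cancel_left,
      List.getElem?_cons_succ] at hD
    refine .id ?_
    rw [List.getElem?_append_right (by simp), ← hD]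
    congr 1
    simp
    omega

theorem BetaGround.hasType {Γ : Ctx} {M N : Tm} {A : Ty} (h : BetaGround M N)
    (hM : HasType Γ M A) : HasType Γ N A := by
  cases h with
  | beta1 B M N =>
    obtain ⟨C, h1, h2⟩ := hM.app_inv
    obtain ⟨D, h3, h4⟩ := h1.lam_inv
    cases h3
    refine h4.subst fun i E hE => ?_
    cases i with
    | zero => obtain rfl : B = E := by simpa using hE
              exact h2
    | succ i => exact .id (by simpa using hE)
  | beta2 M R Ps Ks Qs =>
    obtain ⟨Δ, C, rfl, hN, hM⟩ := HasType.sub_iff.1 hM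
    obtain ⟨Δ₁, B, Δ₂, rfl, h1, h2, h3⟩ := forall₂_append_cons_iff.1 hN
    obtain ⟨Θ, D, h, hK, hR⟩ := HasType.sub_iff.1 h2
    cases h
    refine HasType.sub_iff.2 ⟨Δ₁ ++ Θ ++ Δ₂, C, rfl,
      forall₂_append (forall₂_append h1 hK) h3, hM.subst fun i D hD => ?_⟩
    rw [h1.length_eq, hK.length_eq]
    exact hR.splice i D hD

theorem Cl.hasType {G : Tm → Tm → Prop}
    (hG : ∀ {Γ M N A}, G M N → HasType Γ M A → HasType Γ N A) {Γ : Ctx} {M N : Tm} {A : Ty}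
    (h : Cl G M N) (hM : HasType Γ M A) : HasType Γ N A := by
  induction h generalizing Γ A with
  | ground h => exact hG h hM
  | lam _ ih =>
    obtain ⟨C, rfl, h⟩ := hM.lam_inv
    exact .abs (ih h)
  | appL _ ih =>
    obtain ⟨C, h1, h2⟩ := hM.app_inv
    exact .app h2 (ih h1)
  | appR _ ih =>
    obtain ⟨C, h1, h2⟩ := hM.app_inv
    exact .app (ih h2) h1
  | body _ ih =>
    obtain ⟨Δ, C, rfl, hN, hM⟩ := HasType.sub_iff.1 hM
    exact HasType.sub_iff.2 ⟨Δ, C, rfl, hN, ih hM⟩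
  | arg _ ih =>
    obtain ⟨Δ, C, rfl, hN, hM⟩ := HasType.sub_iff.1 hM
    obtain ⟨Δ₁, B, Δ₂, rfl, h1, h2, h3⟩ := forall₂_append_cons_iff.1 hN
    exact HasType.sub_iff.2 ⟨_, C, rfl, forall₂_append_cons_iff.2
      ⟨Δ₁, B, Δ₂, rfl, h1, ih h2, h3⟩, hM⟩

theorem beta_hasType {Γ : Ctx} {M N : Tm} {A : Ty} (h : Cl BetaGround M N)
    (hM : HasType Γ M A) : HasType Γ N A :=
  h.hasType (fun h hM => h.hasType hM) hM

/-! ### Local confluence of `β` on typed representatives -/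


theorem Cl.star_lam {G : Tm → Tm → Prop} {M N : Tm} (A : Ty) (h : ReflTransGen (Cl G) M N) :
    ReflTransGen (Cl G) (.lam A M) (.lam A N) :=
  h.lift (Tm.lam A) fun _ _ => Cl.lam

theorem Cl.star_app {G : Tm → Tm → Prop} {M M' N N' : Tm} (h1 : ReflTransGen (Cl G) M M')
    (h2 : ReflTransGen (Cl G) N N') : ReflTransGen (Cl G) (.app M N) (.app M' N') :=
  (h1.lift (fun M => Tm.app M N) fun _ _ => Cl.appL).trans
    (h2.lift (fun N => Tm.app M' N) fun _ _ => Cl.appR)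

theorem Cl.star_body {G : Tm → Tm → Prop} {M N : Tm} (Ps : List Tm)
    (h : ReflTransGen (Cl G) M N) : ReflTransGen (Cl G) (.sub M Ps) (.sub N Ps) :=
  h.lift (fun M => Tm.sub M Ps) fun _ _ => Cl.body

theorem Cl.star_arg {G : Tm → Tm → Prop} {M N : Tm} (P : Tm) (Ps Qs : List Tm)
    (h : ReflTransGen (Cl G) M N) :
    ReflTransGen (Cl G) (.sub P (Ps ++ M :: Qs)) (.sub P (Ps ++ N :: Qs)) :=
  h.lift (fun M => Tm.sub P (Ps ++ M :: Qs)) fun _ _ => Cl.arg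

theorem Cl.star_args {G : Tm → Tm → Prop} {Ns Ns' : List Tm} (P : Tm)
    (h : List.Forall₂ (ReflTransGen (Cl G)) Ns Ns') (Ps : List Tm) :
    ReflTransGen (Cl G) (.sub P (Ps ++ Ns)) (.sub P (Ps ++ Ns')) := by
  induction h generalizing Ps with
  | nil => exact .refl
  | @cons N N' Ns Ns' h _ ih =>
    refine (Cl.star_arg P Ps Ns h).trans ?_
    simpa using ih (Ps ++ [N'])

theorem beta_star_subst_right (M : Tm) {s t : ℕ → Tm}
    (h : ∀ i, ReflTransGen (Cl BetaGround) (s i) (t i)) :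
    ReflTransGen (Cl BetaGround) (M.subst s) (M.subst t) := by
  induction M generalizing s t with
  | var i => exact h i
  | lam A M ih =>
    refine Cl.star_lam A (ih fun i => ?_)
    cases i with
    | zero => exact .refl
    | succ i => exact (h i).lift (Tm.rename Nat.succ) fun _ _ h => beta_rename h _
  | app M N ihM ihN => exact Cl.star_app (ihM h) (ihN h)
  | sub M Ns _ ih =>
    rw [Tm.subst_sub, Tm.subst_sub]
    refine Cl.star_args M ?_ []
    rw [List.forall₂_map_left_iff, List.forall₂_map_right_iff, List.forall₂_same]
    exact fun N hN => ih N hN h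

theorem beta_star_splice {R R' : Tm} (h : Cl BetaGround R R') (p k i : ℕ) :
    ReflTransGen (Cl BetaGround) (spliceSubst p k R i) (spliceSubst p k R' i) := by
  unfold spliceSubst
  split_ifs
  · exact .refl
  · exact .single (beta_rename h _)
  · exact .refl

/-- Contracting an explicit substitution into the body and then one of its own arguments amounts
to performing the two contractions in the opposite order. -/
theorem splice_splice_nested (M R S : Tm) {p a k l : ℕ} (h : a < k) :
    (M.subst (spliceSubst p k R)).subst (spliceSubst (p + a) l S) =
      M.subst (spliceSubst p (k - 1 + l) (R.subst (spliceSubst a l S))) := by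
  rw [Tm.subst_subst]
  congr 1
  funext i
  simp only [Function.comp]
  rcases lt_trichotomy i p with hi | rfl | hi
  · rw [spliceSubst_lt _ hi, spliceSubst_lt _ hi, Tm.subst_var, spliceSubst_lt _ (by omega)]
  · rw [spliceSubst_self, spliceSubst_self, Tm.subst_rename, Tm.rename_subst]
    congr 1
    funext j
    simp only [Function.comp]
    rcases lt_trichotomy j a with hj | rfl | hj
    · rw [spliceSubst_lt _ hj, spliceSubst_lt _ (by omega)]; rfl
    · rw [spliceSubst_self, spliceSubst_self, Tm.rename_rename]
      congr 1
      funext m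
      simp only [Function.comp]
      omega
    · rw [spliceSubst_gt _ hj, spliceSubst_gt _ (by omega), Tm.rename_var]
      congr 1
      omega
  · rw [spliceSubst_gt _ hi, spliceSubst_gt _ hi, Tm.subst_var, spliceSubst_gt _ (by omega)]
    congr 1
    omega

/-- The contractions of two arguments at different positions `p < q` commute.  The free variables
of the body `R` put at position `p` have to be bound. -/
theorem splice_splice_disjoint (M R S : Tm) {p q k l : ℕ} (h : p < q)
    (hR : ∀ j, R.Free j → j < k) :
    (M.subst (spliceSubst p k R)).subst (spliceSubst (q - 1 + k) l S) =
      (M.subst (spliceSubst q l S)).subst (spliceSubst p k R) := by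
  rw [Tm.subst_subst, Tm.subst_subst]
  congr 1
  funext i
  simp only [Function.comp]
  rcases lt_trichotomy i p with hi | rfl | hi
  · rw [spliceSubst_lt _ hi, spliceSubst_lt _ (by omega), Tm.subst_var, Tm.subst_var,
      spliceSubst_lt _ hi, spliceSubst_lt _ (by omega)]
  · rw [spliceSubst_lt _ h, Tm.subst_var, spliceSubst_self, Tm.subst_rename, ← Tm.subst_var_comp]
    refine Tm.subst_congr _ fun j hj => ?_
    have := hR j hj
    change spliceSubst _ _ _ (i + j) = .var (i + j)
    exact spliceSubst_lt _ (by omega)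
  · rcases lt_trichotomy i q with hq | rfl | hq
    · rw [spliceSubst_gt _ hi, spliceSubst_lt _ hq, Tm.subst_var, Tm.subst_var,
        spliceSubst_gt _ hi, spliceSubst_lt _ (by omega)]
    · rw [spliceSubst_gt _ hi, Tm.subst_var, spliceSubst_self, spliceSubst_self,
        Tm.subst_rename, ← Tm.subst_var_comp]
      congr 1
      funext j
      simp only [Function.comp]
      rw [spliceSubst_gt _ (by omega)]
      congr 1
      omega
    · rw [spliceSubst_gt _ hi, spliceSubst_gt _ hq, Tm.subst_var, Tm.subst_var,
        spliceSubst_gt _ (by omega), spliceSubst_gt _ (by omega)]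
      congr 1
      omega

/-- Two representatives with a common `β`-reduct. -/
def BetaJoin (M N : Tm) : Prop :=
  ∃ P, ReflTransGen (Cl BetaGround) M P ∧ ReflTransGen (Cl BetaGround) N P

theorem BetaJoin.symm {M N : Tm} (h : BetaJoin M N) : BetaJoin N M :=
  let ⟨P, h1, h2⟩ := h; ⟨P, h2, h1⟩

theorem BetaJoin.refl (M : Tm) : BetaJoin M M := ⟨M, .refl, .refl⟩

theorem BetaJoin.lift {M N : Tm} (g : Tm → Tm)
    (hg : ∀ M N, Cl BetaGround M N → Cl BetaGround (g M) (g N)) (h : BetaJoin M N) :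
    BetaJoin (g M) (g N) :=
  let ⟨P, h1, h2⟩ := h; ⟨g P, h1.lift g hg, h2.lift g hg⟩

theorem betaJoin_beta1 {A : Ty} {M N T : Tm} (h : Cl BetaGround (.app (.lam A M) N) T) :
    BetaJoin (M.subst (inst N)) T := by
  cases h with
  | ground h => cases h; exact .refl _
  | appL h =>
    cases h with
    | ground h => cases h
    | @lam _ _ M' h =>
      exact ⟨M'.subst (inst N), .single (beta_subst h _), .single (.ground (.beta1 _ _ _))⟩
  | @appR _ N' _ h =>
    refine ⟨M.subst (inst N'), beta_star_subst_right M fun i => ?_,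
      .single (.ground (.beta1 _ _ _))⟩
    cases i with
    | zero => exact .single h
    | succ i => exact .refl

/-- A step `β₂` against a step in the argument that it contracts. -/
theorem betaJoin_beta2_arg {M R T : Tm} {Ps Ks Qs : List Tm} (h : Cl BetaGround (.sub R Ks) T) :
    BetaJoin (.sub (M.subst (spliceSubst Ps.length Ks.length R)) (Ps ++ Ks ++ Qs))
      (.sub M (Ps ++ T :: Qs)) := by
  cases h with
  | @body _ R' _ h =>
    exact ⟨_, Cl.star_body _ (beta_star_subst_right M fun i => beta_star_splice h _ _ i),
      .single (.ground (.beta2 M R' Ps Ks Qs))⟩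
  | @arg _ K K' As Bs h =>
    refine ⟨_, .single ?_, .single (.ground (.beta2 M R Ps (As ++ K' :: Bs) Qs))⟩
    have := Cl.arg (P := M.subst (spliceSubst Ps.length (As ++ K :: Bs).length R))
      (Ps := Ps ++ As) (Qs := Bs ++ Qs) h
    simpa using this
  | ground h =>
    cases h with
    | beta2 _ S As Ls Bs =>
      refine ⟨_, .single ?_, .single (.ground (.beta2 M _ Ps (As ++ Ls ++ Bs) Qs))⟩
      have := BetaGround.beta2 (M.subst (spliceSubst Ps.length (As ++ .sub S Ls :: Bs).length R))
        S (Ps ++ As) Ls (Bs ++ Qs)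
      rw [List.length_append (as := Ps), splice_splice_nested _ _ _ (by simp)] at this
      have hl : (As ++ .sub S Ls :: Bs).length - 1 + Ls.length = (As ++ Ls ++ Bs).length := by
        simp; omega
      rw [hl] at this
      simpa using Cl.ground this

/-- Steps `β₂` contracting different arguments of the same explicit substitution. -/
theorem betaJoin_beta2_beta2 {M R S : Tm} {Ps Ks L Ls Qs : List Tm}
    (hR : ∀ j, R.Free j → j < Ks.length) :
    BetaJoin
      (.sub (M.subst (spliceSubst Ps.length Ks.length R)) (Ps ++ Ks ++ (L ++ .sub S Ls :: Qs)))
      (.sub (M.subst (spliceSubst (Ps ++ .sub R Ks :: L).length Ls.length S))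
        (Ps ++ .sub R Ks :: L ++ Ls ++ Qs)) := by
  have h1 := BetaGround.beta2 (M.subst (spliceSubst Ps.length Ks.length R)) S (Ps ++ Ks ++ L) Ls Qs
  have h2 := BetaGround.beta2
    (M.subst (spliceSubst (Ps ++ .sub R Ks :: L).length Ls.length S)) R Ps Ks (L ++ Ls ++ Qs)
  rw [← splice_splice_disjoint _ _ _ (by simp) hR] at h2
  have hl : (Ps ++ .sub R Ks :: L).length - 1 + Ks.length = (Ps ++ Ks ++ L).length := by
    simp; omega
  rw [hl] at h2
  exact ⟨_, .single (.ground (by simpa using h1)), .single (.ground (by simpa using h2))⟩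

theorem betaJoin_beta2 {M R T : Tm} {Ps Ks Qs : List Tm} (hR : ∀ j, R.Free j → j < Ks.length)
    (hfree : ∀ S Ls, Tm.sub S Ls ∈ Ps ++ Qs → ∀ j, S.Free j → j < Ls.length)
    (h : Cl BetaGround (.sub M (Ps ++ .sub R Ks :: Qs)) T) :
    BetaJoin (.sub (M.subst (spliceSubst Ps.length Ks.length R)) (Ps ++ Ks ++ Qs)) T := by
  generalize hl : Ps ++ .sub R Ks :: Qs = Ns at h
  cases h with
  | @body _ M' _ h =>
    subst hl
    exact ⟨_, .single (.body (beta_subst h _)), .single (.ground (.beta2 _ _ _ _ _))⟩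
  | @arg _ N N' Ps' Qs' h =>
    rcases split_split hl with ⟨rfl, rfl, rfl⟩ | ⟨L, rfl, rfl⟩ | ⟨L, rfl, rfl⟩
    · exact betaJoin_beta2_arg h
    · refine ⟨.sub (M.subst (spliceSubst Ps.length Ks.length R)) (Ps ++ Ks ++ (L ++ N' :: Qs')),
        .single ?_, .single ?_⟩
      · simpa using Cl.arg (Ps := Ps ++ Ks ++ L) (Qs := Qs') h
      · simpa using Cl.ground (BetaGround.beta2 M R Ps Ks (L ++ N' :: Qs'))
    · refine ⟨.sub (M.subst (spliceSubst (Ps' ++ N :: L).length Ks.length R))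
        (Ps' ++ N' :: L ++ Ks ++ Qs), .single ?_, .single ?_⟩
      · simpa using Cl.arg (Ps := Ps') (Qs := L ++ Ks ++ Qs) h
      · have := Cl.ground (BetaGround.beta2 M R (Ps' ++ N' :: L) Ks Qs)
        simpa using this
  | ground h =>
    cases h with
    | beta2 _ S Ps' Ls Qs' =>
      rcases split_split hl with ⟨rfl, h, rfl⟩ | ⟨L, rfl, rfl⟩ | ⟨L, rfl, rfl⟩
      · cases h; exact .refl _
      · exact betaJoin_beta2_beta2 hR
      · exact (betaJoin_beta2_beta2 (hfree S Ls (by simp))).symm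

theorem HasType.free_lt_length {Γ : Ctx} {M : Tm} {Ns : List Tm} {A : Ty}
    (h : HasType Γ (.sub M Ns) A) (j : ℕ) (hj : M.Free j) : j < Ns.length := by
  obtain ⟨Δ, C, rfl, hl, -, hM⟩ := h.sub_inv
  exact hl ▸ hM.lt_of_free hj

/-- Local confluence of `β` on typed representatives. -/
theorem HasType.betaJoin {Γ : Ctx} {M : Tm} {A : Ty} (hM : HasType Γ M A) {N₁ N₂ : Tm}
    (h1 : Cl BetaGround M N₁) (h2 : Cl BetaGround M N₂) : BetaJoin N₁ N₂ := by
  induction M generalizing Γ A N₁ N₂ with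
  | var i => exact (not_beta_var h1).elim
  | lam B M ih =>
    obtain ⟨C, rfl, hM'⟩ := hM.lam_inv
    cases h1 with
    | ground h => cases h
    | lam h1 =>
      cases h2 with
      | ground h => cases h
      | lam h2 => exact (ih hM' h1 h2).lift (Tm.lam B) fun _ _ => Cl.lam
  | app M N ihM ihN =>
    obtain ⟨B, hM, hN⟩ := hM.app_inv
    cases h1 with
    | ground h => cases h; exact betaJoin_beta1 h2
    | @appL _ M₁ _ h1 =>
      cases h2 with
      | ground h => cases h; exact (betaJoin_beta1 (.appL h1)).symm
      | appL h2 => exact (ihM hM h1 h2).lift (fun M => .app M N) fun _ _ => Cl.appL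
      | appR h2 => exact ⟨_, .single (.appR h2), .single (.appL h1)⟩
    | @appR _ N₁ _ h1 =>
      cases h2 with
      | ground h => cases h; exact (betaJoin_beta1 (.appR h1)).symm
      | appL h2 => exact ⟨_, .single (.appL h2), .single (.appR h1)⟩
      | appR h2 => exact (ihN hN h1 h2).lift (fun N => .app M N) fun _ _ => Cl.appR
  | sub M Ns ihM ih =>
    have hsub := hM
    obtain ⟨Δ, C, rfl, hl, hN, hM⟩ := hM.sub_inv
    have harg := fun {N} => HasType.sub_inv_arg hl hN (N := N)
    have hfree : ∀ S Ls, Tm.sub S Ls ∈ Ns → ∀ j, S.Free j → j < Ls.length := fun S Ls h =>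
      (harg h).elim fun B hB => hB.free_lt_length
    have hground : ∀ {T₁ T₂}, BetaGround (.sub M Ns) T₁ → Cl BetaGround (.sub M Ns) T₂ →
        BetaJoin T₁ T₂ := by
      intro T₁ T₂ h1 h2
      cases h1
      exact betaJoin_beta2 (hfree _ _ (by simp)) (fun S Ls h => hfree S Ls (by
        simp only [List.mem_append, List.mem_cons] at h ⊢; tauto)) h2
    have h1' := h1
    have h2' := h2
    generalize hNs : Ns = Ns' at h2
    cases h1 with
    | ground h => exact hground h h2'
    | @body _ M₁ _ h1 =>
      cases h2 with
      | ground h => subst hNs; exact (hground h h1').symm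
      | body h2 => subst hNs; exact (ihM hM h1 h2).lift (fun M => .sub M Ns) fun _ _ => Cl.body
      | arg h2 => subst hNs; exact ⟨_, .single (.arg h2), .single (.body h1)⟩
    | @arg _ N N₁ Ps Qs h1 =>
      cases h2 with
      | ground h => subst hNs; exact (hground h h1').symm
      | body h2 => subst hNs; exact ⟨_, .single (.body h2), .single (.arg h1)⟩
      | @arg _ P P₁ Ps' Qs' h2 =>
        rcases split_split hNs with ⟨rfl, rfl, rfl⟩ | ⟨L, rfl, rfl⟩ | ⟨L, rfl, rfl⟩
        · obtain ⟨B, hB⟩ := harg (N := N) (by simp)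
          exact (ih N (by simp) hB h1 h2).lift (fun N => .sub M (Ps ++ N :: Qs)) fun _ _ => Cl.arg
        · refine ⟨.sub M (Ps ++ N₁ :: (L ++ P₁ :: Qs')), .single ?_, .single ?_⟩
          · simpa using Cl.arg (P := M) (Ps := Ps ++ N₁ :: L) (Qs := Qs') h2
          · simpa using Cl.arg (P := M) (Ps := Ps) (Qs := L ++ P₁ :: Qs') h1
        · refine ⟨.sub M (Ps' ++ P₁ :: (L ++ N₁ :: Qs)), .single ?_, .single ?_⟩
          · simpa using Cl.arg (P := M) (Ps := Ps') (Qs := L ++ N₁ :: Qs) h2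
          · simpa using Cl.arg (P := M) (Ps := Ps' ++ P₁ :: L) (Qs := Qs) h1

/-- Newman's lemma, relative to a predicate that is closed under the relation. -/
theorem newman {α : Type*} {r : α → α → Prop} {P : α → Prop} (hP : ∀ a b, P a → r a b → P b)
    (hr : ∀ a b c, P a → r a b → r a c → ∃ d, ReflTransGen r b d ∧ ReflTransGen r c d)
    {a : α} (ha : Acc (fun a b => r b a) a) (hPa : P a) {b c : α} (hb : ReflTransGen r a b)
    (hc : ReflTransGen r a c) : ∃ d, ReflTransGen r b d ∧ ReflTransGen r c d := by
  induction ha generalizing b c with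
  | intro a _ ih =>
    rcases hb.cases_head with rfl | ⟨b', hab, hb⟩
    · exact ⟨c, hc, .refl⟩
    rcases hc.cases_head with rfl | ⟨c', hac, hc⟩
    · exact ⟨b, .refl, .head hab hb⟩
    obtain ⟨d, h1, h2⟩ := hr a b' c' hPa hab hac
    obtain ⟨e, h3, h4⟩ := ih b' hab (hP _ _ hPa hab) hb h1
    obtain ⟨f, h5, h6⟩ := ih c' hac (hP _ _ hPa hac) hc (h2.trans h4)
    exact ⟨f, h3.trans h6, h5⟩

theorem HasType.beta_confluent {Γ : Ctx} {M : Tm} {A : Ty} (hM : HasType Γ M A) {N₁ N₂ : Tm}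
    (h1 : ReflTransGen (Cl BetaGround) M N₁) (h2 : ReflTransGen (Cl BetaGround) M N₂) :
    BetaJoin N₁ N₂ :=
  newman (P := fun M => HasType Γ M A) (fun _ _ hM h => beta_hasType h hM)
    (fun _ _ _ hM h1 h2 => hM.betaJoin h1 h2) hM.sn hM h1 h2

/-! ### Permutation equivalence is a bisimulation for `β` -/

/-- The permutation of the arguments of the result of a step `β₂` at position `p`: it acts as `σ` on
the `n - 1` remaining arguments, and as `τ` on the `k` arguments put in place of the contracted
one. -/
theorem exists_perm_splice {σ τ : Equiv.Perm ℕ} {p k n : ℕ} (hp : p < n)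
    (hσ : ∀ i, n ≤ i → σ i = i) (hτ : ∀ i, k ≤ i → τ i = i) :
    ∃ ρ : Equiv.Perm ℕ, (∀ i, n - 1 + k ≤ i → ρ i = i) ∧ (∀ j < k, ρ (p + j) = σ p + τ j) ∧
      ∀ i, i ≠ p → ρ (if i < p then i else i - 1 + k) =
        if σ i < σ p then σ i else σ i - 1 + k := by
  let f : ℕ → ℕ := fun i =>
    if i < p then (if σ i < σ p then σ i else σ i - 1 + k)
    else if i < p + k then σ p + τ (i - p)
    else (if σ (i + 1 - k) < σ p then σ (i + 1 - k) else σ (i + 1 - k) - 1 + k)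
  have hτlt := perm_lt_iff hτ
  have hσlt := (perm_lt_iff hσ p).2 hp
  have hne : ∀ i, i ≠ p → σ i ≠ σ p := fun i hi h => hi (σ.injective h)
  have hinj : Function.Injective f := by
    intro i j hij
    simp only [f] at hij
    have hmid : ∀ i, p ≤ i → i < p + k → τ (i - p) < k := fun i _ _ => (hτlt _).2 (by omega)
    have hσinj : ∀ a b, σ a = σ b → a = b := fun a b h => σ.injective h
    have hτinj : ∀ a b, τ a = τ b → a = b := fun a b h => τ.injective h
    rcases lt_or_ge i p with hi | hi
    · have a1 := hne i (by omega)
      rcases lt_or_ge j p with hj | hj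
      · have a2 := hne j (by omega)
        have a3 := hσinj i j
        simp only [hi, hj, if_true] at hij
        split_ifs at hij <;> omega
      · rcases lt_or_ge j (p + k) with hj' | hj'
        · have a2 := hmid j hj hj'
          simp only [hi, hj.not_gt, hj', if_true, if_false] at hij
          split_ifs at hij <;> omega
        · have a2 := hne (j + 1 - k) (by omega)
          have a3 := hσinj i (j + 1 - k)
          simp only [hi, hj.not_gt, hj'.not_gt, if_true, if_false] at hij
          split_ifs at hij <;> omega
    · rcases lt_or_ge i (p + k) with hi' | hi'
      · have a1 := hmid i hi hi'
        rcases lt_or_ge j p with hj | hj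
        · have a2 := hne j (by omega)
          simp only [hi.not_gt, hi', hj, if_true, if_false] at hij
          split_ifs at hij <;> omega
        · rcases lt_or_ge j (p + k) with hj' | hj'
          · have a3 := hτinj (i - p) (j - p)
            simp only [hi.not_gt, hi', hj.not_gt, hj', if_true, if_false] at hij
            omega
          · have a2 := hne (j + 1 - k) (by omega)
            simp only [hi.not_gt, hi', hj.not_gt, hj'.not_gt, if_true, if_false] at hij
            split_ifs at hij <;> omega
      · have a1 := hne (i + 1 - k) (by omega)
        rcases lt_or_ge j p with hj | hj
        · have a2 := hne j (by omega)
          have a3 := hσinj (i + 1 - k) j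
          simp only [hi.not_gt, hi'.not_gt, hj, if_true, if_false] at hij
          split_ifs at hij <;> omega
        · rcases lt_or_ge j (p + k) with hj' | hj'
          · have a2 := hmid j hj hj'
            simp only [hi.not_gt, hi'.not_gt, hj.not_gt, hj', if_true, if_false] at hij
            split_ifs at hij <;> omega
          · have a2 := hne (j + 1 - k) (by omega)
            have a3 := hσinj (i + 1 - k) (j + 1 - k)
            simp only [hi.not_gt, hi'.not_gt, hj.not_gt, hj'.not_gt, if_false] at hij
            split_ifs at hij <;> omega
  have hfix : ∀ i, n - 1 + k ≤ i → f i = i := by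
    intro i hi
    have h1 : ¬ i < p := by omega
    have h2 : ¬ i < p + k := by omega
    have h3 : σ (i + 1 - k) = i + 1 - k := hσ _ (by omega)
    simp only [f, h1, h2, h3, if_false]
    split_ifs <;> omega
  obtain ⟨ρ, hρ⟩ := exists_perm_of_injective hinj hfix
  refine ⟨ρ, fun i hi => (hρ i).trans (hfix i hi), fun j hj => ?_, fun i hi => ?_⟩
  · have h1 : ¬ p + j < p := by omega
    have h2 : p + j < p + k := by omega
    simp only [hρ, f, h1, h2, if_true, if_false, Nat.add_sub_cancel_left]
  · rw [hρ]
    rcases lt_or_ge i p with h | h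
    · simp only [f, h, if_true]
    · have h1 : ¬ i - 1 + k < p := by omega
      have h2 : ¬ i - 1 + k < p + k := by omega
      have h3 : i - 1 + k + 1 - k = i := by omega
      simp only [f, h.not_gt, h1, h2, h3, if_false]

theorem nth_splice_ne {Ps Ks Qs : List Tm} (N : Tm) {m : ℕ} (h : m ≠ Ps.length) :
    nth (Ps ++ Ks ++ Qs) (if m < Ps.length then m else m - 1 + Ks.length) =
      nth (Ps ++ N :: Qs) m := by
  split_ifs with hm
  · exact nth_splice_lt N hm
  · exact nth_splice_gt N (by omega)

/-- Equivalent redexes for `β₂`, with contracted arguments that correspond to each other under the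
permutation `σ`, have equivalent contracta. -/
theorem PE.beta2 {M M' R R' : Tm} {Ps Ks Qs Ps' Ks' Qs' : List Tm} (σ τ : Equiv.Perm ℕ)
    (hl : (Ps ++ .sub R Ks :: Qs).length = (Ps' ++ .sub R' Ks' :: Qs').length)
    (hσ : ∀ i, (Ps ++ .sub R Ks :: Qs).length ≤ i → σ i = i) (hM : PE (M.rename σ) M')
    (hN : ∀ i, PE (nth (Ps ++ .sub R Ks :: Qs) i) (nth (Ps' ++ .sub R' Ks' :: Qs') (σ i)))
    (hp : σ Ps.length = Ps'.length) (hlK : Ks.length = Ks'.length)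
    (hτ : ∀ i, Ks.length ≤ i → τ i = i) (hR : PE (R.rename τ) R')
    (hK : ∀ i, PE (nth Ks i) (nth Ks' (τ i))) (hfree : ∀ j, R.Free j → j < Ks.length) :
    PE (.sub (M.subst (spliceSubst Ps.length Ks.length R)) (Ps ++ Ks ++ Qs))
      (.sub (M'.subst (spliceSubst Ps'.length Ks'.length R')) (Ps' ++ Ks' ++ Qs')) := by
  obtain ⟨ρ, h1, h2, h3⟩ := exists_perm_splice (p := Ps.length) (by simp) hσ hτ
  rw [hp] at h2 h3
  have hne : ∀ i, i ≠ Ps.length → σ i ≠ Ps'.length := fun i hi h =>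
    hi (σ.injective (h.trans hp.symm))
  simp only [List.length_append, List.length_cons] at hl h1
  refine .sub ρ (by simp; omega) (fun i hi => h1 i ?_) ?_ fun i => ?_
  · simp only [List.length_append] at hi; omega
  · have : (M.subst (spliceSubst Ps.length Ks.length R)).rename ρ =
        (M.rename σ).subst
          (Tm.rename ρ ∘ spliceSubst Ps.length Ks.length R ∘ σ.symm) := by
      rw [Tm.rename_subst, Tm.subst_rename]
      congr 1
      funext i
      simp
    rw [this]
    refine hM.subst fun i => ?_
    obtain ⟨i, rfl⟩ := σ.surjective i
    simp only [Function.comp, Equiv.symm_apply_apply]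
    by_cases hi : i = Ps.length
    · subst hi
      rw [spliceSubst_self, hp, spliceSubst_self]
      have : (R.rename fun j => Ps.length + j).rename ρ =
          (R.rename τ).rename fun j => Ps'.length + j := by
        rw [Tm.rename_rename, Tm.rename_rename]
        exact Tm.rename_congr _ fun j hj => h2 j (hfree j hj)
      rw [this]
      exact hR.rename _
    · have h4 := h3 i hi
      have h5 := hne i hi
      unfold spliceSubst
      rw [if_neg hi, if_neg h5, ← hlK]
      split_ifs at h4 ⊢ <;> rw [Tm.rename_var, h4] <;> exact .refl _
  · have key : ∀ m, m ≠ Ps.length → PE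
        (nth (Ps ++ Ks ++ Qs) (if m < Ps.length then m else m - 1 + Ks.length))
        (nth (Ps' ++ Ks' ++ Qs') (ρ (if m < Ps.length then m else m - 1 + Ks.length))) := by
      intro m hm
      rw [h3 m hm, hlK, nth_splice_ne (.sub R' Ks') (hne m hm), ← hlK,
        nth_splice_ne (.sub R Ks) hm]
      exact hN m
    rcases lt_or_ge i Ps.length with hi | hi
    · simpa only [hi, if_true] using key i hi.ne
    · rcases lt_or_ge i (Ps.length + Ks.length) with hi' | hi'
      · obtain ⟨j, rfl⟩ : ∃ j, i = Ps.length + j := ⟨i - Ps.length, by omega⟩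
        have hj : j < Ks.length := by omega
        rw [h2 j hj, nth_splice_mid hj, nth_splice_mid (hlK ▸ (perm_lt_iff hτ j).2 hj)]
        exact hK j
      · have h4 : ¬ i + 1 - Ks.length < Ps.length := by omega
        have h5 : i + 1 - Ks.length - 1 + Ks.length = i := by omega
        simpa only [h4, h5, if_false] using key (i + 1 - Ks.length) (by omega)

/-- Permutation equivalence is a bisimulation for `β` on typed representatives. -/
theorem PE.beta {M M' N : Tm} (h : PE M M') {Γ : Ctx} {A : Ty} (hM : HasType Γ M A)
    (hs : Cl BetaGround M N) : ∃ N', Cl BetaGround M' N' ∧ PE N N' := by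
  induction h generalizing Γ A N with
  | var i => exact (not_beta_var hs).elim
  | @lam B _ _ _ ih =>
    obtain ⟨C, rfl, hM'⟩ := hM.lam_inv
    cases hs with
    | ground h => cases h
    | lam hs =>
      obtain ⟨N', h1, h2⟩ := ih hM' hs
      exact ⟨_, .lam h1, .lam h2⟩
  | @app M M' P P' hMM hPP ihM ihP =>
    obtain ⟨B, hM, hP⟩ := hM.app_inv
    cases hs with
    | ground h =>
      cases h
      cases hMM with
      | lam h =>
        refine ⟨_, .ground (.beta1 _ _ _), h.subst fun i => ?_⟩
        cases i with
        | zero => exact hPP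
        | succ i => exact .var i
    | appL hs =>
      obtain ⟨N', h1, h2⟩ := ihM hM hs
      exact ⟨_, .appL h1, .app h2 hPP⟩
    | appR hs =>
      obtain ⟨N', h1, h2⟩ := ihP hP hs
      exact ⟨_, .appR h1, .app hMM h2⟩
  | @sub M M' Ns Ns' σ hl hσ hMM hNN ihM ih =>
    obtain ⟨Δ, C, rfl, hlΔ, hN, hM⟩ := hM.sub_inv
    have hsplit : ∀ Ps P Qs, Ns = Ps ++ P :: Qs → ∃ Ps' P' Qs',
        Ns' = Ps' ++ P' :: Qs' ∧ σ Ps.length = Ps'.length ∧ PE P P' := by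
      rintro Ps P Qs rfl
      have hlt : σ Ps.length < Ns'.length := hl ▸ (perm_lt_iff hσ _).2 (by simp)
      obtain ⟨Ps', Qs', h1, h2⟩ := split_at hlt
      refine ⟨Ps', _, Qs', h1, h2.symm, ?_⟩
      simpa only [nth_middle] using hNN Ps.length
    cases hs with
    | body hs =>
      obtain ⟨Δ', -, hΔ⟩ := exists_perm_ctx Δ (σ := σ) fun i hi => hσ i (hlΔ ▸ hi)
      obtain ⟨N', h1, h2⟩ := ihM (hM.rename fun i B _ hB => by rw [hΔ, hB]) (beta_rename hs σ)
      exact ⟨_, .body h1, .sub σ hl hσ h2 hNN⟩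
    | @arg _ P P₁ Ps Qs hs =>
      obtain ⟨Ps', P', Qs', rfl, hσp, hPP⟩ := hsplit Ps P Qs rfl
      obtain ⟨B, hB⟩ := HasType.sub_inv_arg hlΔ hN (N := P) (by simp)
      obtain ⟨P₁', h1, h2⟩ := ih Ps.length (N := P₁) (by rwa [nth_middle]) (by rwa [nth_middle])
      rw [hσp, nth_middle] at h1
      refine ⟨_, .arg h1, .sub σ (by simpa using hl) (by simpa using hσ) hMM fun i => ?_⟩
      by_cases hi : i = Ps.length
      · rw [hi, nth_middle, hσp, nth_middle]; exact h2
      · rw [nth_middle_ne P₁ P hi,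
          nth_middle_ne P₁' P' fun h => hi (σ.injective (h.trans hσp.symm))]
        exact hNN i
    | ground h =>
      cases h with
      | beta2 _ R Ps Ks Qs =>
        obtain ⟨Ps', P', Qs', rfl, hσp, hPP⟩ := hsplit Ps (.sub R Ks) Qs rfl
        obtain ⟨B, hB⟩ := HasType.sub_inv_arg hlΔ hN (N := .sub R Ks) (by simp)
        cases hPP with
        | sub τ hlK hτ hR hK =>
          exact ⟨_, .ground (.beta2 _ _ _ _ _),
            PE.beta2 σ τ hl hσ hMM hNN hσp hlK hτ hR hK hB.free_lt_length⟩

/-- The class of the representative `M`. -/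
abbrev cls (M : Tm) : Term := Quotient.mk permSetoid M

theorem HasType.beta_lift {Γ : Ctx} {M : Tm} {A : Ty} (hM : HasType Γ M A) {t : Term}
    (h : Beta (cls M) t) : ∃ N, t = cls N ∧ Cl BetaGround M N := by
  obtain ⟨M', N', hs, hM', rfl⟩ := h
  have hpe := mk_eq_mk.1 hM'
  obtain ⟨N, h1, h2⟩ := hpe.beta (hpe.symm.hasType hM) (betaStep_iff.1 hs)
  exact ⟨N, mk_eq_mk.2 h2, h1⟩

theorem beta_cls {M N : Tm} (h : Cl BetaGround M N) : Beta (cls M) (cls N) :=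
  ⟨M, N, betaStep_iff.2 h, rfl, rfl⟩

theorem HasType.beta_lift_star {Γ : Ctx} {M : Tm} {A : Ty} (hM : HasType Γ M A) {t : Term}
    (h : ReflTransGen Beta (cls M) t) :
    ∃ N, t = cls N ∧ HasType Γ N A ∧ ReflTransGen (Cl BetaGround) M N := by
  induction h with
  | refl => exact ⟨M, rfl, hM, .refl⟩
  | tail _ hs ih =>
    obtain ⟨N, rfl, hN, h1⟩ := ih
    obtain ⟨P, rfl, h2⟩ := hN.beta_lift hs
    exact ⟨P, rfl, beta_hasType h2 hN, h1.tail h2⟩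

theorem Typed.beta_stronglyNormalizing {Γ : Ctx} {t : Term} {A : Ty} (ht : Typed Γ t A) :
    StronglyNormalizing Beta t := by
  obtain ⟨M, rfl, hM⟩ := ht
  have hsn := hM.sn
  induction hsn with
  | intro M _ ih =>
    refine ⟨_, fun t ht => ?_⟩
    obtain ⟨N, rfl, hs⟩ := hM.beta_lift ht
    exact ih N hs (beta_hasType hs hM)

theorem Typed.beta_confluent {Γ : Ctx} {t : Term} {A : Ty} (ht : Typed Γ t A) :
    Confluent Beta t := by
  obtain ⟨M, rfl, hM⟩ := ht
  intro u v hu hv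
  obtain ⟨N₁, rfl, -, h1⟩ := hM.beta_lift_star hu
  obtain ⟨N₂, rfl, -, h2⟩ := hM.beta_lift_star hv
  obtain ⟨P, h3, h4⟩ := hM.beta_confluent h1 h2
  exact ⟨cls P, h3.lift cls fun _ _ => beta_cls, h4.lift cls fun _ _ => beta_cls⟩

/-! ### Strong normalization of `κ` -/

mutual
/-- Number of nodes of a term. -/
def Tm.size : Tm → ℕ
  | .var _ => 1
  | .lam _ M => Tm.size M + 1
  | .app M N => Tm.size M + Tm.size N + 1
  | .sub M Ns => Tm.size M + Tm.sizeList Ns + 1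
/-- Number of nodes of a list of terms. -/
def Tm.sizeList : List Tm → ℕ
  | [] => 0
  | N :: Ns => Tm.size N + Tm.sizeList Ns
end

theorem Tm.size_pos (M : Tm) : 0 < M.size := by
  cases M <;> simp [Tm.size]

@[simp] theorem Tm.size_sub (M : Tm) (Ns : List Tm) :
    (Tm.sub M Ns).size = M.size + (Ns.map Tm.size).sum + 1 := by
  have : ∀ Ns, Tm.sizeList Ns = (Ns.map Tm.size).sum := by
    intro Ns
    induction Ns with
    | nil => rfl
    | cons N Ns ih => simp [Tm.sizeList, ih]
  rw [Tm.size, this]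

theorem Tm.size_rename (M : Tm) (f : ℕ → ℕ) : (M.rename f).size = M.size := by
  induction M generalizing f with
  | var i => rfl
  | lam A M ih => simp [Tm.size, ih]
  | app M N ihM ihN => simp [Tm.size, ihM, ihN]
  | sub M Ns _ ih =>
    simp only [Tm.rename_sub, Tm.size_sub, List.map_map]
    congr 3
    exact List.map_congr_left fun N hN => ih N hN f

theorem sum_map_eq_sum_range (g : Tm → ℕ) (Ns : List Tm) :
    (Ns.map g).sum = ∑ i ∈ Finset.range Ns.length, g (nth Ns i) := by
  induction Ns with
  | nil => rfl
  | cons N Ns ih =>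
    rw [List.length_cons, Finset.sum_range_succ']
    simp [ih, add_comm]

/-- A sum over the arguments is invariant under permutation. -/
theorem sum_map_perm {Ns Ns' : List Tm} {σ : Equiv.Perm ℕ} (g g' : Tm → ℕ)
    (hl : Ns.length = Ns'.length) (hσ : ∀ i, Ns.length ≤ i → σ i = i)
    (h : ∀ i < Ns.length, g (nth Ns i) = g' (nth Ns' (σ i))) :
    (Ns.map g).sum = (Ns'.map g').sum := by
  rw [sum_map_eq_sum_range, sum_map_eq_sum_range, ← hl]
  refine Finset.sum_equiv σ (fun i => ?_) fun i hi => h i (by simpa using hi)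
  simpa using (perm_lt_iff hσ i).symm

theorem PE.size_eq {M M' : Tm} (h : PE M M') : M.size = M'.size := by
  induction h with
  | var i => rfl
  | lam _ ih => simp [Tm.size, ih]
  | app _ _ ih1 ih2 => simp [Tm.size, ih1, ih2]
  | sub σ hl hσ _ _ ihM ih =>
    rw [Tm.size_rename] at ihM
    rw [Tm.size_sub, Tm.size_sub, ihM, sum_map_perm Tm.size Tm.size hl hσ fun i _ => ih i]

theorem KappaGround.size_lt {M N : Tm} (h : KappaGround M N) : N.size < M.size := by
  cases h with
  | kappa1 M N Ps Qs _ =>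
    have := N.size_pos
    simp [Tm.size_rename]; omega
  | kappa2 M N Ps Qs =>
    have := N.size_pos
    simp [Tm.size_rename]; omega

theorem kappa_size_lt {M N : Tm} (h : Cl KappaGround M N) : N.size < M.size := by
  induction h with
  | ground h => exact h.size_lt
  | lam _ ih => simpa [Tm.size] using ih
  | appL _ ih => simpa [Tm.size] using ih
  | appR _ ih => simpa [Tm.size] using ih
  | body _ ih => simpa using ih
  | arg _ ih => simpa using ih

/-- The size of a term modulo permutations. -/
def Term.size : Term → ℕ :=
  Quotient.lift Tm.size fun _ _ h => (pe_of_permEq h).size_eq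

theorem Kappa.size_lt {t u : Term} (h : Kappa t u) : u.size < t.size := by
  obtain ⟨M, N, hs, rfl, rfl⟩ := h
  exact kappa_size_lt (kappaStep_iff.1 hs)

theorem kappa_stronglyNormalizing (t : Term) : StronglyNormalizing Kappa t :=
  Subrelation.accessible (fun h => Kappa.size_lt h)
    (InvImage.accessible Term.size (Nat.lt_wfRel.wf.apply _))

/-! ### Subject reduction for `κ` -/

theorem HasType.unique {Γ : Ctx} {M : Tm} {A B : Ty} (h1 : HasType Γ M A) (h2 : HasType Γ M B) :
    A = B := by
  induction M generalizing Γ A B with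
  | var i => exact Option.some.inj (h1.var_inv.symm.trans h2.var_inv)
  | lam C M ih =>
    obtain ⟨D, rfl, h1'⟩ := h1.lam_inv
    obtain ⟨E, rfl, h2'⟩ := h2.lam_inv
    rw [ih h1' h2']
  | app M N ihM _ =>
    obtain ⟨C, h1, _⟩ := h1.app_inv
    obtain ⟨D, h2, _⟩ := h2.app_inv
    exact (Ty.arr.inj (ihM h1 h2)).2
  | sub M Ns ihM ih =>
    obtain ⟨Δ, C, rfl, hl, hN, hM⟩ := h1.sub_inv
    obtain ⟨Δ', C', rfl, hl', hN', hM'⟩ := h2.sub_inv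
    have : Δ = Δ' := by
      refine List.ext_getElem (hl.symm.trans hl') fun i hi hi' => ?_
      exact Ty.box.inj (ih _ (nth_mem (hl ▸ hi)) (hN i _ (List.getElem?_eq_getElem hi))
        (hN' i _ (List.getElem?_eq_getElem hi')))
    subst this
    rw [ihM hM hM']

theorem KappaGround.hasType {Γ : Ctx} {M N : Tm} {A : Ty} (h : KappaGround M N)
    (hM : HasType Γ M A) : HasType Γ N A := by
  cases h with
  | kappa1 M N Ps Qs hc =>
    obtain ⟨Δ, C, rfl, hN, hM⟩ := HasType.sub_iff.1 hM
    obtain ⟨Δ₁, B, Δ₂, rfl, h1, h2, h3⟩ := forall₂_append_cons_iff.1 hN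
    refine HasType.sub_iff.2 ⟨Δ₁ ++ Δ₂, C, rfl, forall₂_append h1 h3, hM.rename fun i D hi hD => ?_⟩
    have hne : i ≠ Ps.length := fun h => hi (h ▸ hc)
    rw [h1.length_eq] at hne ⊢
    unfold lower
    split_ifs with hle
    · have hlt : i < Δ₁.length := by omega
      rw [List.getElem?_append_left hlt] at hD ⊢
      exact hD
    · obtain ⟨j, rfl⟩ : ∃ j, i = Δ₁.length + (j + 1) := ⟨i - Δ₁.length - 1, by omega⟩
      rw [List.getElem?_append_right (by omega), Nat.add_sub_cancel_left,
        List.getElem?_cons_succ] at hD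
      rw [List.getElem?_append_right (by omega), ← hD]
      congr 1
      omega
  | kappa2 M N Ps Qs =>
    obtain ⟨Δ, C, rfl, hN, hM⟩ := HasType.sub_iff.1 hM
    obtain ⟨Δ₁, B, Δ₂, rfl, h1, h2, h3⟩ := forall₂_append_cons_iff.1 hN
    cases h3 with
    | @cons _ B' _ Δ₂ h3 h4 =>
      obtain rfl : B = B' := Ty.box.inj (h2.unique h3)
      refine HasType.sub_iff.2 ⟨Δ₁ ++ B :: Δ₂, C, rfl, forall₂_append h1 (.cons h2 h4),
        hM.rename fun i D hi hD => ?_⟩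
      rw [h1.length_eq]
      unfold lower
      split_ifs with hle
      · rcases hle.lt_or_eq with hlt | rfl
        · rw [List.getElem?_append_left hlt] at hD ⊢
          exact hD
        · simpa using hD
      · obtain ⟨j, rfl⟩ : ∃ j, i = Δ₁.length + (j + 1) := ⟨i - Δ₁.length - 1, by omega⟩
        rw [List.getElem?_append_right (by omega), Nat.add_sub_cancel_left,
          List.getElem?_cons_succ] at hD
        rw [List.getElem?_append_right (by omega), ← hD]
        congr 1
        omega

theorem Typed.kappa {Γ : Ctx} {t u : Term} {A : Ty} (ht : Typed Γ t A) (h : Kappa t u) :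
    Typed Γ u A := by
  obtain ⟨M, N, hs, rfl, rfl⟩ := h
  exact typed_mk.2 ((kappaStep_iff.1 hs).hasType (fun h hM => h.hasType hM) (typed_mk.1 ht))

theorem Typed.kappa_star {Γ : Ctx} {t u : Term} {A : Ty} (ht : Typed Γ t A)
    (h : ReflTransGen Kappa t u) : Typed Γ u A := by
  induction h with
  | refl => exact ht
  | tail _ hs ih => exact ih.kappa hs

/-! ### An invariant of `κ` -/

/-- Terms with boxes in which an argument of an explicit substitution is not bound to a variable,
but written, below `unbox`, wherever this variable occurs in the body.  Bound variables of
abstractions are de Bruijn levels, counted from the enclosing `box`. -/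
inductive Unshared : Type
  | lvl (d : ℕ) : Unshared
  | lam (A : Ty) (X : Unshared) : Unshared
  | app (X Y : Unshared) : Unshared
  | box (X : Unshared) : Unshared
  | unbox (X : Unshared) : Unshared

/-- Extension of an environment by a value for the variable of index `0`. -/
def extend (X : Unshared) (ρ : ℕ → Unshared) : ℕ → Unshared
  | 0 => X
  | i + 1 => ρ i

mutual
/-- The unshared form of a term, under `d` abstractions, for the values `ρ` of its variables. -/
def Tm.unshare : Tm → ℕ → (ℕ → Unshared) → Unshared
  | .var i, _, ρ => ρ i
  | .lam A M, d, ρ => .lam A (Tm.unshare M (d + 1) (extend (.lvl d) ρ))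
  | .app M N, d, ρ => .app (Tm.unshare M d ρ) (Tm.unshare N d ρ)
  | .sub M Ns, d, ρ =>
    .box (Tm.unshare M 0 fun i => .unbox ((Tm.unshareList Ns d ρ).getD i (.lvl 0)))
/-- The unshared forms of a list of terms. -/
def Tm.unshareList : List Tm → ℕ → (ℕ → Unshared) → List Unshared
  | [], _, _ => []
  | N :: Ns, d, ρ => Tm.unshare N d ρ :: Tm.unshareList Ns d ρ
end

/-- The environment of the body of an explicit substitution with the arguments `Ns`. -/
def argEnv (Ns : List Tm) (d : ℕ) (ρ : ℕ → Unshared) (i : ℕ) : Unshared :=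
  .unbox (if i < Ns.length then (nth Ns i).unshare d ρ else .lvl 0)

@[simp] theorem Tm.unshare_sub (M : Tm) (Ns : List Tm) (d : ℕ) (ρ : ℕ → Unshared) :
    (Tm.sub M Ns).unshare d ρ = .box (M.unshare 0 (argEnv Ns d ρ)) := by
  have : ∀ (Ns : List Tm) (i : ℕ), (Tm.unshareList Ns d ρ).getD i (.lvl 0) =
      if i < Ns.length then (nth Ns i).unshare d ρ else .lvl 0 := by
    intro Ns
    induction Ns with
    | nil => intro i; rfl
    | cons N Ns ih =>
      intro i
      cases i with
      | zero => rfl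
      | succ i => simpa [Tm.unshareList] using ih i
  rw [Tm.unshare]
  congr 2
  funext i
  rw [this]; rfl

theorem argEnv_of_lt {Ns : List Tm} {i : ℕ} (h : i < Ns.length) (d : ℕ) (ρ : ℕ → Unshared) :
    argEnv Ns d ρ i = .unbox ((nth Ns i).unshare d ρ) := by simp [argEnv, h]

theorem argEnv_of_le {Ns : List Tm} {i : ℕ} (h : Ns.length ≤ i) (d : ℕ) (ρ : ℕ → Unshared) :
    argEnv Ns d ρ i = .unbox (.lvl 0) := by simp [argEnv, h.not_gt]

theorem Tm.unshare_rename (M : Tm) (f : ℕ → ℕ) (d : ℕ) (ρ : ℕ → Unshared) :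
    (M.rename f).unshare d ρ = M.unshare d (ρ ∘ f) := by
  induction M generalizing f d ρ with
  | var i => rfl
  | lam A M ih =>
    simp only [Tm.rename_lam, Tm.unshare, ih]
    congr 2
    funext i; cases i <;> rfl
  | app M N ihM ihN => simp [Tm.unshare, ihM, ihN]
  | sub M Ns _ ih =>
    simp only [Tm.rename_sub, Tm.unshare_sub]
    congr 2
    funext i
    rcases lt_or_ge i Ns.length with hi | hi
    · rw [argEnv_of_lt (by simpa using hi), argEnv_of_lt hi, nth_map _ hi, ih _ (nth_mem hi)]
    · rw [argEnv_of_le (by simpa using hi), argEnv_of_le hi]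

theorem Tm.unshare_congr (M : Tm) (d : ℕ) {ρ ρ' : ℕ → Unshared}
    (h : ∀ i, M.Free i → ρ i = ρ' i) : M.unshare d ρ = M.unshare d ρ' := by
  induction M generalizing d ρ ρ' with
  | var i => exact h i (by simp)
  | lam A M ih =>
    simp only [Tm.unshare]
    congr 1
    refine ih _ fun i hi => ?_
    cases i with
    | zero => rfl
    | succ i => exact h i hi
  | app M N ihM ihN =>
    simp only [Tm.unshare]
    rw [ihM d fun i hi => h i (by simp [hi]), ihN d fun i hi => h i (by simp [hi])]
  | sub M Ns _ ih =>
    simp only [Tm.unshare_sub]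
    congr 2
    funext i
    rcases lt_or_ge i Ns.length with hi | hi
    · rw [argEnv_of_lt hi, argEnv_of_lt hi,
        ih _ (nth_mem hi) d fun j hj => h j (Tm.free_sub.2 ⟨_, nth_mem hi, hj⟩)]
    · rw [argEnv_of_le hi, argEnv_of_le hi]

theorem PE.unshare_eq {M M' : Tm} (h : PE M M') (d : ℕ) (ρ : ℕ → Unshared) :
    M.unshare d ρ = M'.unshare d ρ := by
  induction h generalizing d ρ with
  | var i => rfl
  | lam _ ih => simp [Tm.unshare, ih]
  | app _ _ ih1 ih2 => simp [Tm.unshare, ih1, ih2]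
  | @sub M M' Ns Ns' σ hl hσ _ _ ihM ih =>
    have : argEnv Ns d ρ = argEnv Ns' d ρ ∘ σ := by
      funext i
      have hi' := perm_lt_iff hσ i
      simp only [Function.comp]
      rcases lt_or_ge i Ns.length with hi | hi
      · rw [argEnv_of_lt hi, argEnv_of_lt (hl ▸ hi'.2 hi), ih]
      · rw [argEnv_of_le hi, argEnv_of_le (by omega)]
    rw [Tm.unshare_sub, Tm.unshare_sub, this, ← Tm.unshare_rename, ihM]

theorem argEnv_append_left {Ps Qs : List Tm} {i : ℕ} (h : i < Ps.length) (d : ℕ)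
    (ρ : ℕ → Unshared) : argEnv (Ps ++ Qs) d ρ i = argEnv Ps d ρ i := by
  rw [argEnv_of_lt (by simp; omega), argEnv_of_lt h, nth_append_left h]

theorem argEnv_append_right (Ps Qs : List Tm) (i : ℕ) (d : ℕ) (ρ : ℕ → Unshared) :
    argEnv (Ps ++ Qs) d ρ (Ps.length + i) = argEnv Qs d ρ i := by
  simp [argEnv, nth_append_right]

theorem argEnv_cons (N : Tm) (Ns : List Tm) (i : ℕ) (d : ℕ) (ρ : ℕ → Unshared) :
    argEnv (N :: Ns) d ρ (i + 1) = argEnv Ns d ρ i := by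
  simp [argEnv]

theorem KappaGround.unshare_eq {M N : Tm} (h : KappaGround M N) (d : ℕ) (ρ : ℕ → Unshared) :
    M.unshare d ρ = N.unshare d ρ := by
  cases h with
  | kappa1 M N Ps Qs hc =>
    rw [Tm.unshare_sub, Tm.unshare_sub, Tm.unshare_rename]
    congr 1
    refine Tm.unshare_congr _ _ fun i hi => ?_
    have hne : i ≠ Ps.length := fun h => hi (h ▸ hc)
    simp only [Function.comp, lower]
    split_ifs with hle
    · rw [argEnv_append_left (by omega), argEnv_append_left (by omega)]
    · obtain ⟨j, rfl⟩ : ∃ j, i = Ps.length + (j + 1) := ⟨i - Ps.length - 1, by omega⟩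
      rw [argEnv_append_right, argEnv_cons, ← add_assoc, Nat.add_sub_cancel, argEnv_append_right]
  | kappa2 M N Ps Qs =>
    rw [Tm.unshare_sub, Tm.unshare_sub, Tm.unshare_rename]
    congr 2
    funext i
    simp only [Function.comp, lower]
    split_ifs with hle
    · rcases hle.lt_or_eq with hlt | rfl
      · rw [argEnv_append_left hlt, argEnv_append_left hlt]
      · rw [argEnv_of_lt (by simp), argEnv_of_lt (by simp), nth_middle, nth_middle]
    · obtain ⟨j, rfl⟩ : ∃ j, i = Ps.length + (j + 1) := ⟨i - Ps.length - 1, by omega⟩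
      rw [argEnv_append_right, argEnv_cons, ← add_assoc, Nat.add_sub_cancel, argEnv_append_right]

theorem kappa_unshare_eq {M N : Tm} (h : Cl KappaGround M N) (d : ℕ) (ρ : ℕ → Unshared) :
    M.unshare d ρ = N.unshare d ρ := by
  induction h generalizing d ρ with
  | ground h => exact h.unshare_eq d ρ
  | lam _ ih => simp [Tm.unshare, ih]
  | appL _ ih => simp [Tm.unshare, ih]
  | appR _ ih => simp [Tm.unshare, ih]
  | body _ ih => simp [ih]
  | @arg P M N Ps Qs _ ih =>
    rw [Tm.unshare_sub, Tm.unshare_sub]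
    congr 2
    funext i
    by_cases hi : i = Ps.length
    · rw [hi, argEnv_of_lt (by simp), argEnv_of_lt (by simp), nth_middle, nth_middle, ih]
    · simp only [argEnv, nth_middle_ne M N hi, List.length_append, List.length_cons]

/-- The values of the free variables of a term.  They are marked by `unbox` to be different from the
levels of abstractions. -/
def freeEnv (i : ℕ) : Unshared := .unbox (.lvl i)

/-- The unshared form of a term modulo permutations. -/
def Term.unshare : Term → Unshared :=
  Quotient.lift (fun M => M.unshare 0 freeEnv) fun _ _ h => (pe_of_permEq h).unshare_eq _ _

theorem Kappa.unshare_eq {t u : Term} (h : Kappa t u) : t.unshare = u.unshare := by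
  obtain ⟨M, N, hs, rfl, rfl⟩ := h
  exact kappa_unshare_eq (kappaStep_iff.1 hs) _ _

theorem kappa_star_unshare_eq {t u : Term} (h : ReflTransGen Kappa t u) :
    t.unshare = u.unshare := by
  induction h with
  | refl => rfl
  | tail _ hs ih => exact ih.trans hs.unshare_eq

/-! ### Normal forms of `κ` -/

/-- The terms in which the variables bound by an explicit substitution all occur, no other variable
occurs in its body, and its arguments are pairwise different. -/
inductive KappaNF : Tm → Prop
  | var (i : ℕ) : KappaNF (.var i)
  | lam {A : Ty} {M : Tm} : KappaNF M → KappaNF (.lam A M)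
  | app {M N : Tm} : KappaNF M → KappaNF N → KappaNF (.app M N)
  | sub {M : Tm} {Ns : List Tm} : KappaNF M → (∀ N ∈ Ns, KappaNF N) →
      (∀ i, M.Free i ↔ i < Ns.length) →
      (∀ i j, i < j → j < Ns.length → ¬ PE (nth Ns i) (nth Ns j)) → KappaNF (.sub M Ns)

/-- The condition on an environment under `d` abstractions: no value is the level of an abstraction
yet to come, or can be confused with the unshared form of a compound term. -/
def EnvOK (d : ℕ) (ρ : ℕ → Unshared) : Prop :=
  ∀ i, (∃ e < d, ρ i = .lvl e) ∨ ∃ X, ρ i = .unbox X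

theorem EnvOK.extend {d : ℕ} {ρ : ℕ → Unshared} (h : EnvOK d ρ) :
    EnvOK (d + 1) (extend (.lvl d) ρ) := by
  intro i
  cases i with
  | zero => exact .inl ⟨d, by omega, rfl⟩
  | succ i =>
    rcases h i with ⟨e, he, hi⟩ | ⟨X, hi⟩
    · exact .inl ⟨e, by omega, hi⟩
    · exact .inr ⟨X, hi⟩

theorem EnvOK.ne_lvl {d : ℕ} {ρ : ℕ → Unshared} (h : EnvOK d ρ) (i : ℕ) : ρ i ≠ .lvl d := by
  intro hd
  rcases h i with ⟨e, he, hi⟩ | ⟨X, hi⟩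
  · rw [hi] at hd; cases hd; omega
  · rw [hi] at hd; cases hd

theorem envOK_argEnv (Ns : List Tm) (d : ℕ) (ρ : ℕ → Unshared) : EnvOK 0 (argEnv Ns d ρ) :=
  fun _ => .inr ⟨_, rfl⟩

/-- The unshared form of a term shows the values of its free variables: since every variable bound
by an explicit substitution occurs, no argument is lost. -/
theorem KappaNF.exists_free {M M' : Tm} (h : KappaNF M) (h' : KappaNF M') {d : ℕ}
    {ρ ρ' : ℕ → Unshared} (hρ : EnvOK d ρ) (hρ' : EnvOK d ρ')
    (heq : M.unshare d ρ = M'.unshare d ρ') {i : ℕ} (hi : M.Free i) :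
    ∃ j, M'.Free j ∧ ρ i = ρ' j := by
  induction M generalizing M' d ρ ρ' i with
  | var k =>
    obtain rfl : k = i := by simpa using hi
    simp only [Tm.unshare] at heq
    cases h' with
    | var j => exact ⟨j, by simp, heq⟩
    | lam _ => rcases hρ k with ⟨e, _, hk⟩ | ⟨X, hk⟩ <;> rw [hk] at heq <;> cases heq
    | app _ _ => rcases hρ k with ⟨e, _, hk⟩ | ⟨X, hk⟩ <;> rw [hk] at heq <;> cases heq
    | sub _ _ _ _ =>
      rw [Tm.unshare_sub] at heq
      rcases hρ k with ⟨e, _, hk⟩ | ⟨X, hk⟩ <;> rw [hk] at heq <;> cases heq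
  | lam A M ih =>
    cases h with
    | lam h =>
      cases h' with
      | var j =>
        simp only [Tm.unshare] at heq
        rcases hρ' j with ⟨e, _, hk⟩ | ⟨X, hk⟩ <;> rw [hk] at heq <;> cases heq
      | lam h' =>
        simp only [Tm.unshare, Unshared.lam.injEq] at heq
        obtain ⟨j, hj, hij⟩ := ih h h' hρ.extend hρ'.extend heq.2 (i := i + 1) (by simpa using hi)
        cases j with
        | zero => exact (hρ.ne_lvl i hij).elim
        | succ j => exact ⟨j, hj, hij⟩
      | app _ _ => simp [Tm.unshare] at heq
      | sub _ _ _ _ => simp [Tm.unshare] at heq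
  | app M N ihM ihN =>
    cases h with
    | app hM hN =>
      cases h' with
      | var j =>
        simp only [Tm.unshare] at heq
        rcases hρ' j with ⟨e, _, hk⟩ | ⟨X, hk⟩ <;> rw [hk] at heq <;> cases heq
      | lam _ => simp [Tm.unshare] at heq
      | app hM' hN' =>
        simp only [Tm.unshare, Unshared.app.injEq] at heq
        rcases Tm.free_app.1 hi with hi | hi
        · obtain ⟨j, hj, hij⟩ := ihM hM hM' hρ hρ' heq.1 hi
          exact ⟨j, by simp [hj], hij⟩
        · obtain ⟨j, hj, hij⟩ := ihN hN hN' hρ hρ' heq.2 hi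
          exact ⟨j, by simp [hj], hij⟩
      | sub _ _ _ _ => simp [Tm.unshare] at heq
  | sub M Ns ihM ih =>
    cases h with
    | sub hM hN hfree _ =>
      cases h' with
      | var j =>
        simp only [Tm.unshare] at heq
        rcases hρ' j with ⟨e, _, hk⟩ | ⟨X, hk⟩ <;> rw [hk] at heq <;> cases heq
      | lam _ => simp [Tm.unshare] at heq
      | app _ _ => simp [Tm.unshare] at heq
      | sub hM' hN' hfree' _ =>
        simp only [Tm.unshare_sub, Unshared.box.injEq] at heq
        obtain ⟨N, hmem, hi⟩ := Tm.free_sub.1 hi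
        obtain ⟨a, ha, rfl⟩ := exists_nth_of_mem hmem
        obtain ⟨b, hb, hab⟩ := ihM hM hM' (envOK_argEnv _ _ _) (envOK_argEnv _ _ _) heq
          ((hfree a).2 ha)
        have hb := (hfree' b).1 hb
        rw [argEnv_of_lt ha, argEnv_of_lt hb] at hab
        obtain ⟨j, hj, hij⟩ := ih _ hmem (hN _ hmem) (hN' _ (nth_mem hb)) hρ hρ'
          (Unshared.unbox.inj hab) hi
        exact ⟨j, Tm.free_sub.2 ⟨_, nth_mem hb, hj⟩, hij⟩

theorem Tm.exists_free_of_rename {M : Tm} {f : ℕ → ℕ} {i : ℕ} (h : (M.rename f).Free i) :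
    ∃ j, M.Free j ∧ f j = i := by
  induction M generalizing f i with
  | var j => exact ⟨j, by simp, by simpa using h⟩
  | lam A M ih =>
    obtain ⟨j, hj, hji⟩ := ih (Tm.free_lam.1 h)
    cases j with
    | zero => simp [upRen] at hji
    | succ j => exact ⟨j, hj, by simpa [upRen] using hji⟩
  | app M N ihM ihN =>
    rcases Tm.free_app.1 h with h | h
    · obtain ⟨j, hj, hji⟩ := ihM h
      exact ⟨j, by simp [hj], hji⟩
    · obtain ⟨j, hj, hji⟩ := ihN h
      exact ⟨j, by simp [hj], hji⟩
  | sub M Ns _ ih =>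
    rw [Tm.rename_sub] at h
    obtain ⟨N', hN', h⟩ := Tm.free_sub.1 h
    obtain ⟨N, hN, rfl⟩ := List.mem_map.1 hN'
    obtain ⟨j, hj, hji⟩ := ih N hN h
    exact ⟨j, Tm.free_sub.2 ⟨N, hN, hj⟩, hji⟩

theorem KappaNF.rename {M : Tm} (h : KappaNF M) {f g : ℕ → ℕ} (hgf : g ∘ f = id) :
    KappaNF (M.rename f) := by
  induction M generalizing f g with
  | var i => exact .var _
  | lam A M ih =>
    cases h with
    | lam h => exact .lam (ih h (g := upRen g) (by rw [upRen_comp, hgf, upRen_id]))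
  | app M N ihM ihN =>
    cases h with
    | app hM hN => exact .app (ihM hM hgf) (ihN hN hgf)
  | sub M Ns _ ih =>
    cases h with
    | sub hM hN hfree hne =>
      rw [Tm.rename_sub]
      refine .sub hM (fun N hmem => ?_) (by simpa using hfree) fun i j hij hj hpe => ?_
      · obtain ⟨N, hmem', rfl⟩ := List.mem_map.1 hmem
        exact ih N hmem' (hN N hmem') hgf
      · have hj' : j < Ns.length := by simpa using hj
        refine hne i j hij hj' ?_
        rw [nth_map _ (by omega), nth_map _ hj'] at hpe
        have := hpe.rename g
        simpa only [Tm.rename_rename, hgf, Tm.rename_id] using this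

/-- The arguments of two explicit substitutions correspond to each other if the unshared forms of
the substitutions agree. -/
theorem exists_arg_match {M M' : Tm} {Ns Ns' : List Tm} {d : ℕ} {ρ ρ' : ℕ → Unshared}
    (hM : KappaNF M) (hM' : KappaNF M') (hfree : ∀ i, M.Free i ↔ i < Ns.length)
    (hfree' : ∀ i, M'.Free i ↔ i < Ns'.length)
    (heq : M.unshare 0 (argEnv Ns d ρ) = M'.unshare 0 (argEnv Ns' d ρ')) :
    ∃ g : ℕ → ℕ, ∀ i < Ns.length, g i < Ns'.length ∧
      (nth Ns i).unshare d ρ = (nth Ns' (g i)).unshare d ρ' := by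
  have : ∀ i, ∃ j, i < Ns.length → j < Ns'.length ∧
      (nth Ns i).unshare d ρ = (nth Ns' j).unshare d ρ' := by
    intro i
    by_cases hi : i < Ns.length
    · obtain ⟨j, hj, hij⟩ := hM.exists_free hM' (envOK_argEnv _ _ _) (envOK_argEnv _ _ _) heq
        ((hfree i).2 hi)
      have hj := (hfree' j).1 hj
      rw [argEnv_of_lt hi, argEnv_of_lt hj] at hij
      exact ⟨j, fun _ => ⟨hj, Unshared.unbox.inj hij⟩⟩
    · exact ⟨0, fun h => (hi h).elim⟩
  choose g hg using this
  exact ⟨g, hg⟩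

/-- A term in normal form is determined, up to permutations, by its unshared form, provided that
different free variables have different values.  The hypothesis passes to the bodies of explicit
substitutions since, by induction, different arguments of a normal form have different unshared
forms.  The induction is on the total size `n` because pairs of arguments on the same side are
compared too. -/
theorem KappaNF.pe_of_unshare_eq (n : ℕ) {M M' : Tm} (hn : M.size + M'.size ≤ n)
    (h : KappaNF M) (h' : KappaNF M') {d : ℕ} {ρ : ℕ → Unshared} (hρ : EnvOK d ρ)
    (hinj : ∀ i j, M.Free i ∨ M'.Free i → M.Free j ∨ M'.Free j → ρ i = ρ j → i = j)
    (heq : M.unshare d ρ = M'.unshare d ρ) : PE M M' := by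
  induction n generalizing M M' d ρ with
  | zero => have := M.size_pos; omega
  | succ n ih =>
    cases h with
    | var i =>
      simp only [Tm.unshare] at heq
      cases h' with
      | var j =>
        obtain rfl := hinj i j (by simp) (by simp) heq
        exact .refl _
      | lam _ => rcases hρ i with ⟨e, _, hk⟩ | ⟨X, hk⟩ <;> rw [hk] at heq <;> cases heq
      | app _ _ => rcases hρ i with ⟨e, _, hk⟩ | ⟨X, hk⟩ <;> rw [hk] at heq <;> cases heq
      | sub _ _ _ _ =>
        rw [Tm.unshare_sub] at heq
        rcases hρ i with ⟨e, _, hk⟩ | ⟨X, hk⟩ <;> rw [hk] at heq <;> cases heq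
    | @lam A M h =>
      cases h' with
      | var j =>
        simp only [Tm.unshare] at heq
        rcases hρ j with ⟨e, _, hk⟩ | ⟨X, hk⟩ <;> rw [hk] at heq <;> cases heq
      | @lam A' M' h' =>
        simp only [Tm.unshare, Unshared.lam.injEq] at heq
        obtain ⟨rfl, heq⟩ := heq
        simp only [Tm.size] at hn
        refine .lam (ih (by omega) h h' hρ.extend (fun i j hi hj hij => ?_) heq)
        cases i with
        | zero =>
          cases j with
          | zero => rfl
          | succ j => exact (hρ.ne_lvl j hij.symm).elim
        | succ i =>
          cases j with
          | zero => exact (hρ.ne_lvl i hij).elim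
          | succ j => rw [hinj i j (by simpa using hi) (by simpa using hj) hij]
      | app _ _ => simp [Tm.unshare] at heq
      | sub _ _ _ _ => simp [Tm.unshare] at heq
    | @app M N hM hN =>
      cases h' with
      | var j =>
        simp only [Tm.unshare] at heq
        rcases hρ j with ⟨e, _, hk⟩ | ⟨X, hk⟩ <;> rw [hk] at heq <;> cases heq
      | lam _ => simp [Tm.unshare] at heq
      | @app M' N' hM' hN' =>
        simp only [Tm.unshare, Unshared.app.injEq] at heq
        simp only [Tm.size] at hn
        simp only [Tm.free_app] at hinj
        exact .app (ih (by omega) hM hM' hρ (fun i j hi hj => hinj i j (by tauto) (by tauto)) heq.1)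
          (ih (by omega) hN hN' hρ (fun i j hi hj => hinj i j (by tauto) (by tauto)) heq.2)
      | sub _ _ _ _ => simp [Tm.unshare] at heq
    | @sub M Ns hM hN hfree hne =>
      cases h' with
      | var j =>
        simp only [Tm.unshare] at heq
        rcases hρ j with ⟨e, _, hk⟩ | ⟨X, hk⟩ <;> rw [hk] at heq <;> cases heq
      | lam _ => simp [Tm.unshare] at heq
      | app _ _ => simp [Tm.unshare] at heq
      | @sub M' Ns' hM' hN' hfree' hne' =>
        simp only [Tm.unshare_sub, Unshared.box.injEq] at heq
        simp only [Tm.size_sub] at hn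
        have hmem_le : ∀ (Ls : List Tm), ∀ L ∈ Ls, L.size ≤ (Ls.map Tm.size).sum :=
          fun Ls L hL => List.le_sum_of_mem (List.mem_map_of_mem hL)
        have hMpos := M.size_pos
        have hMpos' := M'.size_pos
        -- Arguments of one of the two substitutions that have the same value are in the same place.
        have key : ∀ Ls : List Tm, (∀ L ∈ Ls, KappaNF L) →
            (∀ i j, i < j → j < Ls.length → ¬ PE (nth Ls i) (nth Ls j)) →
            (Ls.map Tm.size).sum ≤ n →
            (∀ L ∈ Ls, ∀ a, L.Free a → (Tm.sub M Ns).Free a ∨ (Tm.sub M' Ns').Free a) →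
            ∀ i < Ls.length, ∀ j < Ls.length,
              (nth Ls i).unshare d ρ = (nth Ls j).unshare d ρ → i = j := by
          intro Ls hL hneL hLn hLfree
          have hlt : ∀ i j, i < j → j < Ls.length →
              (nth Ls i).unshare d ρ ≠ (nth Ls j).unshare d ρ := by
            intro i j hij hj he
            have hi : i < Ls.length := by omega
            have hsum : (nth Ls i).size + (nth Ls j).size ≤ (Ls.map Tm.size).sum := by
              rw [sum_map_eq_sum_range, ← Finset.sum_pair (f := fun i => (nth Ls i).size) hij.ne]
              exact Finset.sum_le_sum_of_subset fun k hk => by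
                simp only [Finset.mem_insert, Finset.mem_singleton] at hk
                rcases hk with rfl | rfl <;> simpa
            have hor : ∀ a, (nth Ls i).Free a ∨ (nth Ls j).Free a →
                (Tm.sub M Ns).Free a ∨ (Tm.sub M' Ns').Free a := fun a ha =>
              ha.elim (hLfree _ (nth_mem hi) a) (hLfree _ (nth_mem hj) a)
            exact hneL i j hij hj (ih (by omega) (hL _ (nth_mem hi)) (hL _ (nth_mem hj)) hρ
              (fun a b ha hb => hinj a b (hor a ha) (hor b hb)) he)
          intro i hi j hj he
          rcases lt_trichotomy i j with h | h | h
          · exact (hlt i j h hj he).elim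
          · exact h
          · exact (hlt j i h hi he.symm).elim
        have hinjN := key Ns hN hne (by omega) fun L hL a ha => .inl (Tm.free_sub.2 ⟨L, hL, ha⟩)
        have hinjN' := key Ns' hN' hne' (by omega) fun L hL a ha =>
          .inr (Tm.free_sub.2 ⟨L, hL, ha⟩)
        obtain ⟨g, hg⟩ := exists_arg_match hM hM' hfree hfree' heq
        obtain ⟨g', hg'⟩ := exists_arg_match hM' hM hfree' hfree heq.symm
        have hginj : ∀ i < Ns.length, ∀ j < Ns.length, g i = g j → i = j := fun i hi j hj hij =>
          hinjN i hi j hj ((hg i hi).2.trans (hij ▸ (hg j hj).2.symm))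
        have hginj' : ∀ i < Ns'.length, ∀ j < Ns'.length, g' i = g' j → i = j :=
          fun i hi j hj hij =>
            hinjN' i hi j hj ((hg' i hi).2.trans (hij ▸ (hg' j hj).2.symm))
        have hl : Ns.length = Ns'.length := by
          apply le_antisymm
          · simpa using Finset.card_le_card_of_injOn (s := Finset.range Ns.length)
              (t := Finset.range Ns'.length) g
              (fun i hi => by simpa using (hg i (by simpa using hi)).1)
              fun i hi j hj => hginj i (by simpa using hi) j (by simpa using hj)
          · simpa using Finset.card_le_card_of_injOn (s := Finset.range Ns'.length)
              (t := Finset.range Ns.length) g'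
              (fun i hi => by simpa using (hg' i (by simpa using hi)).1)
              fun i hi j hj => hginj' i (by simpa using hi) j (by simpa using hj)
        obtain ⟨σ, hσ⟩ := exists_perm_of_injective (n := Ns.length)
          (f := fun i => if i < Ns.length then g i else i) (fun i j hij => by
            simp only at hij
            split_ifs at hij with hi hj hj
            · exact hginj i hi j hj hij
            · have := (hg i hi).1; omega
            · have := (hg j hj).1; omega
            · exact hij) (fun i hi => if_neg (by omega))
        have hfix : ∀ i, Ns.length ≤ i → σ i = i := fun i hi => by rw [hσ, if_neg (by omega)]
        have henv : argEnv Ns d ρ = argEnv Ns' d ρ ∘ σ := by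
          funext i
          simp only [Function.comp]
          rcases lt_or_ge i Ns.length with hi | hi
          · rw [hσ, if_pos hi, argEnv_of_lt hi, argEnv_of_lt (hg i hi).1, (hg i hi).2]
          · rw [hfix i hi, argEnv_of_le hi, argEnv_of_le (hl ▸ hi)]
        have hfreeσ : ∀ i, (M.rename σ).Free i → i < Ns'.length := fun i hi => by
          obtain ⟨j, hj, rfl⟩ := Tm.exists_free_of_rename hi
          exact hl ▸ (perm_lt_iff hfix j).2 ((hfree j).1 hj)
        refine .sub σ hl hfix ?_ fun i => ?_
        · rw [henv, ← Tm.unshare_rename] at heq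
          refine ih (by rw [Tm.size_rename]; omega) (hM.rename (Equiv.symm_comp_self σ)) hM'
            (envOK_argEnv _ _ _) (fun i j hi hj hij => ?_) heq
          have hi : i < Ns'.length := hi.elim (hfreeσ i) (hfree' i).1
          have hj : j < Ns'.length := hj.elim (hfreeσ j) (hfree' j).1
          rw [argEnv_of_lt hi, argEnv_of_lt hj] at hij
          exact hinjN' i hi j hj (Unshared.unbox.inj hij)
        · rcases lt_or_ge i Ns.length with hi | hi
          · have h1 := (hg i hi).1
            have h2 := hmem_le Ns _ (nth_mem hi)
            have h3 := hmem_le Ns' _ (nth_mem h1)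
            rw [hσ, if_pos hi]
            refine ih (by omega) (hN _ (nth_mem hi)) (hN' _ (nth_mem h1)) hρ
              (fun a b ha hb => hinj a b ?_ ?_) (hg i hi).2
            · exact ha.imp (fun h => Tm.free_sub.2 ⟨_, nth_mem hi, h⟩)
                fun h => Tm.free_sub.2 ⟨_, nth_mem h1, h⟩
            · exact hb.imp (fun h => Tm.free_sub.2 ⟨_, nth_mem hi, h⟩)
                fun h => Tm.free_sub.2 ⟨_, nth_mem h1, h⟩
          · rw [hfix i hi, nth_of_le hi, nth_of_le (hl ▸ hi)]
            exact .var 0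

theorem PE.body {M M' : Tm} (h : PE M M') (Ns : List Tm) : PE (.sub M Ns) (.sub M' Ns) :=
  .sub 1 rfl (fun _ _ => rfl) ((Tm.rename_id _).symm ▸ h) fun _ => .refl _

theorem PE.arg {N N' : Tm} (h : PE N N') (M : Tm) (Ps Qs : List Tm) :
    PE (.sub M (Ps ++ N :: Qs)) (.sub M (Ps ++ N' :: Qs)) :=
  pe_of_permEq (.arg (permEq_of_pe h))

theorem pe_swap (M N N' : Tm) (Ps Qs : List Tm) :
    PE (.sub M (Ps ++ N :: N' :: Qs))
      (.sub (M.rename (Equiv.swap Ps.length (Ps.length + 1))) (Ps ++ N' :: N :: Qs)) := by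
  refine .sub (Equiv.swap Ps.length (Ps.length + 1)) (by simp) (fun i hi => ?_) (.refl _)
    fun i => ?_
  · simp only [List.length_append, List.length_cons] at hi
    exact Equiv.swap_apply_of_ne_of_ne (by omega) (by omega)
  · by_cases h1 : i = Ps.length
    · subst h1
      rw [Equiv.swap_apply_left, nth_middle, nth_append_right (by omega), Nat.add_sub_cancel_left]
      exact .refl N
    by_cases h2 : i = Ps.length + 1
    · subst h2
      rw [Equiv.swap_apply_right, nth_middle, nth_append_right (by omega), Nat.add_sub_cancel_left]
      exact .refl N'
    rw [Equiv.swap_apply_of_ne_of_ne h1 h2]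
    rcases lt_or_gt_of_ne h1 with h | h
    · rw [nth_append_left h, nth_append_left h]
      exact .refl _
    · obtain ⟨j, rfl⟩ : ∃ j, i = Ps.length + (j + 2) := ⟨i - Ps.length - 2, by omega⟩
      rw [nth_append_right (by omega), nth_append_right (by omega), Nat.add_sub_cancel_left]
      exact .refl _

/-- An argument can be moved to the left across any number of other arguments. -/
theorem exists_pe_move (M N : Tm) (Ps L Qs : List Tm) :
    ∃ M', PE (.sub M (Ps ++ (L ++ N :: Qs))) (.sub M' (Ps ++ N :: (L ++ Qs))) := by
  induction L generalizing M Ps with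
  | nil => exact ⟨M, .refl _⟩
  | cons X L ih =>
    obtain ⟨M', h⟩ := ih M (Ps ++ [X])
    simp only [List.append_assoc, List.cons_append, List.nil_append] at h
    exact ⟨_, h.trans (pe_swap M' X N Ps (L ++ Qs))⟩

/-- Two arguments that are equal up to permutations can be made equal and adjacent. -/
theorem exists_pe_adjacent {M : Tm} {Ns : List Tm} {i j : ℕ} (hij : i < j) (hj : j < Ns.length)
    (h : PE (nth Ns i) (nth Ns j)) :
    ∃ M' N Ps Qs, PE (.sub M Ns) (.sub M' (Ps ++ N :: N :: Qs)) := by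
  have hsplit : ∃ Ps N L N' Qs, Ns = Ps ++ N :: (L ++ N' :: Qs) ∧ PE N N' := by
    obtain ⟨Ps', Qs, h1, h2⟩ := split_at hj
    have hi : i < Ps'.length := by omega
    obtain ⟨Ps, L, h3, h4⟩ := split_at hi
    refine ⟨Ps, nth Ns i, L, nth Ns j, Qs, ?_, h⟩
    have : nth Ns i = nth Ps' i := by rw [h1, nth_append_left hi]
    rw [this]
    conv_lhs => rw [h1, h3]
    simp
  obtain ⟨Ps, N, L, N', Qs, rfl, hNN⟩ := hsplit
  have h1 := hNN.symm.arg M (Ps ++ N :: L) Qs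
  obtain ⟨M', h2⟩ := exists_pe_move M N (Ps ++ [N]) L Qs
  refine ⟨M', N, Ps, L ++ Qs, ?_⟩
  simp only [List.append_assoc, List.cons_append, List.nil_append] at h1 h2
  exact h1.trans h2

/-- A typed term without `κ`-steps is in normal form. -/
theorem HasType.kappaNF {Γ : Ctx} {M : Tm} {A : Ty} (hM : HasType Γ M A)
    (hn : ∀ M' N, PE M M' → ¬ Cl KappaGround M' N) : KappaNF M := by
  induction M generalizing Γ A with
  | var i => exact .var i
  | lam B M ih =>
    obtain ⟨C, rfl, hM'⟩ := hM.lam_inv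
    exact .lam (ih hM' fun M' N h hs => hn _ _ (.lam h) (.lam hs))
  | app M N ihM ihN =>
    obtain ⟨B, h1, h2⟩ := hM.app_inv
    exact .app (ihM h1 fun M' _ h hs => hn _ _ (.app h (.refl N)) (.appL hs))
      (ihN h2 fun M' _ h hs => hn _ _ (.app (.refl M) h) (.appR hs))
  | sub M Ns ihM ih =>
    have hfree := hM.free_lt_length
    obtain ⟨Δ, C, rfl, hl, hN, hM⟩ := hM.sub_inv
    refine .sub (ihM hM fun M' _ h hs => hn _ _ (h.body Ns) (.body hs)) (fun N hmem => ?_)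
      (fun i => ⟨hfree i, fun hi => ?_⟩) fun i j hij hj hpe => ?_
    · obtain ⟨B, hB⟩ := HasType.sub_inv_arg hl hN hmem
      obtain ⟨Ps, Qs, rfl⟩ := List.append_of_mem hmem
      exact ih N hmem hB fun N' _ h hs => hn _ _ (h.arg M Ps Qs) (.arg hs)
    · intro hc
      obtain ⟨Ps, Qs, h1, h2⟩ := split_at hi
      rw [h1] at hn
      exact hn _ _ (.refl _) (.ground (.kappa1 M _ Ps Qs (h2 ▸ hc)))
    · obtain ⟨M', N, Ps, Qs, h⟩ := exists_pe_adjacent hij hj hpe (M := M)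
      exact hn _ _ h (.ground (.kappa2 _ _ _ _))

theorem exists_kappa_normal (t : Term) :
    ∃ u, ReflTransGen Kappa t u ∧ ∀ v, ¬ Kappa u v := by
  have h := kappa_stronglyNormalizing t
  induction h with
  | intro t _ ih =>
    by_cases ht : ∃ u, Kappa t u
    · obtain ⟨u, hu⟩ := ht
      obtain ⟨v, hv, hn⟩ := ih u hu
      exact ⟨v, .head hu hv, hn⟩
    · exact ⟨t, .refl, fun v hv => ht ⟨v, hv⟩⟩

theorem Typed.kappa_confluent {Γ : Ctx} {t : Term} {A : Ty} (ht : Typed Γ t A) :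
    Confluent Kappa t := by
  intro u v hu hv
  obtain ⟨u', hu', hun⟩ := exists_kappa_normal u
  obtain ⟨v', hv', hvn⟩ := exists_kappa_normal v
  have heq : u'.unshare = v'.unshare :=
    (kappa_star_unshare_eq (hu.trans hu')).symm.trans (kappa_star_unshare_eq (hv.trans hv'))
  obtain ⟨M, rfl, hM⟩ := ht.kappa_star (hu.trans hu')
  obtain ⟨M', rfl, hM'⟩ := ht.kappa_star (hv.trans hv')
  have hnf : ∀ {M : Tm}, HasType Γ M A → (∀ v, ¬ Kappa (cls M) v) → KappaNF M :=
    fun {M} hM hn => hM.kappaNF fun M' N h hs =>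
      hn (cls N) ⟨M', N, kappaStep_iff.2 hs, mk_eq_mk.2 h.symm, rfl⟩
  have hpe := KappaNF.pe_of_unshare_eq _ le_rfl (hnf hM hun) (hnf hM' hvn) (d := 0)
    (ρ := freeEnv) (fun i => .inr ⟨_, rfl⟩)
    (fun i j _ _ hij => Unshared.lvl.inj (Unshared.unbox.inj hij)) heq
  have hcls : cls M = cls M' := mk_eq_mk.2 hpe
  exact ⟨cls M, hu', hcls ▸ hv'⟩

/-! ### Restricted `η`-expansion, syntax-directed -/

theorem typedArgs_unique {Γ Δ Δ' : Ctx} {Ns : List Tm}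
    (h : List.Forall₂ (fun N B => HasType Γ N (.box B)) Ns Δ)
    (h' : List.Forall₂ (fun N B => HasType Γ N (.box B)) Ns Δ') : Δ = Δ' := by
  induction h generalizing Δ' with
  | nil => cases h'; rfl
  | cons h _ ih =>
    cases h' with
    | cons h1 h2 => rw [Ty.box.inj (h.unique h1), ih h2]

/-- The term is an introduction: an abstraction or an explicit substitution. -/
def Tm.isIntro : Tm → Bool
  | .lam _ _ => true
  | .sub _ _ => true
  | _ => false

@[simp] theorem isIntro_var (i : ℕ) : (Tm.var i).isIntro = false := rfl
@[simp] theorem isIntro_lam (A : Ty) (M : Tm) : (Tm.lam A M).isIntro = true := rfl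
@[simp] theorem isIntro_app (M N : Tm) : (Tm.app M N).isIntro = false := rfl
@[simp] theorem isIntro_sub (M : Tm) (Ns : List Tm) : (Tm.sub M Ns).isIntro = true := rfl

/-- One restricted `η`-expansion step on terms typed in `Γ`.  The flag tells whether the term itself
may be expanded: it may not if it is the function part of an application or an argument of an
explicit substitution. -/
inductive EtaRed : Ctx → Bool → Tm → Tm → Prop
  | expandArr {Γ : Ctx} {M : Tm} {A B : Ty} : HasType Γ M (.arr A B) → M.isIntro = false →
      EtaRed Γ true M (.lam A (.app (M.rename Nat.succ) (.var 0)))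
  | expandBox {Γ : Ctx} {M : Tm} {A : Ty} : HasType Γ M (.box A) → M.isIntro = false →
      EtaRed Γ true M (.sub (.var 0) [M])
  | lam {Γ : Ctx} {b : Bool} {A : Ty} {M N : Tm} : EtaRed (A :: Γ) true M N →
      EtaRed Γ b (.lam A M) (.lam A N)
  | appL {Γ : Ctx} {b : Bool} {M N P : Tm} : EtaRed Γ false M N →
      EtaRed Γ b (.app M P) (.app N P)
  | appR {Γ : Ctx} {b : Bool} {M N P : Tm} : EtaRed Γ true M N →
      EtaRed Γ b (.app P M) (.app P N)
  | body {Γ Δ : Ctx} {b : Bool} {M N : Tm} {Ps : List Tm} :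
      List.Forall₂ (fun P B => HasType Γ P (.box B)) Ps Δ → EtaRed Δ true M N →
      EtaRed Γ b (.sub M Ps) (.sub N Ps)
  | arg {Γ : Ctx} {b : Bool} {P M N : Tm} {Ps Qs : List Tm} : EtaRed Γ false M N →
      EtaRed Γ b (.sub P (Ps ++ M :: Qs)) (.sub P (Ps ++ N :: Qs))

theorem EtaRed.mono {Γ : Ctx} {M N : Tm} (h : EtaRed Γ false M N) : EtaRed Γ true M N := by
  cases h with
  | lam h => exact .lam h
  | appL h => exact .appL h
  | appR h => exact .appR h
  | body hP h => exact .body hP h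
  | arg h => exact .arg h

theorem Eta1Ground.etaRed {Γ : Ctx} {M N : Tm} (h : Eta1Ground Γ M N) :
    EtaRed Γ true M N ∧ ∃ A B, HasType Γ M (.arr A B) := by
  cases h with
  | @eta1 A B hM hne =>
    refine ⟨.expandArr hM ?_, A, B, hM⟩
    cases M with
    | lam A P => exact (hne A P rfl).elim
    | sub P Ns => cases hM
    | var i => rfl
    | app P Q => rfl

theorem Eta2Ground.etaRed {Γ : Ctx} {M N : Tm} (h : Eta2Ground Γ M N) :
    EtaRed Γ true M N ∧ ∃ A, HasType Γ M (.box A) := by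
  cases h with
  | @eta2 A hM hne =>
    refine ⟨.expandBox hM ?_, A, hM⟩
    cases M with
    | lam A P => cases hM
    | sub P Ns => exact (hne P Ns rfl).elim
    | var i => rfl
    | app P Q => rfl

/-- The type of the hole decides which of its restrictions matters: a function part has no box
type, and an argument of an explicit substitution no arrow type. -/
theorem etaRed_fill {Γ Δ : Ctx} {E : Hole} {M N : Tm} {T : Ty} (hE : HoleCtx Γ E Δ)
    (h : EtaRed Δ true M N)
    (hr : (E.IsEta1 ∧ ∃ A B, HasType Δ M (.arr A B)) ∨ (E.IsEta2 ∧ ∃ A, HasType Δ M (.box A)))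
    (hT : HasType Γ (E.fill M) T) {b : Bool} (hb : E = .hole → b = true) :
    EtaRed Γ b (E.fill M) (E.fill N) := by
  induction hE generalizing T b with
  | hole => rw [hb rfl]; exact h
  | lam _ ih =>
    obtain ⟨C, rfl, hT'⟩ := HasType.lam_inv hT
    exact .lam (ih h hr hT' fun _ => rfl)
  | appR _ ih =>
    obtain ⟨C, h1, h2⟩ := HasType.app_inv hT
    exact .appR (ih h hr h2 fun _ => rfl)
  | @appL _ _ _ C hC ih =>
    obtain ⟨B, h1, h2⟩ := HasType.app_inv hT
    refine .appL (ih h (hr.imp_left fun h => ⟨h.1.2, h.2⟩) h1 ?_)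
    rintro rfl
    cases hC
    rcases hr with ⟨h, _⟩ | ⟨_, A, hA⟩
    · exact (h.1 rfl).elim
    · cases h1.unique hA
  | @body Γ Δ Θ C Ms hl hN hC ih =>
    have hN' := typedArgs_iff.1 ⟨hl, nth_hasType hl hN⟩
    obtain ⟨Θ', D, rfl, h1, h2⟩ := HasType.sub_iff.1 hT
    obtain rfl := typedArgs_unique hN' h1
    exact .body hN' (ih h hr h2 fun _ => rfl)
  | @arg _ _ P Ps Qs C hC ih =>
    obtain ⟨Θ, D, rfl, h1, h2⟩ := HasType.sub_iff.1 hT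
    obtain ⟨_, B, _, rfl, _, h3, _⟩ := forall₂_append_cons_iff.1 h1
    refine .arg (ih h (hr.imp_right fun h => ⟨h.1.2, h.2⟩) h3 ?_)
    rintro rfl
    cases hC
    rcases hr with ⟨_, A, B, hA⟩ | ⟨h, _⟩
    · cases h3.unique hA
    · exact (h.1 rfl).elim

theorem EtaStep.etaRed {Γ : Ctx} {M N : Tm} {A : Ty} (h : EtaStep Γ M N) (hM : HasType Γ M A) :
    EtaRed Γ true M N := by
  cases h with
  | eta1 hE hC hG => exact etaRed_fill hC hG.etaRed.1 (.inl ⟨hE, hG.etaRed.2⟩) hM fun _ => rfl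
  | eta2 hE hC hG => exact etaRed_fill hC hG.etaRed.1 (.inr ⟨hE, hG.etaRed.2⟩) hM fun _ => rfl

theorem EtaRed.exists_hole {Γ : Ctx} {b : Bool} {M N : Tm} (h : EtaRed Γ b M N) :
    ∃ (E : Hole) (Δ : Ctx) (P Q : Tm), M = E.fill P ∧ N = E.fill Q ∧ HoleCtx Γ E Δ ∧
      ((E.IsEta1 ∧ Eta1Ground Δ P Q) ∨ (E.IsEta2 ∧ Eta2Ground Δ P Q)) ∧
      (b = false → E ≠ .hole) := by
  induction h with
  | @expandArr Γ M A B hM hi =>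
    exact ⟨.hole, Γ, _, _, rfl, rfl, .hole, .inl ⟨trivial, .eta1 hM fun A P h => by
      rw [h] at hi; cases hi⟩, fun h => by cases h⟩
  | @expandBox Γ M A hM hi =>
    exact ⟨.hole, Γ, _, _, rfl, rfl, .hole, .inr ⟨trivial, .eta2 hM fun A P h => by
      rw [h] at hi; cases hi⟩, fun h => by cases h⟩
  | @lam _ _ A _ _ _ ih =>
    obtain ⟨E, Δ, P, Q, rfl, rfl, hE, hr, _⟩ := ih
    exact ⟨.lam A E, Δ, P, Q, rfl, rfl, .lam hE, hr, fun _ h => by cases h⟩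
  | @appL _ _ _ _ R _ ih =>
    obtain ⟨E, Δ, P, Q, rfl, rfl, hE, hr, hb⟩ := ih
    exact ⟨.appL E R, Δ, P, Q, rfl, rfl, .appL hE, hr.imp_left fun h => ⟨⟨hb rfl, h.1⟩, h.2⟩,
      fun _ h => by cases h⟩
  | @appR _ _ _ _ R _ ih =>
    obtain ⟨E, Δ, P, Q, rfl, rfl, hE, hr, _⟩ := ih
    exact ⟨.appR R E, Δ, P, Q, rfl, rfl, .appR hE, hr, fun _ h => by cases h⟩
  | @body _ Θ _ _ _ Ps hPs _ ih =>
    obtain ⟨E, Δ, P, Q, rfl, rfl, hE, hr, _⟩ := ih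
    refine ⟨.body E Ps, Δ, P, Q, rfl, rfl, .body hPs.length_eq (fun p hp => ?_) hE, hr,
      fun _ h => by cases h⟩
    exact List.forall₂_zip hPs hp
  | @arg _ _ R _ _ Ps Qs _ ih =>
    obtain ⟨E, Δ, P, Q, rfl, rfl, hE, hr, hb⟩ := ih
    exact ⟨.arg R Ps E Qs, Δ, P, Q, rfl, rfl, .arg hE, hr.imp_right fun h => ⟨⟨hb rfl, h.1⟩, h.2⟩,
      fun _ h => by cases h⟩

theorem EtaRed.etaStep {Γ : Ctx} {M N : Tm} (h : EtaRed Γ true M N) : EtaStep Γ M N := by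
  obtain ⟨E, Δ, P, Q, rfl, rfl, hE, ⟨h1, h2⟩ | ⟨h1, h2⟩, _⟩ := h.exists_hole
  · exact .eta1 h1 hE h2
  · exact .eta2 h1 hE h2

theorem EtaRed.hasType {Γ : Ctx} {b : Bool} {M N : Tm} {T : Ty} (h : EtaRed Γ b M N)
    (hT : HasType Γ M T) : HasType Γ N T := by
  induction h generalizing T with
  | expandArr hM _ =>
    cases hM.unique hT
    exact .abs (.app (.id rfl) (hM.weaken _))
  | expandBox hM _ =>
    cases hM.unique hT
    exact HasType.sub_iff.2 ⟨[_], _, rfl, .cons hM .nil, .id rfl⟩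
  | lam _ ih =>
    obtain ⟨C, rfl, h⟩ := hT.lam_inv
    exact .abs (ih h)
  | appL _ ih =>
    obtain ⟨C, h1, h2⟩ := hT.app_inv
    exact .app h2 (ih h1)
  | appR _ ih =>
    obtain ⟨C, h1, h2⟩ := hT.app_inv
    exact .app (ih h2) h1
  | body hPs _ ih =>
    obtain ⟨Δ, C, rfl, h1, h2⟩ := HasType.sub_iff.1 hT
    obtain rfl := typedArgs_unique hPs h1
    exact HasType.sub_iff.2 ⟨_, C, rfl, h1, ih h2⟩
  | arg _ ih =>
    obtain ⟨Δ, C, rfl, hN, hM⟩ := HasType.sub_iff.1 hT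
    obtain ⟨Δ₁, B, Δ₂, rfl, h1, h2, h3⟩ := forall₂_append_cons_iff.1 hN
    exact HasType.sub_iff.2 ⟨_, C, rfl, forall₂_append_cons_iff.2
      ⟨Δ₁, B, Δ₂, rfl, h1, ih h2, h3⟩, hM⟩

/-! ### Long normal forms -/

mutual
/-- The type of a term in a context, if it has one; otherwise the value is arbitrary. -/
def Tm.ty : Tm → Ctx → Ty
  | .var i, Γ => Γ.getD i (.atom 0)
  | .lam A M, Γ => .arr A (Tm.ty M (A :: Γ))
  | .app M _, Γ => match Tm.ty M Γ with
    | .arr _ B => B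
    | _ => .atom 0
  | .sub M Ns, Γ => .box (Tm.ty M (Tm.argTys Ns Γ))
/-- The context of the body of an explicit substitution with the given arguments. -/
def Tm.argTys : List Tm → Ctx → Ctx
  | [], _ => []
  | N :: Ns, Γ => (match Tm.ty N Γ with
    | .box B => B
    | _ => .atom 0) :: Tm.argTys Ns Γ
end

theorem argTys_eq {Γ Δ : Ctx} {Ns : List Tm} (ih : ∀ N ∈ Ns, ∀ B, HasType Γ N B → N.ty Γ = B)
    (h : List.Forall₂ (fun N B => HasType Γ N (.box B)) Ns Δ) : Tm.argTys Ns Γ = Δ := by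
  induction h with
  | nil => rfl
  | cons h _ ih' =>
    rw [Tm.argTys, ih _ (by simp) _ h, ih' fun N hN => ih N (by simp [hN])]

theorem HasType.ty_eq {Γ : Ctx} {M : Tm} {A : Ty} (h : HasType Γ M A) : M.ty Γ = A := by
  induction M generalizing Γ A with
  | var i => simp [Tm.ty, h.var_inv]
  | lam B M ih =>
    obtain ⟨C, rfl, hM⟩ := h.lam_inv
    rw [Tm.ty, ih hM]
  | app M N ihM _ =>
    obtain ⟨B, h1, h2⟩ := h.app_inv
    rw [Tm.ty, ihM h1]
  | sub M Ns ihM ih =>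
    obtain ⟨Δ, C, rfl, h1, h2⟩ := HasType.sub_iff.1 h
    rw [Tm.ty, argTys_eq (fun N hN B h => ih N hN h) h1, ihM h2]

theorem HasType.argTys_eq {Γ Δ : Ctx} {Ns : List Tm}
    (h : List.Forall₂ (fun N B => HasType Γ N (.box B)) Ns Δ) : Tm.argTys Ns Γ = Δ :=
  ModalLambda.argTys_eq (fun _ _ _ h => h.ty_eq) h

/-- The full `η`-expansion, at a type, of a term that is not an introduction.  An argument of an
explicit substitution may not be expanded at its root, so `M` reappears unchanged at type `□A`. -/
def expandNeutral : Ty → Tm → Tm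
  | .atom _, M => M
  | .arr A B, M =>
    .lam A (expandNeutral B (.app (M.rename Nat.succ) (expandNeutral A (.var 0))))
  | .box A, M => .sub (expandNeutral A (.var 0)) [M]

/-- The full `η`-expansion of a term at a type; introductions are left alone. -/
def expand (A : Ty) (M : Tm) : Tm := if M.isIntro then M else expandNeutral A M

mutual
/-- The result of performing all `η`-expansions in a term except that of the term itself. -/
def Tm.core : Tm → Ctx → Tm
  | .var i, _ => .var i
  | .lam A M, Γ => .lam A (expand (M.ty (A :: Γ)) (Tm.core M (A :: Γ)))
  | .app M N, Γ => .app (Tm.core M Γ) (expand (N.ty Γ) (Tm.core N Γ))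
  | .sub M Ns, Γ =>
    .sub (expand (M.ty (Tm.argTys Ns Γ)) (Tm.core M (Tm.argTys Ns Γ))) (Tm.coreList Ns Γ)
/-- The same for each term of a list. -/
def Tm.coreList : List Tm → Ctx → List Tm
  | [], _ => []
  | N :: Ns, Γ => Tm.core N Γ :: Tm.coreList Ns Γ
end

/-- The number of `η`-expansions that an unexpanded occurrence of the given type gives rise to. -/
def Ty.etaWeight : Ty → ℕ
  | .atom _ => 0
  | .arr A B => A.etaWeight + B.etaWeight + 1
  | .box A => A.etaWeight + 1

/-- The weight of an occurrence of a term at a type that may be expanded. -/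
def rootWeight (A : Ty) (M : Tm) : ℕ := if M.isIntro then 0 else A.etaWeight

mutual
/-- The total weight of the proper subterms of a term that may be expanded. -/
def Tm.etaMeasure : Tm → Ctx → ℕ
  | .var _, _ => 0
  | .lam A M, Γ => Tm.etaMeasure M (A :: Γ) + rootWeight (M.ty (A :: Γ)) M
  | .app M N, Γ => Tm.etaMeasure M Γ + (Tm.etaMeasure N Γ + rootWeight (N.ty Γ) N)
  | .sub M Ns, Γ => Tm.etaMeasure M (Tm.argTys Ns Γ) +
      rootWeight (M.ty (Tm.argTys Ns Γ)) M + Tm.etaMeasureList Ns Γ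
/-- The sum over a list of terms. -/
def Tm.etaMeasureList : List Tm → Ctx → ℕ
  | [], _ => 0
  | N :: Ns, Γ => Tm.etaMeasure N Γ + Tm.etaMeasureList Ns Γ
end

theorem coreList_eq_map (Ns : List Tm) (Γ : Ctx) :
    Tm.coreList Ns Γ = Ns.map fun N => N.core Γ := by
  induction Ns with
  | nil => rfl
  | cons N Ns ih => simp [Tm.coreList, ih]

theorem etaMeasureList_eq_sum (Ns : List Tm) (Γ : Ctx) :
    Tm.etaMeasureList Ns Γ = (Ns.map fun N => N.etaMeasure Γ).sum := by
  induction Ns with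
  | nil => rfl
  | cons N Ns ih => simp [Tm.etaMeasureList, ih]

theorem core_lam {Γ : Ctx} {A C : Ty} {M : Tm} (h : HasType (A :: Γ) M C) :
    (Tm.lam A M).core Γ = .lam A (expand C (M.core (A :: Γ))) := by
  rw [Tm.core, h.ty_eq]

theorem core_app {Γ : Ctx} {A : Ty} {M N : Tm} (h : HasType Γ N A) :
    (Tm.app M N).core Γ = .app (M.core Γ) (expand A (N.core Γ)) := by
  rw [Tm.core, h.ty_eq]

theorem core_sub {Γ Δ : Ctx} {C : Ty} {M : Tm} {Ns : List Tm}
    (hN : List.Forall₂ (fun N B => HasType Γ N (.box B)) Ns Δ) (hM : HasType Δ M C) :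
    (Tm.sub M Ns).core Γ = .sub (expand C (M.core Δ)) (Ns.map fun N => N.core Γ) := by
  rw [Tm.core, HasType.argTys_eq hN, hM.ty_eq, coreList_eq_map]

theorem etaMeasure_lam {Γ : Ctx} {A C : Ty} {M : Tm} (h : HasType (A :: Γ) M C) :
    (Tm.lam A M).etaMeasure Γ = M.etaMeasure (A :: Γ) + rootWeight C M := by
  rw [Tm.etaMeasure, h.ty_eq]

theorem etaMeasure_app {Γ : Ctx} {A : Ty} {M N : Tm} (h : HasType Γ N A) :
    (Tm.app M N).etaMeasure Γ = M.etaMeasure Γ + (N.etaMeasure Γ + rootWeight A N) := by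
  rw [Tm.etaMeasure, h.ty_eq]

theorem etaMeasure_sub {Γ Δ : Ctx} {C : Ty} {M : Tm} {Ns : List Tm}
    (hN : List.Forall₂ (fun N B => HasType Γ N (.box B)) Ns Δ) (hM : HasType Δ M C) :
    (Tm.sub M Ns).etaMeasure Γ =
      M.etaMeasure Δ + rootWeight C M + (Ns.map fun N => N.etaMeasure Γ).sum := by
  rw [Tm.etaMeasure, HasType.argTys_eq hN, hM.ty_eq, etaMeasureList_eq_sum]

@[simp] theorem isIntro_rename (M : Tm) (f : ℕ → ℕ) : (M.rename f).isIntro = M.isIntro := by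
  cases M <;> simp [Tm.isIntro]

@[simp] theorem isIntro_core (M : Tm) (Γ : Ctx) : (M.core Γ).isIntro = M.isIntro := by
  cases M <;> simp [Tm.isIntro, Tm.core]

theorem PE.isIntro_eq {M M' : Tm} (h : PE M M') : M.isIntro = M'.isIntro := by
  cases h <;> rfl

theorem expandNeutral_rename (A : Ty) (M : Tm) (f : ℕ → ℕ) :
    (expandNeutral A M).rename f = expandNeutral A (M.rename f) := by
  induction A generalizing M f with
  | atom a => rfl
  | arr A B ihA ihB =>
    simp only [expandNeutral, Tm.rename_lam, ihB, Tm.rename_app, ihA, Tm.rename_rename,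
      Tm.rename_var]
    rfl
  | box A ihA => simp [expandNeutral]

theorem expand_rename (A : Ty) (M : Tm) (f : ℕ → ℕ) :
    (expand A M).rename f = expand A (M.rename f) := by
  unfold expand
  rw [isIntro_rename]
  split_ifs
  · rfl
  · exact expandNeutral_rename A M f

theorem rootWeight_app (A : Ty) (M N : Tm) : rootWeight A (.app M N) = A.etaWeight := rfl

theorem rootWeight_sub (A : Ty) (M : Tm) (Ns : List Tm) : rootWeight A (.sub M Ns) = 0 := rfl

theorem rootWeight_rename (A : Ty) (M : Tm) (f : ℕ → ℕ) :
    rootWeight A (M.rename f) = rootWeight A M := by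
  unfold rootWeight
  rw [isIntro_rename]

/-- The core and the measure are compatible with renamings that respect types. -/
theorem HasType.core_rename {Γ Δ : Ctx} {M : Tm} {A : Ty} {f : ℕ → ℕ} (h : HasType Γ M A)
    (hf : ∀ i B, Γ[i]? = some B → Δ[f i]? = some B) :
    (M.rename f).core Δ = (M.core Γ).rename f ∧
      (M.rename f).etaMeasure Δ = M.etaMeasure Γ := by
  have hren : ∀ {N B}, HasType Γ N B → HasType Δ (N.rename f) B := fun hN =>
    hN.rename fun i B _ hB => hf i B hB
  induction M generalizing Γ Δ A f with
  | var i => exact ⟨rfl, rfl⟩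
  | lam B M ih =>
    obtain ⟨C, rfl, hM⟩ := h.lam_inv
    have hf' : ∀ i D, (B :: Γ)[i]? = some D → (B :: Δ)[upRen f i]? = some D := by
      intro i D hD
      cases i with
      | zero => simpa [upRen] using hD
      | succ i => simpa [upRen] using hf i D (by simpa using hD)
    have hren' : ∀ {N D}, HasType (B :: Γ) N D → HasType (B :: Δ) (N.rename (upRen f)) D :=
      fun hN => hN.rename fun i D _ hD => hf' i D hD
    obtain ⟨h1, h2⟩ := ih hM hf' hren'
    rw [Tm.rename_lam, core_lam hM, core_lam (hren' hM), etaMeasure_lam hM,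
      etaMeasure_lam (hren' hM), h1, h2, Tm.rename_lam, expand_rename, rootWeight_rename]
    exact ⟨rfl, rfl⟩
  | app M N ihM ihN =>
    obtain ⟨B, hM, hN⟩ := h.app_inv
    obtain ⟨h1, h2⟩ := ihM hM hf hren
    obtain ⟨h3, h4⟩ := ihN hN hf hren
    rw [Tm.rename_app, core_app hN, core_app (hren hN), etaMeasure_app hN,
      etaMeasure_app (hren hN), h1, h2, h3, h4, Tm.rename_app, expand_rename, rootWeight_rename]
    exact ⟨rfl, rfl⟩
  | sub M Ns _ ih =>
    obtain ⟨Θ, C, rfl, hN, hM⟩ := HasType.sub_iff.1 h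
    have hN' : List.Forall₂ (fun N B => HasType Δ N (.box B)) (Ns.map (Tm.rename f)) Θ := by
      rw [List.forall₂_map_left_iff]
      exact hN.imp fun _ _ h => hren h
    have hty : ∀ N ∈ Ns, ∃ B, HasType Γ N B := fun N hmem => by
      obtain ⟨h1, h2⟩ := typedArgs_iff.2 hN
      obtain ⟨B, hB⟩ := HasType.sub_inv_arg h1 h2 hmem
      exact ⟨_, hB⟩
    rw [Tm.rename_sub, core_sub hN hM, core_sub hN' hM, etaMeasure_sub hN hM,
      etaMeasure_sub hN' hM, Tm.rename_sub, List.map_map, List.map_map, List.map_map]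
    constructor
    · congr 1
      refine List.map_congr_left fun N hmem => ?_
      obtain ⟨B, hB⟩ := hty N hmem
      exact (ih N hmem hB hf hren).1
    · congr 2
      refine List.map_congr_left fun N hmem => ?_
      obtain ⟨B, hB⟩ := hty N hmem
      exact (ih N hmem hB hf hren).2

theorem PE.expandNeutral {M M' : Tm} (h : PE M M') (A : Ty) :
    PE (expandNeutral A M) (expandNeutral A M') := by
  induction A generalizing M M' with
  | atom a => exact h
  | arr A B _ ihB => exact .lam (ihB (.app (h.rename _) (.refl _)))
  | box A _ => exact h.arg _ [] []

theorem PE.expand {M M' : Tm} (h : PE M M') (A : Ty) : PE (expand A M) (expand A M') := by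
  unfold ModalLambda.expand
  rw [h.isIntro_eq]
  split_ifs
  · exact h
  · exact h.expandNeutral A

theorem PE.rootWeight_eq {M M' : Tm} (h : PE M M') (A : Ty) :
    rootWeight A M = rootWeight A M' := by
  unfold rootWeight
  rw [h.isIntro_eq]

/-- The core, up to permutations, and the measure are invariant under permutations. -/
theorem PE.core {M M' : Tm} (h : PE M M') {Γ : Ctx} {A : Ty} (hM : HasType Γ M A) :
    PE (M.core Γ) (M'.core Γ) ∧ M.etaMeasure Γ = M'.etaMeasure Γ := by
  induction h generalizing Γ A with
  | var i => exact ⟨.var i, rfl⟩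
  | lam h ih =>
    obtain ⟨C, rfl, hM'⟩ := hM.lam_inv
    obtain ⟨h1, h2⟩ := ih hM'
    rw [core_lam hM', core_lam (h.hasType hM'), etaMeasure_lam hM',
      etaMeasure_lam (h.hasType hM'), h2, h.rootWeight_eq]
    exact ⟨.lam (h1.expand C), rfl⟩
  | app hM' hN' ihM ihN =>
    obtain ⟨B, hM, hN⟩ := hM.app_inv
    obtain ⟨h1, h2⟩ := ihM hM
    obtain ⟨h3, h4⟩ := ihN hN
    rw [core_app hN, core_app (hN'.hasType hN), etaMeasure_app hN,
      etaMeasure_app (hN'.hasType hN), h2, h4, hN'.rootWeight_eq]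
    exact ⟨.app h1 (h3.expand B), rfl⟩
  | @sub M M' Ns Ns' σ hl hσ hMM hNN ihM ih =>
    obtain ⟨Δ, C, rfl, hlΔ, hN, hM⟩ := hM.sub_inv
    obtain ⟨Δ', hlen, hΔ⟩ := exists_perm_ctx Δ (σ := σ) fun i hi => hσ i (hlΔ ▸ hi)
    have hMσ : HasType Δ' (M.rename σ) C := hM.rename fun i B _ hB => by rw [hΔ, hB]
    have hM' := hMM.hasType hMσ
    have hN' : List.Forall₂ (fun N B => HasType Γ N (.box B)) Ns' Δ' := by
      refine typedArgs_iff.1 ⟨by omega, fun i B hB => ?_⟩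
      obtain ⟨j, rfl⟩ := σ.surjective i
      exact (hNN j).hasType (hN j B (by rw [← hΔ, hB]))
    obtain ⟨h1, h2⟩ := hM.core_rename (Δ := Δ') (f := σ) fun i B hB => by rw [hΔ, hB]
    obtain ⟨h3, h4⟩ := ihM hMσ
    have hNs := typedArgs_iff.1 ⟨hlΔ, hN⟩
    have hty : ∀ i < Ns.length, HasType Γ (nth Ns i) (.box (Δ.getD i (.atom 0))) := fun i hi =>
      hN i _ (by simp [hlΔ ▸ hi])
    rw [core_sub hNs hM, core_sub hN' hM', etaMeasure_sub hNs hM, etaMeasure_sub hN' hM']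
    constructor
    · refine .sub σ (by simpa using hl) (by simpa using hσ) ?_
        (nth_map_pe hl hσ fun i hi => (ih i (hty i hi)).1)
      rw [expand_rename, ← h1]
      exact h3.expand C
    · rw [← h2, h4, ← rootWeight_rename C M σ, hMM.rootWeight_eq,
        sum_map_perm (fun N => N.etaMeasure Γ) (fun N => N.etaMeasure Γ) hl hσ
          fun i hi => (ih i (hty i hi)).2]

/-! ### Strong normalization and confluence of `η` -/

/-- A step does not change the long normal form, nor the core if it is not at the root. -/
theorem EtaRed.expand_core {Γ : Ctx} {b : Bool} {M N : Tm} {T : Ty} (h : EtaRed Γ b M N)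
    (hT : HasType Γ M T) : expand T (M.core Γ) = expand T (N.core Γ) ∧
      (b = false → M.core Γ = N.core Γ) := by
  have hof : ∀ {M N : Tm}, M.core Γ = N.core Γ → expand T (M.core Γ) = expand T (N.core Γ) ∧
      (b = false → M.core Γ = N.core Γ) := fun h => ⟨by rw [h], fun _ => h⟩
  induction h generalizing T with
  | @expandArr Γ M A B hM hi =>
    cases hM.unique hT
    refine ⟨?_, fun h => by cases h⟩
    have h1 : HasType (A :: Γ) (.var 0) A := .id rfl
    have h2 : HasType (A :: Γ) (.app (M.rename Nat.succ) (.var 0)) B := .app h1 (hM.weaken _)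
    rw [core_lam h2, core_app h1, (hM.core_rename fun i B hB => by simpa using hB).1]
    simp [expand, hi, expandNeutral, Tm.core]
  | @expandBox Γ M A hM hi =>
    cases hM.unique hT
    refine ⟨?_, fun h => by cases h⟩
    rw [core_sub (Δ := [A]) (.cons hM .nil) (.id rfl)]
    simp [expand, hi, expandNeutral, Tm.core]
  | lam h ih =>
    obtain ⟨C, rfl, hM⟩ := hT.lam_inv
    apply hof
    rw [core_lam hM, core_lam (h.hasType hM),
      (ih hM fun h => ⟨by rw [h], fun _ => h⟩).1]
  | appL h ih =>
    obtain ⟨C, hM, hN⟩ := hT.app_inv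
    apply hof
    rw [core_app hN, core_app hN, (ih hM fun h => ⟨by rw [h], fun _ => h⟩).2 rfl]
  | appR h ih =>
    obtain ⟨C, hM, hN⟩ := hT.app_inv
    apply hof
    rw [core_app hN, core_app (h.hasType hN), (ih hN fun h => ⟨by rw [h], fun _ => h⟩).1]
  | body hPs h ih =>
    obtain ⟨Δ, C, rfl, h1, h2⟩ := HasType.sub_iff.1 hT
    obtain rfl := typedArgs_unique hPs h1
    apply hof
    rw [core_sub h1 h2, core_sub h1 (h.hasType h2), (ih h2 fun h => ⟨by rw [h], fun _ => h⟩).1]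
  | arg h ih =>
    obtain ⟨Δ, C, rfl, hN, hM⟩ := HasType.sub_iff.1 hT
    obtain ⟨Δ₁, B, Δ₂, rfl, h1, h2, h3⟩ := forall₂_append_cons_iff.1 hN
    have hN' := forall₂_append_cons_iff.2 ⟨Δ₁, B, Δ₂, rfl, h1, h.hasType h2, h3⟩
    apply hof
    rw [core_sub hN hM, core_sub hN' hM]
    simp [(ih h2 fun h => ⟨by rw [h], fun _ => h⟩).2 rfl]

/-- A step decreases the total weight.  Expanding a term of type `A → B` trades its weight for those
of the new variable of type `A` and of the new application of type `B`, and expanding a term of type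
`□A` for that of the new variable of type `A`. -/
theorem EtaRed.etaMeasure_lt {Γ : Ctx} {b : Bool} {M N : Tm} {T : Ty} (h : EtaRed Γ b M N)
    (hT : HasType Γ M T) :
    N.etaMeasure Γ + rootWeight T N < M.etaMeasure Γ + rootWeight T M ∧
      (b = false → N.etaMeasure Γ < M.etaMeasure Γ) := by
  induction h generalizing T with
  | @expandArr Γ M A B hM hi =>
    cases hM.unique hT
    refine ⟨?_, fun h => by cases h⟩
    have h1 : HasType (A :: Γ) (.var 0) A := .id rfl
    have h2 : HasType (A :: Γ) (.app (M.rename Nat.succ) (.var 0)) B := .app h1 (hM.weaken _)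
    rw [etaMeasure_lam h2, etaMeasure_app h1, (hM.core_rename fun i B hB => by simpa using hB).2]
    simp [rootWeight, hi, Tm.etaMeasure, Ty.etaWeight]
    omega
  | @expandBox Γ M A hM hi =>
    cases hM.unique hT
    refine ⟨?_, fun h => by cases h⟩
    rw [etaMeasure_sub (Δ := [A]) (.cons hM .nil) (.id rfl)]
    simp [rootWeight, hi, Tm.etaMeasure, Ty.etaWeight]
    omega
  | lam h ih =>
    obtain ⟨C, rfl, hM⟩ := hT.lam_inv
    rw [etaMeasure_lam hM, etaMeasure_lam (h.hasType hM)]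
    exact ⟨Nat.add_lt_add_right (ih hM).1 _, fun _ => (ih hM).1⟩
  | appL h ih =>
    obtain ⟨C, hM, hN⟩ := hT.app_inv
    rw [etaMeasure_app hN, etaMeasure_app hN]
    have := (ih hM).2 rfl
    simp only [rootWeight_app]
    omega
  | appR h ih =>
    obtain ⟨C, hM, hN⟩ := hT.app_inv
    rw [etaMeasure_app hN, etaMeasure_app (h.hasType hN)]
    have := (ih hN).1
    simp only [rootWeight_app]
    omega
  | body hPs h ih =>
    obtain ⟨Δ, C, rfl, h1, h2⟩ := HasType.sub_iff.1 hT
    obtain rfl := typedArgs_unique hPs h1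
    rw [etaMeasure_sub h1 h2, etaMeasure_sub h1 (h.hasType h2)]
    have := (ih h2).1
    simp only [rootWeight_sub]
    omega
  | arg h ih =>
    obtain ⟨Δ, C, rfl, hN, hM⟩ := HasType.sub_iff.1 hT
    obtain ⟨Δ₁, B, Δ₂, rfl, h1, h2, h3⟩ := forall₂_append_cons_iff.1 hN
    have hN' := forall₂_append_cons_iff.2 ⟨Δ₁, B, Δ₂, rfl, h1, h.hasType h2, h3⟩
    rw [etaMeasure_sub hN hM, etaMeasure_sub hN' hM]
    have := (ih h2).2 rfl
    simp only [rootWeight_sub, List.map_append, List.map_cons, List.sum_append,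
      List.sum_cons]
    omega

/-- Sequences of restricted `η`-expansions. -/
abbrev EtaStar (Γ : Ctx) (b : Bool) : Tm → Tm → Prop := ReflTransGen (EtaRed Γ b)

theorem EtaStar.hasType {Γ : Ctx} {b : Bool} {M N : Tm} {A : Ty} (h : EtaStar Γ b M N)
    (hM : HasType Γ M A) : HasType Γ N A := by
  induction h with
  | refl => exact hM
  | tail _ hs ih => exact hs.hasType ih

theorem EtaStar.app {Γ : Ctx} {M M' N N' : Tm} (b : Bool) (h1 : EtaStar Γ false M M')
    (h2 : EtaStar Γ true N N') : EtaStar Γ b (.app M N) (.app M' N') :=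
  (h1.lift (fun M => Tm.app M N) fun _ _ => EtaRed.appL).trans
    (h2.lift (fun N => Tm.app M' N) fun _ _ => EtaRed.appR)

theorem EtaStar.args {Γ : Ctx} {Ns Ns' : List Tm} (b : Bool) (P : Tm)
    (h : List.Forall₂ (EtaStar Γ false) Ns Ns') (Ps : List Tm) :
    EtaStar Γ b (.sub P (Ps ++ Ns)) (.sub P (Ps ++ Ns')) := by
  induction h generalizing Ps with
  | nil => exact .refl
  | @cons N N' Ns Ns' h _ ih =>
    refine (h.lift (fun M => Tm.sub P (Ps ++ M :: Ns)) fun _ _ => EtaRed.arg).trans ?_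
    simpa using ih (Ps ++ [N'])

theorem HasType.etaStar_expandNeutral {Γ : Ctx} {M : Tm} {A : Ty} (hM : HasType Γ M A)
    (hi : M.isIntro = false) : EtaStar Γ true M (expandNeutral A M) := by
  induction A generalizing Γ M with
  | atom a => exact .refl
  | arr A B ihA ihB =>
    have h1 : HasType (A :: Γ) (.var 0) A := .id rfl
    have h2 := ihA h1 rfl
    have h3 := (EtaStar.app true .refl h2).trans (ihB (.app (h2.hasType h1) (hM.weaken _)) rfl)
    exact .head (.expandArr hM hi) (h3.lift (Tm.lam A) fun _ _ => EtaRed.lam)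
  | box A ihA =>
    have h := ihA (Γ := [A]) (M := .var 0) (.id rfl) rfl
    exact .head (.expandBox hM hi)
      (h.lift (fun P => Tm.sub P [M]) fun _ _ => EtaRed.body (.cons hM .nil))

theorem HasType.etaStar_expand {Γ : Ctx} {M : Tm} {A : Ty} (hM : HasType Γ M A) :
    EtaStar Γ true M (expand A M) := by
  unfold expand
  split_ifs with h
  · exact .refl
  · exact hM.etaStar_expandNeutral (by simpa using h)

theorem EtaStar.expand {Γ : Ctx} {M : Tm} {A : Ty} (h : EtaStar Γ false M (M.core Γ))
    (hM : HasType Γ M A) : EtaStar Γ true M (expand A (M.core Γ)) :=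
  (h.lift id fun _ _ => EtaRed.mono).trans (h.hasType hM).etaStar_expand

/-- Every typed term reduces to its core without being expanded at its root. -/
theorem HasType.etaStar_core {Γ : Ctx} {M : Tm} {A : Ty} (hM : HasType Γ M A) :
    EtaStar Γ false M (M.core Γ) := by
  induction M generalizing Γ A with
  | var i => exact .refl
  | lam B M ih =>
    obtain ⟨C, rfl, hM'⟩ := hM.lam_inv
    rw [core_lam hM']
    exact ((ih hM').expand hM').lift (Tm.lam B) fun _ _ => EtaRed.lam
  | app M N ihM ihN =>
    obtain ⟨B, hM, hN⟩ := hM.app_inv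
    rw [core_app hN]
    exact EtaStar.app false (ihM hM) ((ihN hN).expand hN)
  | sub M Ns ihM ih =>
    obtain ⟨Δ, C, rfl, hN, hM⟩ := HasType.sub_iff.1 hM
    rw [core_sub hN hM]
    refine (((ihM hM).expand hM).lift (fun M => Tm.sub M Ns) fun _ _ => EtaRed.body hN).trans
      (EtaStar.args false _ ?_ [])
    rw [List.forall₂_map_right_iff, List.forall₂_same]
    intro N hmem
    obtain ⟨h1, h2⟩ := typedArgs_iff.2 hN
    obtain ⟨B, hB⟩ := HasType.sub_inv_arg h1 h2 hmem
    exact ih N hmem hB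

theorem HasType.eta_lift {Γ : Ctx} {M : Tm} {A : Ty} (hM : HasType Γ M A) {t : Term}
    (h : Eta Γ (cls M) t) : ∃ M' N, t = cls N ∧ PE M M' ∧ EtaRed Γ true M' N := by
  obtain ⟨M', N, hs, hM', rfl⟩ := h
  have hpe := (mk_eq_mk.1 hM').symm
  exact ⟨M', N, rfl, hpe, hs.etaRed (hpe.hasType hM)⟩

theorem eta_cls {Γ : Ctx} {M N : Tm} (h : EtaRed Γ true M N) : Eta Γ (cls M) (cls N) :=
  ⟨M, N, h.etaStep, rfl, rfl⟩

theorem Typed.eta_stronglyNormalizing {Γ : Ctx} {t : Term} {A : Ty} (ht : Typed Γ t A) :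
    StronglyNormalizing (Eta Γ) t := by
  obtain ⟨M, rfl, hM⟩ := ht
  generalize hn : M.etaMeasure Γ + rootWeight A M = n
  induction n using Nat.strong_induction_on generalizing M with
  | _ n ih =>
    refine ⟨_, fun t ht => ?_⟩
    obtain ⟨M', N, rfl, hpe, hs⟩ := hM.eta_lift ht
    have hM' := hpe.hasType hM
    refine ih _ ?_ N (hs.hasType hM') rfl
    rw [← hn, (hpe.core hM).2, hpe.rootWeight_eq]
    exact (hs.etaMeasure_lt hM').1

theorem HasType.eta_lift_star {Γ : Ctx} {M : Tm} {A : Ty} (hM : HasType Γ M A) {t : Term}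
    (h : ReflTransGen (Eta Γ) (cls M) t) : ∃ N, t = cls N ∧ HasType Γ N A ∧
      PE (expand A (M.core Γ)) (expand A (N.core Γ)) := by
  induction h with
  | refl => exact ⟨M, rfl, hM, .refl _⟩
  | tail _ hs ih =>
    obtain ⟨N, rfl, hN, h1⟩ := ih
    obtain ⟨N', P, rfl, hpe, h2⟩ := hN.eta_lift hs
    have hN' := hpe.hasType hN
    exact ⟨P, rfl, h2.hasType hN', (h2.expand_core hN').1 ▸ h1.trans ((hpe.core hN).1.expand A)⟩

theorem Typed.eta_confluent {Γ : Ctx} {t : Term} {A : Ty} (ht : Typed Γ t A) :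
    Confluent (Eta Γ) t := by
  obtain ⟨M, rfl, hM⟩ := ht
  have key : ∀ u, ReflTransGen (Eta Γ) (cls M) u →
      ReflTransGen (Eta Γ) u (cls (expand A (M.core Γ))) := by
    intro u hu
    obtain ⟨N, rfl, hN, h⟩ := hM.eta_lift_star hu
    have hcls : cls (expand A (M.core Γ)) = cls (expand A (N.core Γ)) := mk_eq_mk.2 h
    rw [hcls]
    exact (hN.etaStar_core.expand hN).lift cls fun _ _ => eta_cls
  exact fun u v hu hv => ⟨_, key u hu, key v hv⟩

end ModalLambda

theorem mainTheorem2 :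
    (∀ (Γ : ModalLambda.Ctx) (t : ModalLambda.Term) (A : ModalLambda.Ty),
      ModalLambda.Typed Γ t A →
        ModalLambda.StronglyNormalizing ModalLambda.Beta t ∧
        ModalLambda.Confluent ModalLambda.Beta t) ∧
    (∀ (Γ : ModalLambda.Ctx) (t : ModalLambda.Term) (A : ModalLambda.Ty),
      ModalLambda.Typed Γ t A →
        ModalLambda.StronglyNormalizing (ModalLambda.Eta Γ) t ∧
        ModalLambda.Confluent (ModalLambda.Eta Γ) t) ∧
    (∀ (Γ : ModalLambda.Ctx) (t : ModalLambda.Term) (A : ModalLambda.Ty),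
      ModalLambda.Typed Γ t A →
        ModalLambda.StronglyNormalizing ModalLambda.Kappa t ∧
        ModalLambda.Confluent ModalLambda.Kappa t) :=
  ⟨fun _ _ _ h => ⟨h.beta_stronglyNormalizing, h.beta_confluent⟩,
    fun _ _ _ h => ⟨h.eta_stronglyNormalizing, h.eta_confluent⟩,
    fun _ t _ h => ⟨ModalLambda.kappa_stronglyNormalizing t, h.kappa_confluent⟩⟩
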